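/- **Setting.** For each sample size $n$ consider the model $Y=\tilde Y+E$, $\tilde Y=\sum_{j=1}^{p_n}X_jB_j^*$, with random predictor matrices $X_j\in\mathbb R^{n\times q_{n,j}}$, random noise $E\in\mathbb R^{n\times d_n}$ and deterministic coefficients $B_j^*\in\mathbb R^{q_{n,j}\times d_n}$ ($p_n,d_n,q_{n,j}\ge1$). Write $\|\cdot\|_F,\|\cdot\|_{op},\|\cdot\|_*$ for the Frobenius, operator and nuclear norms, $\langle A,B\rangle=\mathrm{tr}(A^\top B)$, $\sigma_1\ge\sigma_2\ge\dots$ for singular values, $a\wedge b=\min\{a,b\}$. Put $\hat\Sigma_j=n^{-1}X_j^\top X_j$, $\xi_E=\max_j\|X_j^\top E\|_{op}$, $J_n=\{j:B_j^*\ne0\}$, $r_j^*=\mathrm{rank}(B_j^*)$, $\bar r_j=\mathrm{rank}(X_j^\top\tilde Y)$, $J_o=\{j\in J_n:q_{n,j}\wedge d_n>\bar r_j\}$. $x_n=O_p(y_n)$ means that for every $\epsilon>0$ there is $M_\epsilon<\infty$ with $\limsup_n\mathbb P(x_n/y_n>M_\epsilon)<\epsilon$; $x_n=o_p(y_n)$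 means $\mathbb P(x_n/y_n<\epsilon)\to1$ for every $\epsilon>0$. **Assumptions.** With constants $0<\mu,M_o<\infty$ and $L<\infty$, natural numbers $K_n\to\infty$, a positive non-decreasing sequence $s_n$ and a positive sequence $\delta_n$: * (C1) with probability approaching one (w.p.a.1), all eigenvalues of all $\hat\Sigma_j$ lie in $[\mu^{-1},\mu]$; * (C2) $K_n\xi_E=O_p(nd_n^{1/2})$; * (C3) w.p.a.1, $\lambda_{\min}(n^{-1}X(J)^\top X(J))>\mu^{-1}$ for all $J$ with at most $2K_n$ elements, where $X(J)=(X_j:j\in J)$; * (C4) $d_n^{-1/2}\sum_j\|B_j^*\|_*\le L$, $s_n^2=o(K_n)$ and $\sigma_{r_j^*}^2(d_n^{-1/2}B_j^*)\ge s_n^{-1}$ for all $j\in J_n$; * (C5) $\xi_E=o_p(n\delta_n)$ and, w.p.a.1, $\sigma_{\bar r_j}(X_j^\top\tilde Y)\ge n\delta_n$ for all $j\in J_o$; * (C6) w.p.a.1, for every $j\in J_o$ there is an $\bar r_j\times\bar r_j$ matrix $\Lambda_j$ with $\hat\Sigma_jB_j^*=\tilde U_j\Lambda_j\tilde V_j^\top$,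 the columns of $\tilde U_j,\tilde V_j$ being the $\bar r_j$ leading pairs of singular vectors of $X_j^\top\tilde Y$; * w.p.a.1, $M_o^{-1}\le(nd_n)^{-1}\|E\|_F^2\le M_o$. Let $\epsilon_L<1$, $1-\epsilon_L\le\mu^{-2}/4$, $L_0>0$, $L_0\ge L/(1-\epsilon_L)$ and $L_n=d_n^{1/2}L_0$. **Algorithm.** First stage: $\hat G^{(0)}=0$, $\hat B_j^{(0)}=0$; for $k=1,\dots,K_n$ choose $(\hat j_k,\tilde B_{\hat j_k})$ maximizing $\langle Y-\hat G^{(k-1)},X_jB\rangle$ over $1\le j\le p_n$, $\|B\|_*\le L_n$, with a maximizer of the form $\tilde B_{\hat j_k}=L_nuv^\top$, $u,v$ unit vectors; choose $\hat\lambda_k\in[0,1]$ minimizing $\|Y-(1-\lambda)\hat G^{(k-1)}-\lambda X_{\hat j_k}\tilde B_{\hat j_k}\|_F^2$; set $\hat G^{(k)}=(1-\hat\lambda_k)\hat G^{(k-1)}+\hat\lambda_kX_{\hat j_k}\tilde B_{\hat j_k}$ and update the coefficients $\hat B_j^{(k)}$ accordingly. With $\hat\sigma_k^2=(nd_n)^{-1}\|Y-\hat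 G^{(k)}\|_F^2$ and a threshold $t_n$, let $\hat k$ be the first $1\le k\le K_n$ with $\hat\sigma_k^2\ge(1-t_n)\hat\sigma_{k-1}^2$, and $\hat k=K_n$ if there is none. Let $\hat J=\{\hat j_1,\dots,\hat j_{\hat k}\}$, $\hat r=\sum_{j\in\hat J}\mathrm{rank}(\hat B_j^{(\hat k)})$, $\hat J_o=\{j\in\hat J:\hat r<q_{n,j}\wedge d_n\}$ and $$\kappa_n=\sharp(\hat J)\max\Big\{\max_{j\in\hat J-\hat J_o}(q_{n,j}\wedge d_n),\ \hat r\,\mathbf 1\{\hat J_o\ne\emptyset\}\Big\}.$$ Second stage: for $j\in\hat J$ let $U_j,V_j$ be formed by the leading $\hat r$ pairs of singular vectors of $X_j^\top Y$ if $j\in\hat J_o$, and by the full sets of singular vectors otherwise. Restart from $\hat G^{(0)}=0$ and repeat the same scheme for $K_n$ steps, maximizing $\langle Y-\hat G^{(k-1)},X_j\hat\Sigma_j^{-1}U_jSV_j^\top\rangle$ over $j\in\hat J$ and $\|S\|_*\le L_n$ ($S$ of size $\hat r\times\hat r$ if $j\in\hat J_o$, $q_{n,j}\times d_n$ otherwise),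 with a maximizer $\hat S_k=L_nab^\top$, $a,b$ unit vectors (if $\hat r=0$ and $j\in\hat J_o$, $\hat S_k$ is the empty matrix), and with $X_{\hat j_k}\hat\Sigma_{\hat j_k}^{-1}U_{\hat j_k}\hat S_kV_{\hat j_k}^\top$ in place of $X_{\hat j_k}\tilde B_{\hat j_k}$ in the line search and the update. **Theorem 3.** If $t_n=Cs_n^{-2}$ with $C>0$ small enough (depending only on $\mu,L,\epsilon_L,L_0,M_o$), then for every $\tau\in(0,1)$ the second-stage iterates satisfy $$\max_{1\le m\le K_n}\frac{(nd_n)^{-1}\|\tilde Y-\hat G^{(m)}\|_F^2}{\left(1-\frac{\tau^2}{64\mu^5\kappa_n}\right)^m+\frac{(m+\kappa_n)\xi_E^2}{n^2d_n}+\frac{\xi_E^2}{\delta_n^2n^2}\mathbf 1\{J_o\ne\emptyset\}}=O_p(1),$$ where $\tau^2/(64\mu^5\kappa_n)$ is read as $0$ if $\kappa_n=0$. -/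

import Mathlib

open Filter Topology MeasureTheory Matrix

namespace TSRGA

/-! ### Matrix notions -/

/-- The trace inner product `⟨A, B⟩ = tr(Aᵀ B)`. -/
def trInner {m n : ℕ} (A B : Matrix (Fin m) (Fin n) ℝ) : ℝ := (Aᵀ * B).trace

open scoped Matrix.Norms.Frobenius in
/-- The Frobenius norm. -/
noncomputable def frobNorm {m n : ℕ} (A : Matrix (Fin m) (Fin n) ℝ) : ℝ := ‖A‖

open scoped Matrix.Norms.L2Operator in
/-- The operator norm (for the Euclidean norms). -/
noncomputable def opNorm {m n : ℕ} (A : Matrix (Fin m) (Fin n) ℝ) : ℝ := ‖A‖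

/-- The sequence of singular values, in descending order: `singVal A i` is `σ_{i+1}(A)`
(and it is `0` for `i ≥ rank A`). -/
noncomputable def singVal {m n : ℕ} (A : Matrix (Fin m) (Fin n) ℝ) : ℕ →₀ ℝ :=
  (Matrix.toEuclideanLin A).singularValues

/-- The nuclear norm, the sum of the singular values. -/
noncomputable def nuclearNorm {m n : ℕ} (A : Matrix (Fin m) (Fin n) ℝ) : ℝ :=
  (singVal A).sum fun _ x => x

/-- The columns of `U` and of `V` are full sets of left and right singular vectors of `A`, ordered
by descending singular value: `A = U Σ Vᵀ` is a full singular value decomposition. -/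
def IsSVD {m n : ℕ} (A : Matrix (Fin m) (Fin n) ℝ) (U : Matrix (Fin m) (Fin m) ℝ)
    (V : Matrix (Fin n) (Fin n) ℝ) : Prop :=
  U ∈ Matrix.orthogonalGroup (Fin m) ℝ ∧ V ∈ Matrix.orthogonalGroup (Fin n) ℝ ∧
    A = U * (Matrix.of fun i k => if i.val = k.val then singVal A i.val else 0 :
      Matrix (Fin m) (Fin n) ℝ) * Vᵀ

/-- The first `r` columns of a square matrix. -/
def leadingCols {m r : ℕ} (h : r ≤ m) (U : Matrix (Fin m) (Fin m) ℝ) :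
    Matrix (Fin m) (Fin r) ℝ :=
  U.submatrix id (Fin.castLE h)

/-- `S = c a bᵀ` for unit vectors `a` and `b` (a matrix without rows or columns, for which there
are no unit vectors, qualifies). -/
def IsScaledRankOne {m n : ℕ} (c : ℝ) (S : Matrix (Fin m) (Fin n) ℝ) : Prop :=
  ∃ (a : Fin m → ℝ) (b : Fin n → ℝ), S = c • Matrix.vecMulVec a b ∧
    (0 < m → a ⬝ᵥ a = 1) ∧ (0 < n → b ⬝ᵥ b = 1)

/-! ### The regression model at a fixed sample -/

/-- Predictor matrices `X_j`, of size `n × q_j`. -/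
abbrev Predictors {p : ℕ} (n : ℕ) (q : Fin p → ℕ) := ∀ j, Matrix (Fin n) (Fin (q j)) ℝ

/-- Families of coefficient matrices `B_j`, of size `q_j × d`. -/
abbrev Coefs {p : ℕ} (q : Fin p → ℕ) (d : ℕ) := ∀ j, Matrix (Fin (q j)) (Fin d) ℝ

section Sample

variable {n p d : ℕ} {q : Fin p → ℕ}

/-- The noiseless response `∑_j X_j B_j`. -/
def signal (X : Predictors n q) (B : Coefs q d) : Matrix (Fin n) (Fin d) ℝ := ∑ j, X j * B j

/-- `Σ̂_j = n⁻¹ X_jᵀ X_j`. -/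
noncomputable def sigmaHat (X : Predictors n q) (j : Fin p) : Matrix (Fin (q j)) (Fin (q j)) ℝ :=
  (n : ℝ)⁻¹ • ((X j)ᵀ * X j)

/-- The matrix `X(J) = (X_j : j ∈ J)` with the columns of all `X_j`, `j ∈ J`. -/
def stacked (X : Predictors n q) (J : Finset (Fin p)) :
    Matrix (Fin n) ((j : J) × Fin (q j)) ℝ :=
  Matrix.of fun i c => X c.1 i c.2

/-- `ξ_E = max_j ‖X_jᵀ E‖_op`. -/
noncomputable def xiE (X : Predictors n q) (E : Matrix (Fin n) (Fin d) ℝ) : ℝ :=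
  ⨆ j, opNorm ((X j)ᵀ * E)

/-- The indices of the relevant predictors. -/
def relevant (B : Coefs q d) : Set (Fin p) := {j | B j ≠ 0}

/-- `r̄_j = rank(X_jᵀ Ỹ)`. -/
noncomputable def rbar (X : Predictors n q) (B : Coefs q d) (j : Fin p) : ℕ :=
  ((X j)ᵀ * signal X B).rank

/-- `J_o`, the relevant predictors with `min(q_j, d) > r̄_j`. -/
def largeRelevant (X : Predictors n q) (B : Coefs q d) : Set (Fin p) :=
  {j | j ∈ relevant B ∧ rbar X B j < min (q j) d}

theorem rbar_le_left (X : Predictors n q) (B : Coefs q d) (j : Fin p) : rbar X B j ≤ q j :=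
  Matrix.rank_le_height _

theorem rbar_le_right (X : Predictors n q) (B : Coefs q d) (j : Fin p) : rbar X B j ≤ d :=
  Matrix.rank_le_width _

/-- Local revelation at the predictor `j`: `Σ̂_j B_j = Ũ Λ Ṽᵀ`, where `Ũ` and `Ṽ` consist of the
leading `r̄_j` pairs of singular vectors of `X_jᵀ Ỹ`. -/
def LocalRevelation (X : Predictors n q) (B : Coefs q d) (j : Fin p) : Prop :=
  ∃ U V, IsSVD ((X j)ᵀ * signal X B) U V ∧
    ∃ Lam : Matrix (Fin (rbar X B j)) (Fin (rbar X B j)) ℝ,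
      sigmaHat X j * B j =
        leadingCols (rbar_le_left X B j) U * Lam * (leadingCols (rbar_le_right X B j) V)ᵀ

/-! ### Relaxed greedy algorithms -/

/-- The choices made by a relaxed greedy algorithm: at step `k = 1, 2, …` a predictor `ĵ_k`, a
coefficient matrix for it, and a step size `λ̂_k`. (The values at `k = 0` are not used.) -/
structure RGAPath (q : Fin p → ℕ) (d : ℕ) where
  jhat : ℕ → Fin p
  atom : ∀ k, Matrix (Fin (q (jhat k))) (Fin d) ℝ
  lam : ℕ → ℝ

/-- The fitted values `Ĝ^{(k)}`. -/
noncomputable def RGAPath.fit (R : RGAPath q d) (X : Predictors n q) :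
    ℕ → Matrix (Fin n) (Fin d) ℝ
  | 0 => 0
  | k + 1 => (1 - R.lam (k + 1)) • R.fit X k +
      R.lam (k + 1) • (X (R.jhat (k + 1)) * R.atom (k + 1))

/-- The coefficient estimates `B̂_j^{(k)}`, so that `Ĝ^{(k)} = ∑_j X_j B̂_j^{(k)}`. -/
noncomputable def RGAPath.coef (R : RGAPath q d) : ℕ → Coefs q d
  | 0 => fun _ => 0
  | k + 1 => fun j => (1 - R.lam (k + 1)) • R.coef k j +
      R.lam (k + 1) • (Pi.single (R.jhat (k + 1)) (R.atom (k + 1)) : Coefs q d) j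

/-- The step size `λ̂_k` is an exact line search over `[0, 1]` for the response `Y`. -/
def RGAPath.LineSearch (R : RGAPath q d) (X : Predictors n q) (Y : Matrix (Fin n) (Fin d) ℝ)
    (k : ℕ) : Prop :=
  R.lam k ∈ Set.Icc (0 : ℝ) 1 ∧
    IsMinOn (fun l : ℝ => frobNorm (Y - (1 - l) • R.fit X (k - 1) -
      l • (X (R.jhat k) * R.atom k)) ^ 2) (Set.Icc 0 1) (R.lam k)

/-- `R` is a run over `K` steps of the first-stage algorithm for data `(X, Y)` with nuclear norm
bound `Ln`. The maximizing coefficient matrix is `Ln u vᵀ` with `u`, `v` unit vectors. -/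
def RGAPath.IsFirstStage (R : RGAPath q d) (X : Predictors n q) (Y : Matrix (Fin n) (Fin d) ℝ)
    (Ln : ℝ) (K : ℕ) : Prop :=
  ∀ k, 1 ≤ k → k ≤ K →
    nuclearNorm (R.atom k) ≤ Ln ∧
    IsScaledRankOne Ln (R.atom k) ∧
    (∀ (j : Fin p) (B : Matrix (Fin (q j)) (Fin d) ℝ), nuclearNorm B ≤ Ln →
      trInner (Y - R.fit X (k - 1)) (X j * B) ≤
        trInner (Y - R.fit X (k - 1)) (X (R.jhat k) * R.atom k)) ∧
    R.LineSearch X Y k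

/-- The training error `σ̂_k² = (n d)⁻¹ ‖Y - Ĝ^{(k)}‖_F²`. -/
noncomputable def RGAPath.trainErr (R : RGAPath q d) (X : Predictors n q)
    (Y : Matrix (Fin n) (Fin d) ℝ) (k : ℕ) : ℝ :=
  ((n : ℝ) * d)⁻¹ * frobNorm (Y - R.fit X k) ^ 2

open Classical in
/-- The just-in-time stopping time `k̂`: the first `1 ≤ k ≤ K` with `σ̂_k² / σ̂_{k-1}² ≥ 1 - t`
(written without the division), and `K` if there is none. -/
noncomputable def RGAPath.stopTime (R : RGAPath q d) (X : Predictors n q)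
    (Y : Matrix (Fin n) (Fin d) ℝ) (t : ℝ) (K : ℕ) : ℕ :=
  if h : ∃ k, 1 ≤ k ∧ k ≤ K ∧ (1 - t) * R.trainErr X Y (k - 1) ≤ R.trainErr X Y k
  then Nat.find h else K

/-- The predictors `Ĵ_k = {ĵ_1, …, ĵ_k}` selected in the first `k` steps. -/
def RGAPath.selected (R : RGAPath q d) (k : ℕ) : Finset (Fin p) :=
  (Finset.Icc 1 k).image R.jhat

/-- `r̂ = ∑_{j ∈ Ĵ_k} rank(B̂_j^{(k)})`. -/
noncomputable def RGAPath.rankSum (R : RGAPath q d) (k : ℕ) : ℕ :=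
  ∑ j ∈ R.selected k, (R.coef k j).rank

/-- The number of columns of `U_j` in the second stage: `r` if `r < min(q, d)`, and `q` otherwise. -/
def rowDim (r q d : ℕ) : ℕ := if r < min q d then r else q

/-- The number of columns of `V_j` in the second stage: `r` if `r < min(q, d)`, and `d` otherwise. -/
def colDim (r q d : ℕ) : ℕ := if r < min q d then r else d

theorem rowDim_le (r q d : ℕ) : rowDim r q d ≤ q := by
  unfold rowDim; split_ifs with h <;> omega

theorem colDim_le (r q d : ℕ) : colDim r q d ≤ d := by
  unfold colDim; split_ifs with h <;> omega

/-- The second-stage candidate coefficient matrix `Σ̂_j⁻¹ U_j S V_jᵀ`, where `U_j` and `V_j` are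
made of the leading columns of `U` and `V` (of all columns if `r ≥ min(q_j, d)`). -/
noncomputable def candidate (X : Predictors n q) (r : ℕ) (U : ∀ j, Matrix (Fin (q j)) (Fin (q j)) ℝ)
    (V : Fin p → Matrix (Fin d) (Fin d) ℝ) (j : Fin p)
    (S : Matrix (Fin (rowDim r (q j) d)) (Fin (colDim r (q j) d)) ℝ) :
    Matrix (Fin (q j)) (Fin d) ℝ :=
  (sigmaHat X j)⁻¹ * leadingCols (rowDim_le r (q j) d) (U j) * S *
    (leadingCols (colDim_le r (q j) d) (V j))ᵀ

/-- `R` is a run over `K` steps of the second-stage algorithm for data `(X, Y)` with nuclear norm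
bound `Ln`, selected predictors `J` and rank bound `r`. The singular vectors of the `X_jᵀ Y` are
fixed before the first step. The maximizing `Ŝ_k` is `Ln a bᵀ` with `a`, `b` unit vectors. -/
def RGAPath.IsSecondStage (R : RGAPath q d) (X : Predictors n q) (Y : Matrix (Fin n) (Fin d) ℝ)
    (Ln : ℝ) (J : Finset (Fin p)) (r K : ℕ) : Prop :=
  ∃ (U : ∀ j, Matrix (Fin (q j)) (Fin (q j)) ℝ) (V : Fin p → Matrix (Fin d) (Fin d) ℝ),
    (∀ j ∈ J, IsSVD ((X j)ᵀ * Y) (U j) (V j)) ∧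
    ∀ k, 1 ≤ k → k ≤ K →
      R.jhat k ∈ J ∧
      (∃ S : Matrix (Fin (rowDim r (q (R.jhat k)) d)) (Fin (colDim r (q (R.jhat k)) d)) ℝ,
        R.atom k = candidate X r U V (R.jhat k) S ∧ nuclearNorm S ≤ Ln ∧ IsScaledRankOne Ln S) ∧
      (∀ j ∈ J, ∀ S : Matrix (Fin (rowDim r (q j) d)) (Fin (colDim r (q j) d)) ℝ,
        nuclearNorm S ≤ Ln →
        trInner (Y - R.fit X (k - 1)) (X j * candidate X r U V j S) ≤
          trInner (Y - R.fit X (k - 1)) (X (R.jhat k) * R.atom k)) ∧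
      R.LineSearch X Y k

/-- `κ = #(J) max{ max_{j ∈ J - J_o} min(q_j, d), r 1{J_o ≠ ∅} }` with
`J_o = {j ∈ J : r < min(q_j, d)}`; a maximum over the empty set is `0`. -/
def kappa (q : Fin p → ℕ) (d : ℕ) (J : Finset (Fin p)) (r : ℕ) : ℕ :=
  J.card * max ((J.filter fun j => ¬ r < min (q j) d).sup fun j => min (q j) d)
    (if (J.filter fun j => r < min (q j) d).Nonempty then r else 0)

end Sample

/-! ### The model along the sample size, and stochastic orders -/

/-- A sequence of multivariate linear regression models `Y = ∑_j X_j B*_j + E`, indexed by the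
sample size `n`: random predictors and noise, deterministic coefficients. -/
structure RegressionModel (Ω : ℕ → Type*) [∀ n, MeasurableSpace (Ω n)] where
  d : ℕ → ℕ
  p : ℕ → ℕ
  q : ∀ n, Fin (p n) → ℕ
  d_pos : ∀ n, 0 < d n
  p_pos : ∀ n, 0 < p n
  q_pos : ∀ n j, 0 < q n j
  X : ∀ n, Ω n → Predictors n (q n)
  Bstar : ∀ n, Coefs (q n) (d n)
  E : ∀ n, Ω n → Matrix (Fin n) (Fin (d n)) ℝ
  measurable_X : ∀ n j i l, Measurable fun ω => X n ω j i l
  measurable_E : ∀ n i l, Measurable fun ω => E n ω i l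

section Sequence

variable {Ω : ℕ → Type*} [∀ n, MeasurableSpace (Ω n)]

/-- With probability approaching one, `A_n` holds. -/
def WPA1 (P : ∀ n, Measure (Ω n)) (A : ∀ n, Set (Ω n)) : Prop :=
  Tendsto (fun n => P n (A n)ᶜ) atTop (𝓝 0)

/-- `x_n = O_p(y_n)`. -/
def IsBigOp (P : ∀ n, Measure (Ω n)) (x y : ∀ n, Ω n → ℝ) : Prop :=
  ∀ ε : ℝ, 0 < ε → ∃ M : ℝ,
    limsup (fun n => P n {ω | M < x n ω / y n ω}) atTop < ENNReal.ofReal ε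

/-- `x_n = o_p(y_n)`. -/
def IsLittleOp (P : ∀ n, Measure (Ω n)) (x y : ∀ n, Ω n → ℝ) : Prop :=
  ∀ ε : ℝ, 0 < ε → WPA1 P fun n => {ω | x n ω / y n ω < ε}

namespace RegressionModel

variable (D : RegressionModel Ω)

/-- The noiseless response `Ỹ`. -/
def Ytilde (n : ℕ) (ω : Ω n) : Matrix (Fin n) (Fin (D.d n)) ℝ := signal (D.X n ω) (D.Bstar n)

/-- The response `Y = Ỹ + E`. -/
def Y (n : ℕ) (ω : Ω n) : Matrix (Fin n) (Fin (D.d n)) ℝ := D.Ytilde n ω + D.E n ω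

/-- The effect size `ξ_E` of the noise. -/
noncomputable def xi (n : ℕ) (ω : Ω n) : ℝ := xiE (D.X n ω) (D.E n ω)

/-- The random set `J_o`. -/
def Jo (n : ℕ) (ω : Ω n) : Set (Fin (D.p n)) := largeRelevant (D.X n ω) (D.Bstar n)

open Classical in
/-- The indicator `1{J_o ≠ ∅}`. -/
noncomputable def indJo (n : ℕ) (ω : Ω n) : ℝ := if (D.Jo n ω).Nonempty then 1 else 0

/-- Assumption: with probability approaching one, the eigenvalues of all `Σ̂_j` are in `[μ⁻¹, μ]`. -/
def C1 (P : ∀ n, Measure (Ω n)) (μ : ℝ) : Prop :=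
  WPA1 P fun n => {ω | ∀ j, ∀ x ∈ spectrum ℝ (sigmaHat (D.X n ω) j), μ⁻¹ ≤ x ∧ x ≤ μ}

/-- Assumption: `K_n → ∞` and `K_n ξ_E = O_p(n d_n^{1/2})`. -/
def C2 (P : ∀ n, Measure (Ω n)) (K : ℕ → ℕ) : Prop :=
  Tendsto K atTop atTop ∧
    IsBigOp P (fun n ω => K n * D.xi n ω) (fun n _ => n * √(D.d n : ℝ))

/-- Assumption: with probability approaching one, the eigenvalues of `n⁻¹ X(J)ᵀ X(J)` exceed `μ⁻¹` for
all `J` with at most `2 K_n` elements. -/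
def C3 (P : ∀ n, Measure (Ω n)) (μ : ℝ) (K : ℕ → ℕ) : Prop :=
  WPA1 P fun n => {ω | ∀ J : Finset (Fin (D.p n)), J.card ≤ 2 * K n →
    ∀ x ∈ spectrum ℝ ((n : ℝ)⁻¹ • ((stacked (D.X n ω) J)ᵀ * stacked (D.X n ω) J)), μ⁻¹ < x}

/-- Assumption: `d_n^{-1/2} ∑_j ‖B*_j‖_* ≤ L`, and `(s_n)` is a non-decreasing positive sequence with
`s_n² = o(K_n)` and `σ²_{r*_j}(d_n^{-1/2} B*_j) ≥ s_n⁻¹` for all relevant `j`, where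
`r*_j = rank(B*_j)`. -/
def C4 (L : ℝ) (K : ℕ → ℕ) (s : ℕ → ℝ) : Prop :=
  (∀ n, (√(D.d n : ℝ))⁻¹ * ∑ j, nuclearNorm (D.Bstar n j) ≤ L) ∧
  (∀ n, 0 < s n) ∧ Monotone s ∧
  (fun n => s n ^ 2) =o[atTop] (fun n => (K n : ℝ)) ∧
  ∀ n, ∀ j ∈ relevant (D.Bstar n),
    (s n)⁻¹ ≤ singVal ((√(D.d n : ℝ))⁻¹ • D.Bstar n j) ((D.Bstar n j).rank - 1) ^ 2

/-- Assumption: `δ_n > 0`, `ξ_E = o_p(n δ_n)`, and with probability approaching one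
`σ_{r̄_j}(X_jᵀ Ỹ) ≥ n δ_n` for all `j ∈ J_o`. -/
def C5 (P : ∀ n, Measure (Ω n)) (δ : ℕ → ℝ) : Prop :=
  (∀ n, 0 < δ n) ∧
  IsLittleOp P D.xi (fun n _ => n * δ n) ∧
  WPA1 P fun n => {ω | ∀ j ∈ D.Jo n ω,
    n * δ n ≤ singVal ((D.X n ω j)ᵀ * D.Ytilde n ω) (rbar (D.X n ω) (D.Bstar n) j - 1)}

/-- Assumption: with probability approaching one, local revelation holds at all `j ∈ J_o`. -/
def C6 (P : ∀ n, Measure (Ω n)) : Prop :=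
  WPA1 P fun n => {ω | ∀ j ∈ D.Jo n ω, LocalRevelation (D.X n ω) (D.Bstar n) j}

/-- The noise level condition: `M₀⁻¹ ≤ (n d_n)⁻¹ ‖E‖_F² ≤ M₀` with probability approaching one. -/
def NoiseLevel (P : ∀ n, Measure (Ω n)) (M₀ : ℝ) : Prop :=
  WPA1 P fun n => {ω | M₀⁻¹ ≤ ((n : ℝ) * D.d n)⁻¹ * frobNorm (D.E n ω) ^ 2 ∧
    ((n : ℝ) * D.d n)⁻¹ * frobNorm (D.E n ω) ^ 2 ≤ M₀}

end RegressionModel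

/-- A run, for each sample size and outcome, of the two-stage algorithm: the choices made in the
first and in the second stage. -/
structure TwoStageRun (D : RegressionModel Ω) where
  first : ∀ n, Ω n → RGAPath (D.q n) (D.d n)
  second : ∀ n, Ω n → RGAPath (D.q n) (D.d n)

namespace TwoStageRun

variable {D : RegressionModel Ω} (T : TwoStageRun D)

/-- The stopping time `k̂` of the first stage, for thresholds `t_n` and at most `K_n` steps. -/
noncomputable def khat (t : ℕ → ℝ) (K : ℕ → ℕ) (n : ℕ) (ω : Ω n) : ℕ :=
  (T.first n ω).stopTime (D.X n ω) (D.Y n ω) (t n) (K n)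

/-- The predictors `Ĵ` selected by the first stage. -/
noncomputable def Jhat (t : ℕ → ℝ) (K : ℕ → ℕ) (n : ℕ) (ω : Ω n) : Finset (Fin (D.p n)) :=
  (T.first n ω).selected (T.khat t K n ω)

/-- The sum `r̂` of the ranks of the coefficient estimates of the first stage. -/
noncomputable def rhat (t : ℕ → ℝ) (K : ℕ → ℕ) (n : ℕ) (ω : Ω n) : ℕ :=
  (T.first n ω).rankSum (T.khat t K n ω)

/-- `κ_n`. -/
noncomputable def kappa (t : ℕ → ℝ) (K : ℕ → ℕ) (n : ℕ) (ω : Ω n) : ℕ :=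
  TSRGA.kappa (D.q n) (D.d n) (T.Jhat t K n ω) (T.rhat t K n ω)

/-- The second-stage iterates `Ĝ^{(m)}`. -/
noncomputable def Ghat (n : ℕ) (ω : Ω n) (m : ℕ) : Matrix (Fin n) (Fin (D.d n)) ℝ :=
  (T.second n ω).fit (D.X n ω) m

/-- `T` follows the two-stage algorithm with `L_n = d_n^{1/2} L₀`, thresholds `t_n`, and at most
`K_n` steps in each stage. -/
def IsTSRGA (L₀ : ℝ) (t : ℕ → ℝ) (K : ℕ → ℕ) : Prop :=
  ∀ n ω,
    (T.first n ω).IsFirstStage (D.X n ω) (D.Y n ω) (√(D.d n : ℝ) * L₀) (K n) ∧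
    (T.second n ω).IsSecondStage (D.X n ω) (D.Y n ω) (√(D.d n : ℝ) * L₀)
      (T.Jhat t K n ω) (T.rhat t K n ω) (K n)

end TwoStageRun

end Sequence

end TSRGA

/-! On a suitable event everything is deterministic; probability enters only when the events are
intersected at the end.

The first stage finds enough. As long as the squared estimation error exceeds twice the noise cross
term, an exact line search lowers the residual sum of squares by an amount of the order of the
fourth power of the error (`RGAPath.IsFirstStage.decrease`). If some estimated block has smaller
rank than the true block, the Eckart–Young bound `singVal_le_opNorm_sub` and the restricted
eigenvalues force a normalized squared error of at least `1 / (μ s)` (`le_frobNorm_sq_of_rank_lt`).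
The last step before stopping then decreased the training error by a multiple of `s⁻²`, which the
stopping rule with threshold `C s⁻²`, `C` small, excludes. If the rule never fires, the training
error is at most a constant times `exp (-t K)`, with `t K → ∞`, which falls below the floor set by
the noise level. Hence the first stage stops with every true rank matched
(`rank_le_rank_coef_stopTime`): all relevant predictors are selected, and the rank sum dominates
each rank of `X_jᵀ Ỹ`.

The second-stage candidates approximate the signal. The coordinates `U_jᵀ Σ̂_j B_j V_j` are used.
When full sets of singular vectors are taken the block is reproduced exactly. Otherwise local
revelation places `Σ̂_j B_j` in the leading singular spaces of `X_jᵀ Ỹ`, and projecting onto those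
of the perturbed matrix `X_jᵀ Y` costs a relative error of at most `6 ξ_E / (n δ)`
(`frobNorm_sub_projection_le`). No comparison of individual singular vectors is needed: the
projection captures the unperturbed matrix up to `3 ‖Δ‖`, and `Σ̂_j B_j` factors through that
matrix.

The second stage contracts. Rank bounds and restricted eigenvalues bound the total nuclear norm of
the coordinates of a difference by `√(κ μ³ / n)` times its Frobenius norm (`sum_nuclearNorm_le`), so
the best atom correlates with the residual in proportion to the error. The approximation of the
signal uses only a quarter of the nuclear norm ball, so one line search removes a fraction of order
`1 / (μ⁵ κ)` of the excess residual sum of squares (`second_stage_decrease`). This lasts until the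
error reaches the level given by the noise, `ξ_E² κ / n`, and by the approximation error
(`sq_le_of_contraction`, `second_stage_bound`). After normalization these are the terms of the
claimed rate (`normalized_error_le`), with a constant that serves all steps at once. -/

namespace TSRGA

/-! ### The trace inner product and the Frobenius norm -/

section Basics

variable {l m n k : ℕ}

theorem trInner_eq_sum (A B : Matrix (Fin m) (Fin n) ℝ) :
    trInner A B = ∑ i, ∑ j, A i j * B i j := by
  simp only [trInner, Matrix.trace, Matrix.diag, Matrix.mul_apply, Matrix.transpose_apply]
  exact Finset.sum_comm

theorem trInner_comm (A B : Matrix (Fin m) (Fin n) ℝ) : trInner A B = trInner B A := by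
  simp only [trInner_eq_sum, mul_comm]

theorem trInner_add_left (A B C : Matrix (Fin m) (Fin n) ℝ) :
    trInner (A + B) C = trInner A C + trInner B C := by
  simp [trInner, Matrix.add_mul]

theorem trInner_sub_left (A B C : Matrix (Fin m) (Fin n) ℝ) :
    trInner (A - B) C = trInner A C - trInner B C := by
  simp [trInner, Matrix.sub_mul]

theorem trInner_add_right (A B C : Matrix (Fin m) (Fin n) ℝ) :
    trInner A (B + C) = trInner A B + trInner A C := by
  simp [trInner, Matrix.mul_add]

theorem trInner_sub_right (A B C : Matrix (Fin m) (Fin n) ℝ) :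
    trInner A (B - C) = trInner A B - trInner A C := by
  simp [trInner, Matrix.mul_sub]

theorem trInner_smul_left (c : ℝ) (A B : Matrix (Fin m) (Fin n) ℝ) :
    trInner (c • A) B = c * trInner A B := by
  simp [trInner]

theorem trInner_smul_right (c : ℝ) (A B : Matrix (Fin m) (Fin n) ℝ) :
    trInner A (c • B) = c * trInner A B := by
  simp [trInner]

theorem trInner_sum_right {ι : Type*} (s : Finset ι) (A : Matrix (Fin m) (Fin n) ℝ)
    (B : ι → Matrix (Fin m) (Fin n) ℝ) :
    trInner A (∑ i ∈ s, B i) = ∑ i ∈ s, trInner A (B i) := by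
  simp [trInner, Matrix.mul_sum, Matrix.trace_sum]

theorem trInner_zero_right (A : Matrix (Fin m) (Fin n) ℝ) : trInner A 0 = 0 := by
  simp [trInner]

theorem trInner_mul_right (A : Matrix (Fin m) (Fin n) ℝ) (B : Matrix (Fin m) (Fin l) ℝ)
    (C : Matrix (Fin l) (Fin n) ℝ) : trInner A (B * C) = trInner (Bᵀ * A) C := by
  simp [trInner, Matrix.mul_assoc]

theorem trInner_mul_right' (A : Matrix (Fin m) (Fin n) ℝ) (B : Matrix (Fin m) (Fin l) ℝ)
    (C : Matrix (Fin l) (Fin n) ℝ) : trInner A (B * C) = trInner (A * Cᵀ) B := by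
  simp only [trInner, Matrix.transpose_mul, Matrix.transpose_transpose]
  rw [← Matrix.mul_assoc, Matrix.trace_mul_comm, ← Matrix.mul_assoc]

theorem frobNorm_sq (A : Matrix (Fin m) (Fin n) ℝ) : frobNorm A ^ 2 = trInner A A := by
  rw [trInner_eq_sum, frobNorm, Matrix.frobenius_norm_def, ← Real.sqrt_eq_rpow,
    Real.sq_sqrt (by positivity)]
  simp [sq]

open scoped Matrix.Norms.Frobenius in
theorem frobNorm_nonneg (A : Matrix (Fin m) (Fin n) ℝ) : 0 ≤ frobNorm A := norm_nonneg A

open scoped Matrix.Norms.Frobenius in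
theorem frobNorm_zero : frobNorm (0 : Matrix (Fin m) (Fin n) ℝ) = 0 :=
  norm_zero (E := Matrix (Fin m) (Fin n) ℝ)

open scoped Matrix.Norms.Frobenius in
theorem frobNorm_eq_zero {A : Matrix (Fin m) (Fin n) ℝ} : frobNorm A = 0 ↔ A = 0 :=
  norm_eq_zero (E := Matrix (Fin m) (Fin n) ℝ)

open scoped Matrix.Norms.Frobenius in
theorem frobNorm_add_le (A B : Matrix (Fin m) (Fin n) ℝ) :
    frobNorm (A + B) ≤ frobNorm A + frobNorm B := norm_add_le A B

open scoped Matrix.Norms.Frobenius in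
theorem frobNorm_sub_le (A B : Matrix (Fin m) (Fin n) ℝ) :
    frobNorm (A - B) ≤ frobNorm A + frobNorm B := norm_sub_le A B

open scoped Matrix.Norms.Frobenius in
theorem frobNorm_smul (c : ℝ) (A : Matrix (Fin m) (Fin n) ℝ) :
    frobNorm (c • A) = |c| * frobNorm A := norm_smul c A

open scoped Matrix.Norms.Frobenius in
theorem frobNorm_sum_le {ι : Type*} (s : Finset ι) (A : ι → Matrix (Fin m) (Fin n) ℝ) :
    frobNorm (∑ i ∈ s, A i) ≤ ∑ i ∈ s, frobNorm (A i) := norm_sum_le s A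

open scoped Matrix.Norms.Frobenius in
theorem frobNorm_transpose (A : Matrix (Fin m) (Fin n) ℝ) : frobNorm Aᵀ = frobNorm A :=
  Matrix.frobenius_norm_transpose A

theorem frobNorm_add_sq (A B : Matrix (Fin m) (Fin n) ℝ) :
    frobNorm (A + B) ^ 2 = frobNorm A ^ 2 + 2 * trInner A B + frobNorm B ^ 2 := by
  simp only [frobNorm_sq, trInner_add_left, trInner_add_right, trInner_comm B A]
  ring

theorem frobNorm_sub_sq (A B : Matrix (Fin m) (Fin n) ℝ) :
    frobNorm (A - B) ^ 2 = frobNorm A ^ 2 - 2 * trInner A B + frobNorm B ^ 2 := by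
  simp only [frobNorm_sq, trInner_sub_left, trInner_sub_right, trInner_comm B A]
  ring

theorem abs_trInner_le (A B : Matrix (Fin m) (Fin n) ℝ) :
    |trInner A B| ≤ frobNorm A * frobNorm B := by
  have h : trInner A B ^ 2 ≤ (frobNorm A * frobNorm B) ^ 2 := by
    rw [mul_pow, frobNorm_sq, frobNorm_sq, trInner_eq_sum, trInner_eq_sum, trInner_eq_sum]
    simp only [← Finset.sum_product']
    simpa only [sq] using Finset.sum_mul_sq_le_sq_mul_sq (Finset.univ ×ˢ Finset.univ)
      (fun x : Fin m × Fin n => A x.1 x.2) (fun x => B x.1 x.2)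
  exact abs_le_of_sq_le_sq h (mul_nonneg (frobNorm_nonneg _) (frobNorm_nonneg _))

theorem trInner_le (A B : Matrix (Fin m) (Fin n) ℝ) :
    trInner A B ≤ frobNorm A * frobNorm B := (le_abs_self _).trans (abs_trInner_le A B)

/-! ### The operator norm -/

open scoped Matrix.Norms.L2Operator in
theorem opNorm_nonneg (A : Matrix (Fin m) (Fin n) ℝ) : 0 ≤ opNorm A := norm_nonneg A

open scoped Matrix.Norms.L2Operator in
theorem opNorm_zero : opNorm (0 : Matrix (Fin m) (Fin n) ℝ) = 0 :=
  norm_zero (E := Matrix (Fin m) (Fin n) ℝ)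

open scoped Matrix.Norms.L2Operator in
theorem opNorm_sub_le (A B : Matrix (Fin m) (Fin n) ℝ) :
    opNorm (A - B) ≤ opNorm A + opNorm B := norm_sub_le A B

open scoped Matrix.Norms.L2Operator in
theorem opNorm_mul_le (A : Matrix (Fin m) (Fin l) ℝ) (B : Matrix (Fin l) (Fin n) ℝ) :
    opNorm (A * B) ≤ opNorm A * opNorm B := Matrix.l2_opNorm_mul A B

open scoped Matrix.Norms.L2Operator in
theorem opNorm_transpose (A : Matrix (Fin m) (Fin n) ℝ) : opNorm Aᵀ = opNorm A := by
  have := Matrix.l2_opNorm_conjTranspose A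
  rwa [Matrix.conjTranspose_eq_transpose_of_trivial] at this

open scoped Matrix.Norms.L2Operator in
theorem opNorm_sq (A : Matrix (Fin m) (Fin n) ℝ) : opNorm A ^ 2 = opNorm (Aᵀ * A) := by
  have := Matrix.l2_opNorm_conjTranspose_mul_self A
  rw [Matrix.conjTranspose_eq_transpose_of_trivial] at this
  rw [sq]; exact this.symm

open scoped Matrix.Norms.L2Operator in
theorem opNorm_diagonal_le (w : Fin n → ℝ) {c : ℝ} (hc : 0 ≤ c) (h : ∀ i, |w i| ≤ c) :
    opNorm (Matrix.diagonal w) ≤ c := by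
  rw [opNorm, Matrix.l2_opNorm_diagonal]
  exact (pi_norm_le_iff_of_nonneg hc).2 h

theorem opNorm_le_one_of_orthonormal {U : Matrix (Fin m) (Fin n) ℝ} (hU : Uᵀ * U = 1) :
    opNorm U ≤ 1 := by
  have h : opNorm U ^ 2 ≤ 1 := by
    rw [opNorm_sq, hU, ← Matrix.diagonal_one]
    exact opNorm_diagonal_le _ zero_le_one (by simp)
  nlinarith [opNorm_nonneg U]

open scoped Matrix.Norms.L2Operator in
theorem dotProduct_mulVec_self_le (A : Matrix (Fin m) (Fin n) ℝ) (x : Fin n → ℝ) :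
    (A *ᵥ x) ⬝ᵥ (A *ᵥ x) ≤ opNorm A ^ 2 * (x ⬝ᵥ x) := by
  have h := Matrix.l2_opNorm_mulVec A (WithLp.toLp 2 x)
  have h2 := pow_le_pow_left₀ (norm_nonneg _) h 2
  rw [mul_pow, EuclideanSpace.norm_sq_eq, EuclideanSpace.norm_sq_eq] at h2
  simpa [dotProduct, ← sq, opNorm] using h2

open scoped Matrix.Norms.L2Operator in
theorem opNorm_le_of_forall (A : Matrix (Fin m) (Fin n) ℝ) {c : ℝ} (hc : 0 ≤ c)
    (h : ∀ x, (A *ᵥ x) ⬝ᵥ (A *ᵥ x) ≤ c ^ 2 * (x ⬝ᵥ x)) : opNorm A ≤ c := by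
  rw [opNorm, Matrix.l2_opNorm_def]
  refine ContinuousLinearMap.opNorm_le_bound _ hc fun x => ?_
  refine le_of_sq_le_sq ?_ (by positivity)
  rw [mul_pow, EuclideanSpace.norm_sq_eq, EuclideanSpace.norm_sq_eq]
  simpa [dotProduct, ← sq] using h x.ofLp

theorem frobNorm_sq_eq_sum_col (A : Matrix (Fin m) (Fin n) ℝ) :
    frobNorm A ^ 2 = ∑ j, A.col j ⬝ᵥ A.col j := by
  rw [frobNorm_sq, trInner_eq_sum, Finset.sum_comm]
  simp [dotProduct]

theorem frobNorm_mul_le (A : Matrix (Fin m) (Fin l) ℝ) (B : Matrix (Fin l) (Fin n) ℝ) :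
    frobNorm (A * B) ≤ opNorm A * frobNorm B := by
  refine le_of_sq_le_sq ?_ (mul_nonneg (opNorm_nonneg _) (frobNorm_nonneg _))
  rw [mul_pow, frobNorm_sq_eq_sum_col, frobNorm_sq_eq_sum_col, Finset.mul_sum]
  refine Finset.sum_le_sum fun j _ => ?_
  have : (A * B).col j = A *ᵥ B.col j := by
    ext i; simp [Matrix.mul_apply, Matrix.mulVec, dotProduct]
  rw [this]
  exact dotProduct_mulVec_self_le A _

theorem frobNorm_mul_le' (A : Matrix (Fin m) (Fin l) ℝ) (B : Matrix (Fin l) (Fin n) ℝ) :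
    frobNorm (A * B) ≤ frobNorm A * opNorm B := by
  rw [← frobNorm_transpose, Matrix.transpose_mul, ← frobNorm_transpose A, ← opNorm_transpose B,
    mul_comm]
  exact frobNorm_mul_le _ _

theorem opNorm_le_frobNorm (A : Matrix (Fin m) (Fin n) ℝ) : opNorm A ≤ frobNorm A := by
  refine opNorm_le_of_forall A (frobNorm_nonneg A) fun x => ?_
  rw [frobNorm_sq, trInner_eq_sum, Finset.sum_mul]
  refine Finset.sum_le_sum fun i _ => ?_
  have := Finset.sum_mul_sq_le_sq_mul_sq Finset.univ (A i) x
  simpa [Matrix.mulVec, dotProduct, sq] using this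

theorem frobNorm_orthonormal_mul {U : Matrix (Fin m) (Fin l) ℝ} (hU : Uᵀ * U = 1)
    (A : Matrix (Fin l) (Fin n) ℝ) : frobNorm (U * A) = frobNorm A := by
  have h : frobNorm (U * A) ^ 2 = frobNorm A ^ 2 := by
    rw [frobNorm_sq, frobNorm_sq, trInner_mul_right, ← Matrix.mul_assoc, hU, Matrix.one_mul]
  exact (pow_left_inj₀ (frobNorm_nonneg _) (frobNorm_nonneg _) two_ne_zero).1 h

theorem frobNorm_mul_orthonormal {V : Matrix (Fin n) (Fin l) ℝ} (hV : Vᵀ * V = 1)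
    (A : Matrix (Fin m) (Fin l) ℝ) : frobNorm (A * Vᵀ) = frobNorm A := by
  rw [← frobNorm_transpose, Matrix.transpose_mul, Matrix.transpose_transpose,
    frobNorm_orthonormal_mul hV, frobNorm_transpose]

end Basics

end TSRGA

namespace TSRGA

/-! ### Singular value decompositions and the nuclear norm -/

section SingularValues

variable {l m n k : ℕ}

theorem finrank_range_toEuclideanLin (A : Matrix (Fin m) (Fin n) ℝ) :
    Module.finrank ℝ (Matrix.toEuclideanLin A).range = A.rank :=
  (Matrix.rank_eq_finrank_range_toLin A (EuclideanSpace.basisFun _ ℝ).toBasis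
    (EuclideanSpace.basisFun _ ℝ).toBasis).symm

theorem singVal_nonneg (A : Matrix (Fin m) (Fin n) ℝ) (i : ℕ) : 0 ≤ singVal A i :=
  LinearMap.singularValues_nonneg _ i

theorem singVal_antitone (A : Matrix (Fin m) (Fin n) ℝ) : Antitone (singVal A) :=
  LinearMap.singularValues_antitone _

theorem singVal_pos_iff {A : Matrix (Fin m) (Fin n) ℝ} {i : ℕ} : 0 < singVal A i ↔ i < A.rank := by
  rw [singVal, LinearMap.singularValues_pos_iff_lt_finrank_range, finrank_range_toEuclideanLin]

theorem singVal_eq_zero_iff {A : Matrix (Fin m) (Fin n) ℝ} {i : ℕ} :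
    singVal A i = 0 ↔ A.rank ≤ i := by
  rw [singVal, LinearMap.singularValues_eq_zero_iff_le_finrank_range, finrank_range_toEuclideanLin]

theorem nuclearNorm_eq_sum (A : Matrix (Fin m) (Fin n) ℝ) :
    nuclearNorm A = ∑ i : Fin A.rank, singVal A i := by
  rw [nuclearNorm, Finsupp.sum, singVal, LinearMap.support_singularValues,
    finrank_range_toEuclideanLin, Finset.sum_range]

theorem inner_eq_dotProduct (x y : EuclideanSpace ℝ (Fin n)) :
    inner ℝ x y = x.ofLp ⬝ᵥ y.ofLp := by
  rw [EuclideanSpace.inner_eq_star_dotProduct, star_trivial, dotProduct_comm]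

/-- An orthonormal eigenbasis of `Aᵀ A`, whose eigenvalues in descending order are the squared
singular values. -/
theorem exists_right_singular_basis (A : Matrix (Fin m) (Fin n) ℝ) :
    ∃ v : Fin n → Fin n → ℝ, (∀ i j, v i ⬝ᵥ v j = if i = j then 1 else 0) ∧
      ∀ i j, (A *ᵥ v i) ⬝ᵥ (A *ᵥ v j) = if i = j then singVal A j ^ 2 else 0 := by
  have hn : Module.finrank ℝ (EuclideanSpace ℝ (Fin n)) = n := by simp
  obtain ⟨T, hT⟩ : ∃ T, T = Matrix.toEuclideanLin A := ⟨_, rfl⟩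
  have hs : singVal A = T.singularValues := by rw [hT, singVal]
  have hTA : ∀ x : EuclideanSpace ℝ (Fin n), (T x).ofLp = A *ᵥ x.ofLp := by
    intro x; rw [hT, Matrix.toLpLin_apply]
  obtain ⟨b, hb⟩ : ∃ b : OrthonormalBasis (Fin n) ℝ (EuclideanSpace ℝ (Fin n)),
      ∀ j, T.adjoint (T (b j)) = (T.singularValues j ^ 2) • b j := by
    refine ⟨T.isSymmetric_adjoint_comp_self.eigenvectorBasis hn, fun j => ?_⟩
    have h := T.isSymmetric_adjoint_comp_self.apply_eigenvectorBasis hn j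
    rw [← T.sq_singularValues_fin hn j] at h
    exact h
  refine ⟨fun i => (b i).ofLp, fun i j => ?_, fun i j => ?_⟩
  · rw [← inner_eq_dotProduct, orthonormal_iff_ite.1 b.orthonormal i j]
  · rw [← hTA, ← hTA, ← inner_eq_dotProduct, ← LinearMap.adjoint_inner_right, hb,
      inner_smul_right, orthonormal_iff_ite.1 b.orthonormal i j, hs]
    split_ifs <;> simp

/-- Thin singular value decomposition. -/
theorem exists_thin_svd (A : Matrix (Fin m) (Fin n) ℝ) :
    ∃ (U : Matrix (Fin m) (Fin A.rank) ℝ) (V : Matrix (Fin n) (Fin A.rank) ℝ),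
      Uᵀ * U = 1 ∧ Vᵀ * V = 1 ∧
        A = U * Matrix.diagonal (fun i : Fin A.rank => singVal A i) * Vᵀ := by
  have hr : A.rank ≤ n := A.rank_le_width
  obtain ⟨b, hV, hA⟩ := exists_right_singular_basis A
  let c : Fin A.rank → Fin n := Fin.castLE hr
  have hpos : ∀ i : Fin A.rank, 0 < singVal A i := fun i => singVal_pos_iff.2 i.2
  refine ⟨Matrix.of fun i k => (singVal A k)⁻¹ * (A *ᵥ (b (c k))) i,
    Matrix.of fun i k => (b (c k)) i, ?_, ?_, ?_⟩
  · ext i j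
    have h := hA (c i) (c j)
    simp only [Matrix.mul_apply, Matrix.transpose_apply, Matrix.of_apply, Matrix.one_apply]
    calc ∑ x, (singVal A i)⁻¹ * (A *ᵥ (b (c i))) x * ((singVal A j)⁻¹ * (A *ᵥ (b (c j))) x)
        = (singVal A i)⁻¹ * (singVal A j)⁻¹ *
          ((A *ᵥ (b (c i))) ⬝ᵥ (A *ᵥ (b (c j)))) := by
          rw [dotProduct, Finset.mul_sum]
          exact Finset.sum_congr rfl fun _ _ => by ring
      _ = _ := by
          rw [h]
          have hcc : c i = c j ↔ i = j := (Fin.castLE_injective hr).eq_iff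
          by_cases hij : i = j
          · subst hij
            have := (hpos i).ne'
            simp [c]
            field_simp
          · simp [hcc, hij]
  · ext i j
    have h := hV (c i) (c j)
    have hcc : c i = c j ↔ i = j := (Fin.castLE_injective hr).eq_iff
    simp only [hcc] at h
    simpa [Matrix.mul_apply, dotProduct, Matrix.one_apply] using h
  -- For a square matrix, orthonormal rows give orthonormal columns. The resulting resolution of the
  -- identity expands `A` as the sum of `(A v_i) v_iᵀ`, and the terms with `i ≥ rank A` vanish.
  · have hout : ∀ j x : Fin n, ∑ i : Fin n, (b i) j * (b i) x = if j = x then 1 else 0 := by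
      let Q : Matrix (Fin n) (Fin n) ℝ := Matrix.of fun i j => (b i) j
      have hQ : Q * Qᵀ = 1 := by
        ext i j
        simpa [Q, Matrix.mul_apply, dotProduct, Matrix.one_apply] using hV i j
      have hQ' := mul_eq_one_comm.1 hQ
      intro j x
      have := congrFun (congrFun hQ' j) x
      simpa [Q, Matrix.mul_apply, Matrix.one_apply] using this
    have hzero : ∀ i : Fin n, A.rank ≤ i → A *ᵥ (b i) = 0 := by
      intro i hi
      have h := hA i i
      rw [if_pos rfl, singVal_eq_zero_iff.2 hi] at h
      exact dotProduct_self_eq_zero.1 (by simpa using h)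
    ext p x
    have h1 : A p x = ∑ i : Fin n, (A *ᵥ (b i)) p * (b i) x := by
      simp only [Matrix.mulVec, dotProduct, Finset.sum_mul]
      rw [Finset.sum_comm]
      simp only [mul_assoc, ← Finset.mul_sum, hout]
      simp
    have h2 : ∑ i : Fin n, (A *ᵥ (b i)) p * (b i) x =
        ∑ k : Fin A.rank, (A *ᵥ (b (c k))) p * (b (c k)) x := by
      rw [← Finset.sum_image (s := Finset.univ) (g := c)
        (f := fun i => (A *ᵥ (b i)) p * (b i) x)
        (fun _ _ _ _ h => Fin.castLE_injective hr h)]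
      refine (Finset.sum_subset (Finset.subset_univ _) fun i _ hi => ?_).symm
      rw [hzero i, Pi.zero_apply, zero_mul]
      by_contra! hlt
      exact hi (Finset.mem_image.2 ⟨⟨i, hlt⟩, Finset.mem_univ _, by ext; simp [c]⟩)
    rw [h1, h2, Matrix.mul_apply]
    refine Finset.sum_congr rfl fun k _ => ?_
    have := (hpos k).ne'
    simp only [Matrix.mul_diagonal, Matrix.of_apply, Matrix.transpose_apply]
    field_simp

theorem frobNorm_diagonal_sq (w : Fin n → ℝ) : frobNorm (Matrix.diagonal w) ^ 2 = ∑ i, w i ^ 2 := by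
  rw [frobNorm_sq, trInner_eq_sum]
  refine Finset.sum_congr rfl fun i _ => ?_
  simp [Matrix.diagonal_apply, sq]

theorem frobNorm_sq_eq_sum_singVal (A : Matrix (Fin m) (Fin n) ℝ) :
    frobNorm A ^ 2 = ∑ i : Fin A.rank, singVal A i ^ 2 := by
  obtain ⟨U, V, hU, hV, hA⟩ := exists_thin_svd A
  refine (congrArg (fun B => frobNorm B ^ 2) hA).trans ?_
  rw [frobNorm_mul_orthonormal hV, frobNorm_orthonormal_mul hU, frobNorm_diagonal_sq]

theorem nuclearNorm_nonneg (A : Matrix (Fin m) (Fin n) ℝ) : 0 ≤ nuclearNorm A := by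
  rw [nuclearNorm_eq_sum]
  exact Finset.sum_nonneg fun i _ => singVal_nonneg _ _

theorem frobNorm_le_nuclearNorm (A : Matrix (Fin m) (Fin n) ℝ) : frobNorm A ≤ nuclearNorm A := by
  refine le_of_sq_le_sq ?_ (nuclearNorm_nonneg A)
  rw [frobNorm_sq_eq_sum_singVal, nuclearNorm_eq_sum]
  exact Finset.sum_sq_le_sq_sum_of_nonneg fun i _ => singVal_nonneg _ _

/-- Cauchy–Schwarz on the nonzero singular values. This is where ranks, and eventually `κ`, enter
the rate. -/
theorem nuclearNorm_sq_le (A : Matrix (Fin m) (Fin n) ℝ) :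
    nuclearNorm A ^ 2 ≤ A.rank * frobNorm A ^ 2 := by
  rw [frobNorm_sq_eq_sum_singVal, nuclearNorm_eq_sum]
  simpa using sq_sum_le_card_mul_sum_sq (s := (Finset.univ : Finset (Fin A.rank)))
    (f := fun i => singVal A i)

/-- In the singular bases of `A` the inner product only sees the diagonal of `Uᵀ E V`, whose entries
are at most the operator norm. -/
theorem trInner_le_opNorm_mul_nuclearNorm (E A : Matrix (Fin m) (Fin n) ℝ) :
    trInner E A ≤ opNorm E * nuclearNorm A := by
  obtain ⟨U, V, hU, hV, hA⟩ := exists_thin_svd A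
  have key : ∀ i, (Uᵀ * E * V) i i ≤ opNorm E := by
    intro i
    have h1 : opNorm (Uᵀ * E * V) ≤ opNorm E := by
      have hu := opNorm_le_one_of_orthonormal hU
      have hv := opNorm_le_one_of_orthonormal hV
      calc opNorm (Uᵀ * E * V) ≤ opNorm Uᵀ * opNorm E * opNorm V :=
            (opNorm_mul_le _ _).trans
              (mul_le_mul_of_nonneg_right (opNorm_mul_le _ _) (opNorm_nonneg _))
        _ ≤ 1 * opNorm E * 1 := by
            rw [opNorm_transpose]
            have := opNorm_nonneg E
            have := opNorm_nonneg V
            gcongr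
        _ = _ := by ring
    have h2 := dotProduct_mulVec_self_le (Uᵀ * E * V) (Pi.single i 1)
    have h3 : (Uᵀ * E * V) i i ^ 2 ≤ ((Uᵀ * E * V) *ᵥ Pi.single i 1) ⬝ᵥ
        ((Uᵀ * E * V) *ᵥ Pi.single i 1) := by
      rw [Matrix.mulVec_single_one, dotProduct]
      refine le_trans (le_of_eq ?_) (Finset.single_le_sum
        (fun j _ => mul_self_nonneg ((Uᵀ * E * V).col i j)) (Finset.mem_univ i))
      simp [sq]
    have h4 : (Uᵀ * E * V) i i ^ 2 ≤ opNorm (Uᵀ * E * V) ^ 2 := by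
      simpa using h3.trans h2
    exact (abs_le_of_sq_le_sq' h4 (opNorm_nonneg _)).2.trans h1
  have h5 : trInner E A = ∑ i : Fin A.rank, (Uᵀ * E * V) i i * singVal A i := by
    refine (congrArg (trInner E) hA).trans ?_
    rw [trInner_mul_right', Matrix.transpose_transpose, trInner_mul_right, trInner_eq_sum]
    refine Finset.sum_congr rfl fun i _ => ?_
    simp [Matrix.diagonal_apply, Matrix.mul_assoc]
  rw [h5, nuclearNorm_eq_sum, Finset.mul_sum]
  exact Finset.sum_le_sum fun i _ => mul_le_mul_of_nonneg_right (key i) (singVal_nonneg _ _)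

/-- The partial isometry `U Vᵀ` attains the duality bound. Testing against it yields the triangle
inequality and the ideal property of the nuclear norm. -/
theorem exists_trInner_eq_nuclearNorm (A : Matrix (Fin m) (Fin n) ℝ) :
    ∃ W : Matrix (Fin m) (Fin n) ℝ, opNorm W ≤ 1 ∧ trInner W A = nuclearNorm A := by
  obtain ⟨U, V, hU, hV, hA⟩ := exists_thin_svd A
  refine ⟨U * Vᵀ, ?_, ?_⟩
  · have hu := opNorm_le_one_of_orthonormal hU
    have hv := opNorm_le_one_of_orthonormal hV
    refine (opNorm_mul_le _ _).trans ?_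
    rw [opNorm_transpose]
    exact mul_le_one₀ hu (opNorm_nonneg _) hv
  · refine (congrArg (trInner (U * Vᵀ)) hA).trans ?_
    rw [trInner_mul_right', Matrix.transpose_transpose, Matrix.mul_assoc, hV, Matrix.mul_one,
      trInner_mul_right, hU, nuclearNorm_eq_sum, trInner_eq_sum]
    simp [Matrix.one_apply]

theorem nuclearNorm_add_le (A B : Matrix (Fin m) (Fin n) ℝ) :
    nuclearNorm (A + B) ≤ nuclearNorm A + nuclearNorm B := by
  obtain ⟨W, hW, h⟩ := exists_trInner_eq_nuclearNorm (A + B)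
  have hA := trInner_le_opNorm_mul_nuclearNorm W A
  have hB := trInner_le_opNorm_mul_nuclearNorm W B
  rw [← h, trInner_add_right]
  nlinarith [nuclearNorm_nonneg A, nuclearNorm_nonneg B]

theorem nuclearNorm_smul_le {c : ℝ} (hc : 0 ≤ c) (A : Matrix (Fin m) (Fin n) ℝ) :
    nuclearNorm (c • A) ≤ c * nuclearNorm A := by
  obtain ⟨W, hW, h⟩ := exists_trInner_eq_nuclearNorm (c • A)
  have hA := trInner_le_opNorm_mul_nuclearNorm W A
  rw [← h, trInner_smul_right]
  refine mul_le_mul_of_nonneg_left ?_ hc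
  nlinarith [nuclearNorm_nonneg A]

theorem nuclearNorm_mul_mul_le (P : Matrix (Fin l) (Fin m) ℝ) (A : Matrix (Fin m) (Fin n) ℝ)
    (Q : Matrix (Fin n) (Fin k) ℝ) :
    nuclearNorm (P * A * Q) ≤ opNorm P * nuclearNorm A * opNorm Q := by
  obtain ⟨W, hW, h⟩ := exists_trInner_eq_nuclearNorm (P * A * Q)
  rw [← h, trInner_mul_right', trInner_mul_right]
  refine (trInner_le_opNorm_mul_nuclearNorm _ _).trans ?_
  have h1 : opNorm (Pᵀ * (W * Qᵀ)) ≤ opNorm P * (1 * opNorm Q) := by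
    rw [← opNorm_transpose P, ← opNorm_transpose Q]
    refine (opNorm_mul_le _ _).trans (mul_le_mul_of_nonneg_left ?_ (opNorm_nonneg _))
    exact (opNorm_mul_le _ _).trans (mul_le_mul_of_nonneg_right hW (opNorm_nonneg _))
  calc _ ≤ opNorm P * (1 * opNorm Q) * nuclearNorm A :=
        mul_le_mul_of_nonneg_right h1 (nuclearNorm_nonneg _)
    _ = _ := by ring

theorem nuclearNorm_zero : nuclearNorm (0 : Matrix (Fin m) (Fin n) ℝ) = 0 := by
  simp [nuclearNorm, singVal]

/-- The distance from `A` to the matrices of rank at most `k` is at least `σ_{k+1}(A)`. -/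
theorem singVal_le_opNorm_sub (A B : Matrix (Fin m) (Fin n) ℝ) (hB : B.rank ≤ k) :
    singVal A k ≤ opNorm (A - B) := by
  by_cases hk : A.rank ≤ k
  · rw [singVal_eq_zero_iff.2 hk]; exact opNorm_nonneg _
  push Not at hk
  obtain ⟨U, V, hU, hV, hA⟩ := exists_thin_svd A
  let f : Fin (k + 1) → Fin A.rank := Fin.castLE hk
  let V₁ : Matrix (Fin n) (Fin (k + 1)) ℝ := V.submatrix id f
  have hinj : Function.Injective f := Fin.castLE_injective _
  have hVV : Vᵀ * V₁ = Matrix.of fun i j => if i = f j then 1 else 0 := by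
    ext i j
    have := congrFun (congrFun hV i) (f j)
    simpa [V₁, Matrix.mul_apply, Matrix.one_apply] using this
  have hV₁ : V₁ᵀ * V₁ = 1 := by
    ext i j
    have := congrFun (congrFun hV (f i)) (f j)
    simpa [V₁, Matrix.mul_apply, Matrix.one_apply, hinj.eq_iff] using this
  -- Dimension count: `B * V₁` has `k + 1` columns and rank at most `k`, so `B` kills a nonzero
  -- combination of the leading `k + 1` right singular vectors of `A`.
  obtain ⟨c, hc0, hc⟩ : ∃ c : Fin (k + 1) → ℝ, c ≠ 0 ∧ (B * V₁) *ᵥ c = 0 := by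
    have hlt : (B * V₁).rank < k + 1 := by
      have := Matrix.rank_mul_le_left B V₁
      omega
    by_contra! hne
    have hinjm : Function.Injective (B * V₁).mulVecLin := by
      rw [← LinearMap.ker_eq_bot, LinearMap.ker_eq_bot']
      intro c hc
      by_contra h0
      exact hne c h0 hc
    have := LinearMap.finrank_range_of_inj hinjm
    rw [Module.finrank_fin_fun] at this
    exact hlt.ne this
  set x := V₁ *ᵥ c with hx
  have hxx : x ⬝ᵥ x = c ⬝ᵥ c := by
    rw [hx, Matrix.dotProduct_mulVec, Matrix.vecMul_mulVec, ← Matrix.dotProduct_mulVec]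
    have : (V₁ᵀ * V₁) *ᵥ c = c := by rw [hV₁, Matrix.one_mulVec]
    simpa [Matrix.dotProduct_mulVec] using congrArg (fun y => c ⬝ᵥ y) this
  have hcc : 0 < c ⬝ᵥ c := by
    have h0 : (0:ℝ) ≤ c ⬝ᵥ c := Finset.sum_nonneg fun i _ => mul_self_nonneg _
    exact lt_of_le_of_ne h0 fun h => hc0 (dotProduct_self_eq_zero.1 h.symm)
  have hAB : (A - B) *ᵥ x = A *ᵥ x := by
    have : B *ᵥ x = 0 := by rw [hx, Matrix.mulVec_mulVec, hc]
    rw [Matrix.sub_mulVec, this, sub_zero]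
  have hiso : ∀ y : Fin A.rank → ℝ, (U *ᵥ y) ⬝ᵥ (U *ᵥ y) = y ⬝ᵥ y := by
    intro y
    rw [Matrix.dotProduct_mulVec, Matrix.vecMul_mulVec, hU, Matrix.vecMul_one]
  have hVx : Vᵀ *ᵥ x = fun i => ∑ j, if i = f j then c j else 0 := by
    rw [hx, Matrix.mulVec_mulVec, hVV]
    ext i
    simp [Matrix.mulVec, dotProduct]
  -- On the span of these vectors `A` stretches by at least the last of their singular values, which
  -- has zero-based index `k`.
  have hAx : singVal A k ^ 2 * (c ⬝ᵥ c) ≤ (A *ᵥ x) ⬝ᵥ (A *ᵥ x) := by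
    have : A *ᵥ x = U *ᵥ (Matrix.diagonal (fun i : Fin A.rank => singVal A i) *ᵥ (Vᵀ *ᵥ x)) := by
      refine (congrArg (· *ᵥ x) hA).trans ?_
      simp only [Matrix.mulVec_mulVec, Matrix.mul_assoc]
    rw [this, hiso, dotProduct, dotProduct, Finset.mul_sum]
    calc ∑ j, singVal A k ^ 2 * (c j * c j)
        ≤ ∑ j, (singVal A (f j) * c j) * (singVal A (f j) * c j) := by
          refine Finset.sum_le_sum fun j _ => ?_
          have h1 : singVal A k ≤ singVal A (f j) := singVal_antitone A (Nat.lt_succ_iff.1 j.2)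
          have h2 := singVal_nonneg A k
          calc _ = singVal A k ^ 2 * c j ^ 2 := by ring
            _ ≤ singVal A (f j) ^ 2 * c j ^ 2 := by gcongr
            _ = _ := by ring
      _ = ∑ i ∈ Finset.univ.image f, (Matrix.diagonal (fun i : Fin A.rank => singVal A i) *ᵥ
            (Vᵀ *ᵥ x)) i * (Matrix.diagonal (fun i : Fin A.rank => singVal A i) *ᵥ (Vᵀ *ᵥ x)) i := by
          rw [Finset.sum_image fun _ _ _ _ h => hinj h]
          refine Finset.sum_congr rfl fun j _ => ?_
          simp [hVx, Matrix.mulVec_diagonal, hinj.eq_iff]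
      _ ≤ _ := Finset.sum_le_sum_of_subset_of_nonneg (Finset.subset_univ _)
            fun i _ _ => mul_self_nonneg _
  have hle := dotProduct_mulVec_self_le (A - B) x
  rw [hAB, hxx] at hle
  have := le_of_mul_le_mul_right (hAx.trans hle) hcc
  exact (pow_le_pow_iff_left₀ (singVal_nonneg _ _) (opNorm_nonneg _) two_ne_zero).1 this

end SingularValues

end TSRGA

namespace TSRGA

/-! ### Leading singular vectors and their perturbation -/

section LeadingVectors

variable {m n r : ℕ}

theorem leadingCols_orthonormal (h : r ≤ m) {U : Matrix (Fin m) (Fin m) ℝ}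
    (hU : U ∈ Matrix.orthogonalGroup (Fin m) ℝ) : (leadingCols h U)ᵀ * leadingCols h U = 1 := by
  have hUU : Uᵀ * U = 1 := (Matrix.mem_orthogonalGroup_iff' (Fin m) ℝ).1 hU
  ext i j
  have := congrFun (congrFun hUU (Fin.castLE h i)) (Fin.castLE h j)
  simpa [leadingCols, Matrix.mul_apply, Matrix.one_apply, (Fin.castLE_injective h).eq_iff] using this

theorem leadingCols_mul_transpose (h : r ≤ m) (U : Matrix (Fin m) (Fin m) ℝ) :
    leadingCols h U * (leadingCols h U)ᵀ =
      U * Matrix.diagonal (fun i => if i.val < r then 1 else 0) * Uᵀ := by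
  ext i j
  rw [Matrix.mul_apply, Matrix.mul_apply]
  simp only [leadingCols, Matrix.transpose_apply, Matrix.submatrix_apply, id, Matrix.mul_diagonal]
  rw [← Finset.sum_image (s := Finset.univ) (g := Fin.castLE h) (f := fun x => U i x * U j x)
    (fun _ _ _ _ e => Fin.castLE_injective h e)]
  have : Finset.univ.image (Fin.castLE h) = Finset.univ.filter fun x : Fin m => x.val < r := by
    ext x
    simp only [Finset.mem_image, Finset.mem_univ, true_and, Finset.mem_filter]
    exact ⟨fun ⟨y, hy⟩ => hy ▸ y.2, fun hx => ⟨⟨x, hx⟩, rfl⟩⟩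
  rw [this, Finset.sum_filter]
  exact Finset.sum_congr rfl fun x _ => by split_ifs <;> simp

/-- The rectangular diagonal matrix with entries `w 0, w 1, …` on the diagonal. -/
def rectDiagonal (m n : ℕ) (w : ℕ → ℝ) : Matrix (Fin m) (Fin n) ℝ :=
  Matrix.of fun i k => if i.val = k.val then w i.val else 0

theorem IsSVD.eq {A : Matrix (Fin m) (Fin n) ℝ} {U : Matrix (Fin m) (Fin m) ℝ}
    {V : Matrix (Fin n) (Fin n) ℝ} (h : IsSVD A U V) :
    A = U * rectDiagonal m n (singVal A) * Vᵀ := h.2.2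

theorem opNorm_rectDiagonal_le (w : ℕ → ℝ) {c : ℝ} (hc : 0 ≤ c) (h : ∀ i, |w i| ≤ c) :
    opNorm (rectDiagonal m n w) ≤ c := by
  refine opNorm_le_of_forall _ hc fun x => ?_
  have hw : ∀ i, w i ^ 2 ≤ c ^ 2 := fun i => sq_le_sq' (by linarith [neg_abs_le (w i), h i])
    ((le_abs_self _).trans (h i))
  have hval : ∀ i : Fin m, (rectDiagonal m n w *ᵥ x) i = if hi : i.val < n then w i * x ⟨i, hi⟩ else 0 := by
    intro i
    simp only [rectDiagonal, Matrix.mulVec, dotProduct, Matrix.of_apply]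
    split_ifs with hi
    · rw [Finset.sum_eq_single ⟨i, hi⟩]
      · simp
      · intro b _ hb
        rw [if_neg, zero_mul]
        exact fun e => hb (Fin.ext e.symm)
      · simp
    · refine Finset.sum_eq_zero fun k _ => ?_
      rw [if_neg, zero_mul]
      have := k.2; omega
  -- Extending `x` by zero to `ℕ` turns row and column sums into sums over ranges, comparable for
  -- either order of `m` and `n`.
  let y : ℕ → ℝ := fun i => if hi : i < n then x ⟨i, hi⟩ else 0
  have hxy : x ⬝ᵥ x = ∑ i ∈ Finset.range n, y i ^ 2 := by
    rw [Finset.sum_range, dotProduct]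
    exact Finset.sum_congr rfl fun i _ => by simp [y, sq]
  rw [hxy, dotProduct, Finset.mul_sum]
  calc _ = ∑ i ∈ Finset.range m, w i ^ 2 * y i ^ 2 := by
        rw [Finset.sum_range]
        refine Finset.sum_congr rfl fun i _ => ?_
        rw [hval]
        by_cases hi : i.val < n
        · simp [y, hi]; ring
        · simp [y, hi]
    _ ≤ ∑ i ∈ Finset.range m, c ^ 2 * y i ^ 2 :=
        Finset.sum_le_sum fun i _ => mul_le_mul_of_nonneg_right (hw i) (sq_nonneg _)
    _ ≤ ∑ i ∈ Finset.range (max m n), c ^ 2 * y i ^ 2 :=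
        Finset.sum_le_sum_of_subset_of_nonneg (Finset.range_mono (le_max_left _ _))
          fun i _ _ => by positivity
    _ = ∑ i ∈ Finset.range n, c ^ 2 * y i ^ 2 := by
        refine (Finset.sum_subset (Finset.range_mono (le_max_right _ _)) fun i _ hi => ?_).symm
        simp [y, Finset.mem_range.not.1 hi]

theorem opNorm_orthogonal_mul_mul_le {U : Matrix (Fin m) (Fin m) ℝ} {V : Matrix (Fin n) (Fin n) ℝ}
    (hU : U ∈ Matrix.orthogonalGroup (Fin m) ℝ) (hV : V ∈ Matrix.orthogonalGroup (Fin n) ℝ)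
    (D : Matrix (Fin m) (Fin n) ℝ) : opNorm (U * D * Vᵀ) ≤ opNorm D := by
  have hu := opNorm_le_one_of_orthonormal ((Matrix.mem_orthogonalGroup_iff' (Fin m) ℝ).1 hU)
  have hv := opNorm_le_one_of_orthonormal ((Matrix.mem_orthogonalGroup_iff' (Fin n) ℝ).1 hV)
  calc opNorm (U * D * Vᵀ) ≤ opNorm U * opNorm D * opNorm Vᵀ :=
        (opNorm_mul_le _ _).trans (mul_le_mul_of_nonneg_right (opNorm_mul_le _ _) (opNorm_nonneg _))
    _ ≤ 1 * opNorm D * 1 := by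
        rw [opNorm_transpose]
        have := opNorm_nonneg D
        have := opNorm_nonneg V
        gcongr
    _ = _ := by ring

theorem opNorm_rectDiagonal_tail_le (A : Matrix (Fin m) (Fin n) ℝ) (r : ℕ) :
    opNorm (rectDiagonal m n fun i => if i < r then 0 else singVal A i) ≤ singVal A r := by
  refine opNorm_rectDiagonal_le _ (singVal_nonneg _ _) fun i => ?_
  split_ifs with hi
  · simpa using singVal_nonneg _ _
  · rw [abs_of_nonneg (singVal_nonneg _ _)]
    exact singVal_antitone A (not_lt.1 hi)

/-- The part of `A` that is not captured by its `r` leading left singular vectors. -/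
theorem IsSVD.opNorm_sub_left_le {A : Matrix (Fin m) (Fin n) ℝ} {U : Matrix (Fin m) (Fin m) ℝ}
    {V : Matrix (Fin n) (Fin n) ℝ} (h : IsSVD A U V) (hr : r ≤ m) :
    opNorm (A - leadingCols hr U * (leadingCols hr U)ᵀ * A) ≤ singVal A r := by
  have hUU : Uᵀ * U = 1 := (Matrix.mem_orthogonalGroup_iff' (Fin m) ℝ).1 h.1
  have key : ∀ w : ℕ → ℝ, U * rectDiagonal m n w * Vᵀ -
      leadingCols hr U * (leadingCols hr U)ᵀ * (U * rectDiagonal m n w * Vᵀ) =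
        U * rectDiagonal m n (fun i => if i < r then 0 else w i) * Vᵀ := by
    intro w
    have : U * Matrix.diagonal (fun i : Fin m => if i.val < r then (1 : ℝ) else 0) * Uᵀ *
        (U * rectDiagonal m n w * Vᵀ) =
        U * (Matrix.diagonal (fun i : Fin m => if i.val < r then (1 : ℝ) else 0) * rectDiagonal m n w) *
          Vᵀ := by
      simp only [← Matrix.mul_assoc]
      rw [Matrix.mul_assoc _ Uᵀ U, hUU, Matrix.mul_one]
    rw [leadingCols_mul_transpose, this, ← Matrix.sub_mul, ← Matrix.mul_sub]
    congr 2
    ext i k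
    simp only [Matrix.sub_apply, Matrix.diagonal_mul, rectDiagonal, Matrix.of_apply]
    split_ifs <;> simp
  have hA := key (singVal A)
  rw [← h.eq] at hA
  rw [hA]
  exact (opNorm_orthogonal_mul_mul_le h.1 h.2.1 _).trans (opNorm_rectDiagonal_tail_le A r)

/-- The part of `A` that is not captured by its `r` leading right singular vectors. -/
theorem IsSVD.opNorm_sub_right_le {A : Matrix (Fin m) (Fin n) ℝ} {U : Matrix (Fin m) (Fin m) ℝ}
    {V : Matrix (Fin n) (Fin n) ℝ} (h : IsSVD A U V) (hr : r ≤ n) :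
    opNorm (A - A * (leadingCols hr V * (leadingCols hr V)ᵀ)) ≤ singVal A r := by
  have hVV : Vᵀ * V = 1 := (Matrix.mem_orthogonalGroup_iff' (Fin n) ℝ).1 h.2.1
  have key : ∀ w : ℕ → ℝ, U * rectDiagonal m n w * Vᵀ -
      U * rectDiagonal m n w * Vᵀ * (leadingCols hr V * (leadingCols hr V)ᵀ) =
        U * rectDiagonal m n (fun i => if i < r then 0 else w i) * Vᵀ := by
    intro w
    have : U * rectDiagonal m n w * Vᵀ *
        (V * Matrix.diagonal (fun i : Fin n => if i.val < r then (1 : ℝ) else 0) * Vᵀ) =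
        U * (rectDiagonal m n w * Matrix.diagonal (fun i : Fin n => if i.val < r then (1 : ℝ) else 0)) *
          Vᵀ := by
      simp only [← Matrix.mul_assoc]
      rw [Matrix.mul_assoc _ Vᵀ V, hVV, Matrix.mul_one]
    rw [leadingCols_mul_transpose, this, ← Matrix.sub_mul, ← Matrix.mul_sub]
    congr 2
    ext i k
    simp only [Matrix.sub_apply, Matrix.mul_diagonal, rectDiagonal, Matrix.of_apply]
    by_cases hik : i.val = k.val
    · simp only [hik]; split_ifs <;> simp
    · simp [hik]
  have hA := key (singVal A)
  rw [← h.eq] at hA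
  rw [hA]
  exact (opNorm_orthogonal_mul_mul_le h.1 h.2.1 _).trans (opNorm_rectDiagonal_tail_le A r)

theorem IsSVD.mul_leadingCols {A : Matrix (Fin m) (Fin n) ℝ} {U : Matrix (Fin m) (Fin m) ℝ}
    {V : Matrix (Fin n) (Fin n) ℝ} (h : IsSVD A U V) (hm : r ≤ m) (hn : r ≤ n) :
    A * leadingCols hn V = leadingCols hm U * Matrix.diagonal fun i : Fin r => singVal A i := by
  obtain ⟨-, hV, hA⟩ := h
  have hVV : Vᵀ * V = 1 := (Matrix.mem_orthogonalGroup_iff' (Fin n) ℝ).1 hV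
  have h1 : leadingCols hn V = V * (1 : Matrix (Fin n) (Fin n) ℝ).submatrix id (Fin.castLE hn) := by
    ext i j
    simp [leadingCols, Matrix.mul_apply, Matrix.one_apply]
  -- The singular values are abstracted so that rewriting `A` by its decomposition leaves them
  -- untouched.
  generalize hw : (fun i => singVal A i) = w at hA ⊢
  have hw' : ∀ i, singVal A i = w i := fun i => congrFun hw i
  simp only [hw'] at hA ⊢
  rw [h1, hA, ← Matrix.mul_assoc, Matrix.mul_assoc _ Vᵀ V, hVV, Matrix.mul_one, Matrix.mul_assoc]
  ext i j
  simp only [Matrix.mul_apply, Matrix.submatrix_apply, id, Matrix.one_apply, Matrix.of_apply,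
    leadingCols, Matrix.diagonal_apply]
  simp only [mul_ite, mul_one, mul_zero, Finset.sum_ite_eq', Finset.mem_univ, if_true]
  rw [Finset.sum_eq_single (Fin.castLE hm j)]
  · simp
  · intro b _ hb
    rw [if_neg]
    exact fun e => hb (Fin.ext (by simpa using e))
  · simp

theorem IsSVD.transpose_leadingCols_mul {A : Matrix (Fin m) (Fin n) ℝ}
    {U : Matrix (Fin m) (Fin m) ℝ} {V : Matrix (Fin n) (Fin n) ℝ} (h : IsSVD A U V) (hm : r ≤ m)
    (hn : r ≤ n) :
    (leadingCols hm U)ᵀ * A =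
      (Matrix.diagonal fun i : Fin r => singVal A i) * (leadingCols hn V)ᵀ := by
  obtain ⟨hU, -, hA⟩ := h
  have hUU : Uᵀ * U = 1 := (Matrix.mem_orthogonalGroup_iff' (Fin m) ℝ).1 hU
  have h1 : leadingCols hm U = U * (1 : Matrix (Fin m) (Fin m) ℝ).submatrix id (Fin.castLE hm) := by
    ext i j
    simp [leadingCols, Matrix.mul_apply, Matrix.one_apply]
  generalize hw : (fun i => singVal A i) = w at hA ⊢
  have hw' : ∀ i, singVal A i = w i := fun i => congrFun hw i
  simp only [hw'] at hA ⊢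
  rw [h1, hA, Matrix.transpose_mul, ← Matrix.mul_assoc, ← Matrix.mul_assoc,
    Matrix.mul_assoc _ Uᵀ U, hUU, Matrix.mul_one]
  ext i j
  simp only [Matrix.mul_apply, Matrix.submatrix_apply, id, Matrix.one_apply, Matrix.of_apply,
    leadingCols, Matrix.diagonal_apply, Matrix.transpose_apply]
  simp only [ite_mul, one_mul, zero_mul, Finset.sum_ite_eq', Finset.sum_ite_eq, Finset.mem_univ,
    if_true]
  rw [Finset.sum_eq_single (Fin.castLE hn i)]
  · simp
  · intro b _ hb
    rw [if_neg]
    exact fun e => hb (Fin.ext (by simpa using e.symm))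
  · simp

/-- Zero-based index `r - 1` marks the smallest of the `r` leading singular values. -/
theorem opNorm_diagonal_singVal_inv_le {A : Matrix (Fin m) (Fin n) ℝ} {η : ℝ} (hη : 0 < η)
    (h : η ≤ singVal A (r - 1)) :
    opNorm (Matrix.diagonal fun i : Fin r => (singVal A i)⁻¹) ≤ η⁻¹ := by
  refine opNorm_diagonal_le _ (by positivity) fun i => ?_
  have : singVal A (r - 1) ≤ singVal A i := singVal_antitone A (by have := i.2; omega)
  rw [abs_of_nonneg (inv_nonneg.2 (singVal_nonneg _ _))]
  exact inv_anti₀ hη (h.trans this)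

/-- A matrix with row and column space in those of the leading singular vectors of `A` is
nearly fixed by the projections onto the leading singular vectors of a perturbation of `A`. -/
theorem frobNorm_sub_projection_le {A Δ : Matrix (Fin m) (Fin n) ℝ}
    {U U' : Matrix (Fin m) (Fin m) ℝ} {V V' : Matrix (Fin n) (Fin n) ℝ}
    (h : IsSVD A U V) (h' : IsSVD (A + Δ) U' V') (hm : A.rank ≤ m) (hn : A.rank ≤ n)
    {a b : ℕ} (ha : a ≤ m) (hb : b ≤ n) (hra : A.rank ≤ a) (hrb : A.rank ≤ b) {η : ℝ} (hη : 0 < η)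
    (hση : η ≤ singVal A (A.rank - 1)) (Lam : Matrix (Fin A.rank) (Fin A.rank) ℝ)
    {Z : Matrix (Fin m) (Fin n) ℝ} (hZ : Z = leadingCols hm U * Lam * (leadingCols hn V)ᵀ) :
    frobNorm (Z - leadingCols ha U' * (leadingCols ha U')ᵀ * Z *
      (leadingCols hb V' * (leadingCols hb V')ᵀ)) ≤ 6 * (opNorm Δ / η) * frobNorm Z := by
  have hUo := leadingCols_orthonormal hm h.1
  have hVo := leadingCols_orthonormal hn h.2.1
  have hU'o := leadingCols_orthonormal ha h'.1
  have hV'o := leadingCols_orthonormal hb h'.2.1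
  have hAV := h.mul_leadingCols hm hn
  have hUA := h.transpose_leadingCols_mul hm hn
  have hLam : frobNorm Lam = frobNorm Z := by
    rw [hZ, frobNorm_mul_orthonormal hVo, frobNorm_orthonormal_mul hUo]
  have hσ : ∀ i : Fin A.rank, singVal A i ≠ 0 := fun i => (singVal_pos_iff.2 i.2).ne'
  have hDD : (Matrix.diagonal fun i : Fin A.rank => singVal A i) *
      (Matrix.diagonal fun i : Fin A.rank => (singVal A i)⁻¹) = 1 := by
    rw [Matrix.diagonal_mul_diagonal]
    simp only [mul_inv_cancel₀ (hσ _), Matrix.diagonal_one]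
  have hDD' := mul_eq_one_comm.1 hDD
  have hDinv := opNorm_diagonal_singVal_inv_le hη hση
  generalize (Matrix.diagonal fun i : Fin A.rank => singVal A i) = D at hDD hDD' hAV hUA
  generalize (Matrix.diagonal fun i : Fin A.rank => (singVal A i)⁻¹) = D' at hDD hDD' hDinv
  generalize leadingCols hm U = Ur at *
  generalize leadingCols hn V = Vr at *
  -- `A` itself is a competitor of rank at most `c` for approximating `A + Δ`, so no spectral gap of
  -- the perturbed matrix is needed.
  have hleft : ∀ c, A.rank ≤ c → singVal (A + Δ) c ≤ opNorm Δ := fun c hc => by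
    simpa using singVal_le_opNorm_sub (A + Δ) A hc
  have hPU := h'.opNorm_sub_left_le ha
  have hPV := h'.opNorm_sub_right_le hb
  have hP1 : opNorm (leadingCols ha U' * (leadingCols ha U')ᵀ) ≤ 1 := by
    have hu := opNorm_le_one_of_orthonormal hU'o
    refine (opNorm_mul_le _ _).trans ?_
    rw [opNorm_transpose]
    exact mul_le_one₀ hu (opNorm_nonneg _) hu
  have hQ1 : opNorm (leadingCols hb V' * (leadingCols hb V')ᵀ) ≤ 1 := by
    have hu := opNorm_le_one_of_orthonormal hV'o
    refine (opNorm_mul_le _ _).trans ?_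
    rw [opNorm_transpose]
    exact mul_le_one₀ hu (opNorm_nonneg _) hu
  generalize leadingCols ha U' * (leadingCols ha U')ᵀ = Pr at *
  generalize leadingCols hb V' * (leadingCols hb V')ᵀ = Qr at *
  have hΔ := opNorm_nonneg Δ
  -- One `‖Δ‖` for the tail of `A + Δ`, one for `Δ` and one for its projection.
  have hA1 : opNorm (A - Pr * A) ≤ 3 * opNorm Δ := by
    have : A - Pr * A = (A + Δ - Pr * (A + Δ)) - (Δ - Pr * Δ) := by
      rw [Matrix.mul_add]; abel
    rw [this]
    have h1 := opNorm_sub_le (A + Δ - Pr * (A + Δ)) (Δ - Pr * Δ)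
    have h2 := opNorm_sub_le Δ (Pr * Δ)
    have h3 := hPU.trans (hleft a hra)
    have h4 := opNorm_mul_le Pr Δ
    nlinarith
  have hA2 : opNorm (A - A * Qr) ≤ 3 * opNorm Δ := by
    have : A - A * Qr = (A + Δ - (A + Δ) * Qr) - (Δ - Δ * Qr) := by
      rw [Matrix.add_mul]; abel
    rw [this]
    have h1 := opNorm_sub_le (A + Δ - (A + Δ) * Qr) (Δ - Δ * Qr)
    have h2 := opNorm_sub_le Δ (Δ * Qr)
    have h3 := hPV.trans (hleft b hrb)
    have h4 := opNorm_mul_le Δ Qr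
    nlinarith
  -- `Z` factors through `A` on the right and, in `hM2`, on the left, with a cofactor of norm at
  -- most `η⁻¹ ‖Z‖`. What a projection misses of `Z` is thus controlled by what it misses of `A`.
  have hM1 : Z = A * (Vr * (D' * (Lam * Vrᵀ))) := by
    rw [← Matrix.mul_assoc, hAV, Matrix.mul_assoc, ← Matrix.mul_assoc D, hDD, Matrix.one_mul,
      ← Matrix.mul_assoc, hZ]
  have hM2 : Z = Ur * Lam * D' * Urᵀ * A := by
    rw [Matrix.mul_assoc _ Urᵀ, hUA, ← Matrix.mul_assoc, Matrix.mul_assoc _ D', hDD',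
      Matrix.mul_one, hZ]
  have hZ0 := frobNorm_nonneg Z
  have hn1 : frobNorm (Vr * (D' * (Lam * Vrᵀ))) ≤ η⁻¹ * frobNorm Z := by
    rw [frobNorm_orthonormal_mul hVo]
    refine (frobNorm_mul_le _ _).trans ?_
    rw [frobNorm_mul_orthonormal hVo, hLam]
    exact mul_le_mul_of_nonneg_right hDinv hZ0
  have hn2 : frobNorm (Ur * Lam * D' * Urᵀ) ≤ η⁻¹ * frobNorm Z := by
    rw [frobNorm_mul_orthonormal hUo]
    refine (frobNorm_mul_le' _ _).trans ?_
    rw [frobNorm_orthonormal_mul hUo, hLam, mul_comm]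
    exact mul_le_mul_of_nonneg_right hDinv hZ0
  have hsplit : Z - Pr * Z * Qr = (Z - Pr * Z) + Pr * (Z - Z * Qr) := by
    rw [Matrix.mul_sub, Matrix.mul_assoc]; abel
  have hb1 : frobNorm (Z - Pr * Z) ≤ 3 * opNorm Δ * (η⁻¹ * frobNorm Z) := by
    have : Z - Pr * Z = (A - Pr * A) * (Vr * (D' * (Lam * Vrᵀ))) := by
      rw [Matrix.sub_mul, Matrix.mul_assoc Pr, ← hM1]
    rw [this]
    exact (frobNorm_mul_le _ _).trans (mul_le_mul hA1 hn1 (frobNorm_nonneg _) (by positivity))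
  have hb2 : frobNorm (Z - Z * Qr) ≤ 3 * opNorm Δ * (η⁻¹ * frobNorm Z) := by
    have : Z - Z * Qr = (Ur * Lam * D' * Urᵀ) * (A - A * Qr) := by
      rw [Matrix.mul_sub, ← Matrix.mul_assoc _ A, ← hM2]
    rw [this, mul_comm (3 * opNorm Δ)]
    exact (frobNorm_mul_le' _ _).trans (mul_le_mul hn2 hA2 (opNorm_nonneg _) (by positivity))
  have hb3 : frobNorm (Pr * (Z - Z * Qr)) ≤ frobNorm (Z - Z * Qr) :=
    (frobNorm_mul_le _ _).trans (mul_le_of_le_one_left (frobNorm_nonneg _) hP1)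
  rw [hsplit]
  calc _ ≤ _ := frobNorm_add_le _ _
    _ ≤ 3 * opNorm Δ * (η⁻¹ * frobNorm Z) + 3 * opNorm Δ * (η⁻¹ * frobNorm Z) := by linarith
    _ = _ := by ring

end LeadingVectors

end TSRGA

namespace TSRGA

/-! ### Spectral bounds for Gram matrices -/

section Spectral

theorem isHermitian_transpose_mul_self_smul {α β : Type*} [Fintype α] (c : ℝ) (A : Matrix α β ℝ) :
    (c • (Aᵀ * A)).IsHermitian := by
  rw [Matrix.IsHermitian, Matrix.conjTranspose_eq_transpose_of_trivial]
  simp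

/-- The Rayleigh quotient is at least any lower bound of the spectrum. -/
theorem le_dotProduct_mulVec_of_spectrum {ι : Type*} [Fintype ι] [DecidableEq ι]
    {A : Matrix ι ι ℝ} (hA : A.IsHermitian) {c : ℝ} (h : ∀ x ∈ spectrum ℝ A, c ≤ x) (y : ι → ℝ) :
    c * (y ⬝ᵥ y) ≤ y ⬝ᵥ (A *ᵥ y) := by
  have hB : (A - c • (1 : Matrix ι ι ℝ)).IsHermitian := by
    refine hA.sub ?_
    simp [Matrix.IsHermitian]
  have hpsd : (A - c • (1 : Matrix ι ι ℝ)).PosSemidef := by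
    rw [hB.posSemidef_iff_eigenvalues_nonneg]
    intro i
    have hi := hB.eigenvalues_mem_spectrum_real i
    have h2 : hB.eigenvalues i + c ∈ spectrum ℝ A := by
      rw [spectrum.add_mem_iff, Algebra.algebraMap_eq_smul_one, neg_add_eq_sub]
      exact hi
    have := h _ h2
    simpa using this
  have := hpsd.dotProduct_mulVec_nonneg y
  simp only [star_trivial, Matrix.sub_mulVec, Matrix.smul_mulVec, Matrix.one_mulVec,
    dotProduct_sub, dotProduct_smul, smul_eq_mul] at this
  linarith

theorem opNorm_le_of_spectrum {m : ℕ} {A : Matrix (Fin m) (Fin m) ℝ} (hA : A.IsHermitian) {c : ℝ}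
    (hc : 0 ≤ c) (h : ∀ x ∈ spectrum ℝ A, |x| ≤ c) : opNorm A ≤ c := by
  obtain ⟨U, hU, hs⟩ : ∃ U ∈ Matrix.orthogonalGroup (Fin m) ℝ,
      A = U * Matrix.diagonal (RCLike.ofReal ∘ hA.eigenvalues) * star U :=
    ⟨_, hA.eigenvectorUnitary.2, hA.spectral_theorem⟩
  rw [Matrix.star_eq_conjTranspose, Matrix.conjTranspose_eq_transpose_of_trivial] at hs
  have h1 := opNorm_orthogonal_mul_mul_le hU hU
    (Matrix.diagonal (RCLike.ofReal ∘ hA.eigenvalues) : Matrix (Fin m) (Fin m) ℝ)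
  rw [← hs] at h1
  exact h1.trans (opNorm_diagonal_le _ hc fun i => h _ (hA.eigenvalues_mem_spectrum_real i))

end Spectral

/-! ### Consequences of the eigenvalue conditions for one sample -/

section SpectrumSample

variable {n p d : ℕ} {q : Fin p → ℕ} {X : Predictors n q} {μ : ℝ}

theorem sigmaHat_isHermitian (X : Predictors n q) (j : Fin p) : (sigmaHat X j).IsHermitian :=
  isHermitian_transpose_mul_self_smul _ _

/-- All eigenvalues of all `Σ̂_j` lie in `[μ⁻¹, μ]`. -/
def SpectrumBounded (X : Predictors n q) (μ : ℝ) : Prop :=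
  ∀ j, ∀ x ∈ spectrum ℝ (sigmaHat X j), μ⁻¹ ≤ x ∧ x ≤ μ

theorem SpectrumBounded.isUnit (h : SpectrumBounded X μ) (hμ : 0 < μ) (j : Fin p) :
    IsUnit (sigmaHat X j) := by
  rw [← spectrum.zero_notMem_iff ℝ]
  intro h0
  have := (h j 0 h0).1
  have := inv_pos.2 hμ
  linarith

theorem SpectrumBounded.opNorm_le (h : SpectrumBounded X μ) (hμ : 0 < μ) (j : Fin p) :
    opNorm (sigmaHat X j) ≤ μ := by
  refine opNorm_le_of_spectrum (sigmaHat_isHermitian X j) hμ.le fun x hx => ?_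
  have h0 := inv_pos.2 hμ
  rw [abs_of_nonneg (by linarith [(h j x hx).1])]
  exact (h j x hx).2

theorem SpectrumBounded.opNorm_inv_le (h : SpectrumBounded X μ) (hμ : 0 < μ) (j : Fin p) :
    opNorm (sigmaHat X j)⁻¹ ≤ μ := by
  refine opNorm_le_of_spectrum (sigmaHat_isHermitian X j).inv hμ.le fun x hx => ?_
  have hx' : x⁻¹ ∈ spectrum ℝ (sigmaHat X j) := by
    have hu := (Matrix.isUnit_iff_isUnit_det _).1 (h.isUnit hμ j)
    have h1 : (sigmaHat X j)⁻¹ = ↑(h.isUnit hμ j).unit⁻¹ := by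
      rw [Matrix.coe_units_inv, IsUnit.unit_spec]
    rw [h1, ← spectrum.map_inv, Set.mem_inv] at hx
    exact hx
  have h0 := inv_pos.2 hμ
  have h1 := (h j _ hx').1
  have hx0 : 0 < x := inv_pos.1 (h0.trans_le h1)
  rw [abs_of_pos hx0]
  exact (inv_le_inv₀ hμ hx0).1 h1

/-- A nonempty matrix has an eigenvalue, so the interval from `μ⁻¹` to `μ` is nonempty. -/
theorem SpectrumBounded.one_le (h : SpectrumBounded X μ) (hμ : 0 < μ) {j : Fin p} (hq : 0 < q j) :
    1 ≤ μ := by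
  have : Nonempty (Fin (q j)) := ⟨⟨0, hq⟩⟩
  have hi := (sigmaHat_isHermitian X j).eigenvalues_mem_spectrum_real (Classical.arbitrary _)
  have h1 := h j _ hi
  by_contra! hlt
  have : 1 < μ⁻¹ := (one_lt_inv₀ hμ).2 hlt
  linarith

theorem frobNorm_sq_mul_eq (hn : 0 < n) (X : Predictors n q) (j : Fin p)
    (M : Matrix (Fin (q j)) (Fin d) ℝ) :
    frobNorm (X j * M) ^ 2 = n * trInner M (sigmaHat X j * M) := by
  have : (n : ℝ) ≠ 0 := by positivity
  rw [frobNorm_sq, trInner_mul_right, trInner_comm, sigmaHat, Matrix.smul_mul,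
    trInner_smul_right, Matrix.mul_assoc]
  field_simp

theorem SpectrumBounded.frobNorm_mul_le (h : SpectrumBounded X μ) (hμ : 0 < μ) (hn : 0 < n)
    (j : Fin p) (M : Matrix (Fin (q j)) (Fin d) ℝ) :
    frobNorm (X j * M) ≤ √(n * μ) * frobNorm M := by
  refine le_of_sq_le_sq ?_ (mul_nonneg (Real.sqrt_nonneg _) (frobNorm_nonneg _))
  rw [frobNorm_sq_mul_eq hn, mul_pow, Real.sq_sqrt (by positivity), mul_assoc]
  refine mul_le_mul_of_nonneg_left ?_ (by positivity)
  have h1 := trInner_le M (sigmaHat X j * M)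
  have h2 := TSRGA.frobNorm_mul_le (sigmaHat X j) M
  have h3 := h.opNorm_le hμ j
  nlinarith [frobNorm_nonneg M, mul_le_mul_of_nonneg_right h3 (frobNorm_nonneg M)]

/-- The Gram matrix cancels one inverse: the square equals `n tr(Mᵀ Σ̂⁻¹ M)`. This saves a factor
`μ` over bounding `X_j` and the inverse separately. -/
theorem SpectrumBounded.frobNorm_mul_inv_le (h : SpectrumBounded X μ) (hμ : 0 < μ) (hn : 0 < n)
    (j : Fin p) (M : Matrix (Fin (q j)) (Fin d) ℝ) :
    frobNorm (X j * ((sigmaHat X j)⁻¹ * M)) ≤ √(n * μ) * frobNorm M := by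
  refine le_of_sq_le_sq ?_ (mul_nonneg (Real.sqrt_nonneg _) (frobNorm_nonneg _))
  rw [frobNorm_sq_mul_eq hn, mul_pow, Real.sq_sqrt (by positivity), mul_assoc]
  refine mul_le_mul_of_nonneg_left ?_ (by positivity)
  rw [Matrix.mul_nonsing_inv_cancel_left _ _ ((Matrix.isUnit_iff_isUnit_det _).1 (h.isUnit hμ j)),
    trInner_comm]
  have h1 := trInner_le M ((sigmaHat X j)⁻¹ * M)
  have h2 := TSRGA.frobNorm_mul_le (sigmaHat X j)⁻¹ M
  have h3 := h.opNorm_inv_le hμ j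
  nlinarith [frobNorm_nonneg M, mul_le_mul_of_nonneg_right h3 (frobNorm_nonneg M)]

theorem SpectrumBounded.frobNorm_le_mul_inv (h : SpectrumBounded X μ) (hμ : 0 < μ)
    (j : Fin p) (M : Matrix (Fin (q j)) (Fin d) ℝ) :
    frobNorm M ≤ μ * frobNorm ((sigmaHat X j)⁻¹ * M) := by
  have h2 := TSRGA.frobNorm_mul_le (sigmaHat X j) ((sigmaHat X j)⁻¹ * M)
  rw [Matrix.mul_nonsing_inv_cancel_left _ _ ((Matrix.isUnit_iff_isUnit_det _).1 (h.isUnit hμ j))]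
    at h2
  exact h2.trans (mul_le_mul_of_nonneg_right (h.opNorm_le hμ j) (frobNorm_nonneg _))

/-- Column by column: the `k`-th columns of all blocks form one vector, to which the Rayleigh bound
for the stacked Gram matrix applies. -/
theorem sum_frobNorm_sq_le (hn : 0 < n) {c : ℝ} {J : Finset (Fin p)}
    (h : ∀ x ∈ spectrum ℝ ((n : ℝ)⁻¹ • ((stacked X J)ᵀ * stacked X J)), c < x)
    (M : Coefs q d) :
    n * c * ∑ j ∈ J, frobNorm (M j) ^ 2 ≤ frobNorm (∑ j ∈ J, X j * M j) ^ 2 := by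
  have hcol : ∀ k : Fin d, n * c * ∑ j ∈ J, (M j).col k ⬝ᵥ (M j).col k ≤
      (∑ j ∈ J, X j * M j).col k ⬝ᵥ (∑ j ∈ J, X j * M j).col k := by
    intro k
    let y : ((j : J) × Fin (q j)) → ℝ := fun c => M c.1 c.2 k
    have h1 := le_dotProduct_mulVec_of_spectrum
      (isHermitian_transpose_mul_self_smul (n : ℝ)⁻¹ (stacked X J)) (fun x hx => (h x hx).le) y
    have h2 : y ⬝ᵥ y = ∑ j ∈ J, (M j).col k ⬝ᵥ (M j).col k := by
      rw [dotProduct, Fintype.sum_sigma, ← Finset.sum_coe_sort J]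
      rfl
    have h3 : stacked X J *ᵥ y = (∑ j ∈ J, X j * M j).col k := by
      ext i
      rw [Matrix.mulVec, dotProduct, Fintype.sum_sigma, Matrix.col_apply, Matrix.sum_apply,
        ← Finset.sum_coe_sort J]
      rfl
    rw [Matrix.smul_mulVec, dotProduct_smul, ← Matrix.mulVec_mulVec, Matrix.dotProduct_mulVec,
      Matrix.vecMul_transpose, h3, h2, smul_eq_mul] at h1
    have hn' : (0 : ℝ) < n := by positivity
    calc _ = n * (c * ∑ j ∈ J, (M j).col k ⬝ᵥ (M j).col k) := by ring
      _ ≤ n * ((n : ℝ)⁻¹ * _) := mul_le_mul_of_nonneg_left h1 hn'.le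
      _ = _ := by field_simp
  rw [frobNorm_sq_eq_sum_col]
  calc _ = ∑ k, n * c * ∑ j ∈ J, (M j).col k ⬝ᵥ (M j).col k := by
        simp only [frobNorm_sq_eq_sum_col]
        rw [Finset.sum_comm, Finset.mul_sum]
    _ ≤ _ := Finset.sum_le_sum fun k _ => hcol k

end SpectrumSample

end TSRGA

namespace TSRGA

/-! ### General properties of relaxed greedy paths -/

section Path

variable {n p d : ℕ} {q : Fin p → ℕ} {X : Predictors n q} {Y : Matrix (Fin n) (Fin d) ℝ}
  {R : RGAPath q d} {K k : ℕ} {μ : ℝ}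

theorem RGAPath.sub_fit_succ (R : RGAPath q d) (X : Predictors n q) (Y : Matrix (Fin n) (Fin d) ℝ)
    (k : ℕ) (l : ℝ) :
    Y - (1 - l) • R.fit X k - l • (X (R.jhat (k + 1)) * R.atom (k + 1)) =
      (Y - R.fit X k) - l • (X (R.jhat (k + 1)) * R.atom (k + 1) - R.fit X k) := by
  rw [sub_smul, one_smul, smul_sub]
  abel

theorem RGAPath.LineSearch.frobNorm_sq_le (h : R.LineSearch X Y (k + 1)) {l : ℝ}
    (hl : l ∈ Set.Icc (0 : ℝ) 1) :
    frobNorm (Y - R.fit X (k + 1)) ^ 2 ≤ frobNorm (Y - R.fit X k) ^ 2 -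
      2 * l * trInner (Y - R.fit X k) (X (R.jhat (k + 1)) * R.atom (k + 1) - R.fit X k) +
      l ^ 2 * frobNorm (X (R.jhat (k + 1)) * R.atom (k + 1) - R.fit X k) ^ 2 := by
  have h1 := isMinOn_iff.1 h.2 l hl
  simp only [Nat.add_sub_cancel] at h1
  have h2 : Y - R.fit X (k + 1) = Y - (1 - R.lam (k + 1)) • R.fit X k -
      R.lam (k + 1) • (X (R.jhat (k + 1)) * R.atom (k + 1)) := by
    rw [RGAPath.fit]; abel
  rw [h2]
  refine h1.trans (le_of_eq ?_)
  rw [R.sub_fit_succ, frobNorm_sub_sq, trInner_smul_right, frobNorm_smul, mul_pow, sq_abs]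
  ring

theorem RGAPath.LineSearch.antitone (h : R.LineSearch X Y (k + 1)) :
    frobNorm (Y - R.fit X (k + 1)) ^ 2 ≤ frobNorm (Y - R.fit X k) ^ 2 := by
  simpa using h.frobNorm_sq_le (l := 0) (by simp)

/-- The exact line search does at least as well as the step `a / b`, which minimizes the quadratic
`-2 l a + l² b`; the condition `a ≤ b` makes this step admissible. -/
theorem RGAPath.LineSearch.decrease (h : R.LineSearch X Y (k + 1)) {a b : ℝ} (ha : 0 ≤ a)
    (hab : a ≤ b) (hb : 0 < b)
    (h1 : a ≤ trInner (Y - R.fit X k) (X (R.jhat (k + 1)) * R.atom (k + 1) - R.fit X k))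
    (h2 : frobNorm (X (R.jhat (k + 1)) * R.atom (k + 1) - R.fit X k) ^ 2 ≤ b) :
    frobNorm (Y - R.fit X (k + 1)) ^ 2 ≤ frobNorm (Y - R.fit X k) ^ 2 - a ^ 2 / b := by
  have h3 := h.frobNorm_sq_le (l := a / b) ⟨by positivity, (div_le_one hb).2 hab⟩
  have h4 : 2 * (a / b) * a ≤ 2 * (a / b) *
      trInner (Y - R.fit X k) (X (R.jhat (k + 1)) * R.atom (k + 1) - R.fit X k) := by gcongr
  have h5 : (a / b) ^ 2 * frobNorm (X (R.jhat (k + 1)) * R.atom (k + 1) - R.fit X k) ^ 2 ≤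
      (a / b) ^ 2 * b := by gcongr
  have h6 : (a / b) ^ 2 * b = a ^ 2 / b := by field_simp
  have h7 : 2 * (a / b) * a = 2 * (a ^ 2 / b) := by ring
  linarith

theorem signal_sub (X : Predictors n q) (B B' : Coefs q d) :
    signal X B - signal X B' = signal X (fun j => B j - B' j) := by
  simp [signal, Matrix.mul_sub, Finset.sum_sub_distrib]

theorem signal_eq_sum {J : Finset (Fin p)} (X : Predictors n q) {B : Coefs q d}
    (h : ∀ j, j ∉ J → B j = 0) : signal X B = ∑ j ∈ J, X j * B j := by
  refine (Finset.sum_subset (Finset.subset_univ J) fun j _ hj => ?_).symm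
  rw [h j hj, Matrix.mul_zero]

theorem RGAPath.fit_eq_signal (R : RGAPath q d) (X : Predictors n q) (k : ℕ) :
    R.fit X k = signal X (R.coef k) := by
  induction k with
  | zero => simp [RGAPath.fit, RGAPath.coef, signal]
  | succ k ih =>
    have h : ∑ j, X j * (Pi.single (R.jhat (k + 1)) (R.atom (k + 1)) : Coefs q d) j =
        X (R.jhat (k + 1)) * R.atom (k + 1) := by
      rw [Finset.sum_eq_single (R.jhat (k + 1))]
      · simp
      · intro j _ hj
        simp [Pi.single_eq_of_ne hj]
      · simp
    simp only [RGAPath.fit, ih, RGAPath.coef, signal, Matrix.mul_add, Matrix.mul_smul,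
      Finset.sum_add_distrib, ← Finset.smul_sum, h]

theorem RGAPath.selected_mono (R : RGAPath q d) : Monotone R.selected := fun _ _ h =>
  Finset.image_subset_image (Finset.Icc_subset_Icc_right h)

theorem RGAPath.card_selected_le (R : RGAPath q d) (k : ℕ) : (R.selected k).card ≤ k := by
  simpa [RGAPath.selected] using Finset.card_image_le (s := Finset.Icc 1 k) (f := R.jhat)

theorem RGAPath.coef_eq_zero (R : RGAPath q d) {k : ℕ} {j : Fin p} (h : j ∉ R.selected k) :
    R.coef k j = 0 := by
  induction k with
  | zero => rfl
  | succ k ih =>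
    have h1 : j ∉ R.selected k := fun hj => h (R.selected_mono k.le_succ hj)
    have h2 : j ≠ R.jhat (k + 1) := fun e =>
      h (Finset.mem_image.2 ⟨k + 1, by simp, e.symm⟩)
    simp only [RGAPath.coef]
    rw [ih h1, Pi.single_eq_of_ne h2]
    simp

/-- Each iterate is a convex combination of zero and earlier atoms, so the total nuclear norm never
leaves the ball. -/
theorem RGAPath.sum_nuclearNorm_coef_le (R : RGAPath q d) {Ln : ℝ} (hLn : 0 ≤ Ln)
    (hlam : ∀ k, 1 ≤ k → k ≤ K → R.lam k ∈ Set.Icc (0 : ℝ) 1)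
    (hatom : ∀ k, 1 ≤ k → k ≤ K → nuclearNorm (R.atom k) ≤ Ln) (hk : k ≤ K) :
    ∑ j, nuclearNorm (R.coef k j) ≤ Ln := by
  induction k with
  | zero => simpa [RGAPath.coef, nuclearNorm_zero] using hLn
  | succ k ih =>
    obtain ⟨h0, h1⟩ := hlam (k + 1) (by omega) hk
    have ha := hatom (k + 1) (by omega) hk
    have hih := ih (by omega)
    have hs : ∑ j, nuclearNorm ((Pi.single (R.jhat (k + 1)) (R.atom (k + 1)) : Coefs q d) j) =
        nuclearNorm (R.atom (k + 1)) := by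
      rw [Finset.sum_eq_single (R.jhat (k + 1))]
      · simp
      · intro j _ hj
        simp [Pi.single_eq_of_ne hj, nuclearNorm_zero]
      · simp
    calc ∑ j, nuclearNorm (R.coef (k + 1) j)
        ≤ ∑ j, ((1 - R.lam (k + 1)) * nuclearNorm (R.coef k j) + R.lam (k + 1) *
          nuclearNorm ((Pi.single (R.jhat (k + 1)) (R.atom (k + 1)) : Coefs q d) j)) := by
          refine Finset.sum_le_sum fun j _ => ?_
          refine (nuclearNorm_add_le _ _).trans (add_le_add ?_ ?_)
          · exact nuclearNorm_smul_le (by linarith) _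
          · exact nuclearNorm_smul_le h0 _
      _ = (1 - R.lam (k + 1)) * ∑ j, nuclearNorm (R.coef k j) +
          R.lam (k + 1) * nuclearNorm (R.atom (k + 1)) := by
          rw [Finset.sum_add_distrib, ← Finset.mul_sum, ← Finset.mul_sum, hs]
      _ ≤ (1 - R.lam (k + 1)) * Ln + R.lam (k + 1) * Ln := by
          have : 0 ≤ 1 - R.lam (k + 1) := by linarith
          gcongr
      _ = Ln := by ring

theorem SpectrumBounded.frobNorm_signal_le (h : SpectrumBounded X μ) (hμ : 0 < μ) (hn : 0 < n)
    (B : Coefs q d) : frobNorm (signal X B) ≤ √(n * μ) * ∑ j, nuclearNorm (B j) := by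
  rw [Finset.mul_sum]
  refine (frobNorm_sum_le _ _).trans (Finset.sum_le_sum fun j _ => ?_)
  exact (h.frobNorm_mul_le hμ hn j _).trans
    (mul_le_mul_of_nonneg_left (frobNorm_le_nuclearNorm _) (Real.sqrt_nonneg _))

theorem opNorm_le_xiE (X : Predictors n q) (E : Matrix (Fin n) (Fin d) ℝ) (j : Fin p) :
    opNorm ((X j)ᵀ * E) ≤ xiE X E :=
  le_ciSup (f := fun j => opNorm ((X j)ᵀ * E)) (Set.finite_range _).bddAbove j

theorem xiE_nonneg (X : Predictors n q) (E : Matrix (Fin n) (Fin d) ℝ) : 0 ≤ xiE X E :=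
  Real.iSup_nonneg fun _ => opNorm_nonneg _

theorem abs_trInner_le_opNorm_mul_nuclearNorm {m l : ℕ} (E A : Matrix (Fin m) (Fin l) ℝ) :
    |trInner E A| ≤ opNorm E * nuclearNorm A := by
  refine abs_le.2 ⟨?_, trInner_le_opNorm_mul_nuclearNorm E A⟩
  have h := trInner_le_opNorm_mul_nuclearNorm ((-1 : ℝ) • E) A
  have h2 : opNorm ((-1 : ℝ) • E) ≤ opNorm E := by
    rw [neg_one_smul, ← zero_sub]
    exact (opNorm_sub_le _ _).trans (by rw [opNorm_zero, zero_add])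
  rw [trInner_smul_left] at h
  have := mul_le_mul_of_nonneg_right h2 (nuclearNorm_nonneg A)
  linarith

/-- Blockwise duality between operator and nuclear norm: the noise acts on fitted values only
through `ξ_E`. -/
theorem abs_trInner_signal_le (X : Predictors n q) (E : Matrix (Fin n) (Fin d) ℝ) (B : Coefs q d) :
    |trInner E (signal X B)| ≤ xiE X E * ∑ j, nuclearNorm (B j) := by
  rw [signal, trInner_sum_right, Finset.mul_sum]
  refine (Finset.abs_sum_le_sum_abs _ _).trans (Finset.sum_le_sum fun j _ => ?_)
  rw [trInner_mul_right]
  exact (abs_trInner_le_opNorm_mul_nuclearNorm _ _).trans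
    (mul_le_mul_of_nonneg_right (opNorm_le_xiE X E j) (nuclearNorm_nonneg _))

/-- A positively homogeneous function that is at most `T` on a nuclear norm ball. -/
theorem le_nuclearNorm_div_mul {a b : ℕ} {f : Matrix (Fin a) (Fin b) ℝ → ℝ}
    (hf : ∀ (c : ℝ) S, f (c • S) = c * f S) {Ln T : ℝ} (hLn : 0 < Ln)
    (h : ∀ S, nuclearNorm S ≤ Ln → f S ≤ T) (S : Matrix (Fin a) (Fin b) ℝ) :
    f S ≤ nuclearNorm S / Ln * T := by
  rcases (nuclearNorm_nonneg S).eq_or_lt with h0 | h0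
  · have hS : S = 0 := frobNorm_eq_zero.1
      (le_antisymm ((frobNorm_le_nuclearNorm S).trans h0.ge) (frobNorm_nonneg S))
    have hf0 := hf 0 S
    rw [hS, smul_zero, zero_mul] at hf0
    rw [hS, hf0, nuclearNorm_zero, zero_div, zero_mul]
  · have h1 : nuclearNorm ((Ln / nuclearNorm S) • S) ≤ Ln :=
      (nuclearNorm_smul_le (by positivity) S).trans (by rw [div_mul_cancel₀ _ h0.ne'])
    have h2 := h _ h1
    rw [hf] at h2
    calc f S = nuclearNorm S / Ln * (Ln / nuclearNorm S * f S) := by field_simp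
      _ ≤ _ := mul_le_mul_of_nonneg_left h2 (by positivity)

theorem RGAPath.stopTime_le (R : RGAPath q d) (X : Predictors n q) (Y : Matrix (Fin n) (Fin d) ℝ)
    (t : ℝ) (K : ℕ) : R.stopTime X Y t K ≤ K := by
  classical
  unfold RGAPath.stopTime
  split_ifs with h
  · exact (Nat.find_spec h).2.1
  · exact le_rfl

theorem RGAPath.stopTime_spec (R : RGAPath q d) (X : Predictors n q)
    (Y : Matrix (Fin n) (Fin d) ℝ) (t : ℝ) (K : ℕ) :
    (1 ≤ R.stopTime X Y t K ∧ (1 - t) * R.trainErr X Y (R.stopTime X Y t K - 1) ≤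
      R.trainErr X Y (R.stopTime X Y t K)) ∨
    ∀ k, 1 ≤ k → k ≤ K → R.trainErr X Y k < (1 - t) * R.trainErr X Y (k - 1) := by
  classical
  by_cases h : ∃ k, 1 ≤ k ∧ k ≤ K ∧ (1 - t) * R.trainErr X Y (k - 1) ≤ R.trainErr X Y k
  · left
    have hs : R.stopTime X Y t K = Nat.find h := by
      unfold RGAPath.stopTime
      rw [dif_pos h]
    rw [hs]
    exact ⟨(Nat.find_spec h).1, (Nat.find_spec h).2.2⟩
  · right
    push Not at h
    exact h

end Path

end TSRGA

namespace TSRGA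

/-! ### The first stage -/

section FirstStage

variable {n p d : ℕ} {q : Fin p → ℕ} {X : Predictors n q} {E : Matrix (Fin n) (Fin d) ℝ}
  {B : Coefs q d} {R : RGAPath q d} {K k : ℕ} {μ L L₀ M₀ s t : ℝ}

theorem frobNorm_convex_le {m l : ℕ} {A A' : Matrix (Fin m) (Fin l) ℝ} {c w : ℝ}
    (hw : w ∈ Set.Icc (0 : ℝ) 1) (h : frobNorm A ≤ c) (h' : frobNorm A' ≤ c) :
    frobNorm ((1 - w) • A + w • A') ≤ c := by
  obtain ⟨h0, h1⟩ := hw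
  have := frobNorm_add_le ((1 - w) • A) (w • A')
  rw [frobNorm_smul, frobNorm_smul, abs_of_nonneg h0, abs_of_nonneg (sub_nonneg.2 h1)] at this
  nlinarith

theorem sq_le_four_mul {a b c x : ℝ} (hx : 0 ≤ x) (ha : a ≤ c) (hb : b ≤ c)
    (h : x ≤ a + b) : x ^ 2 ≤ 4 * c ^ 2 := by
  nlinarith

/-- Every step of the first stage decreases the residual sum of squares by an amount of the order
of the squared estimation error, when that error exceeds the noise level `ν`. -/
theorem RGAPath.IsFirstStage.decrease (hn : 0 < n) (hμ : 0 < μ) (hX : SpectrumBounded X μ)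
    {Ln ν : ℝ} (hLn : 0 < Ln) (hB : ∑ j, nuclearNorm (B j) ≤ Ln)
    (hR : R.IsFirstStage X (signal X B + E) Ln K) (hk : k + 1 ≤ K)
    (hν : |trInner E (signal X B - R.fit X k)| ≤ ν)
    (he : 2 * ν ≤ frobNorm (signal X B - R.fit X k) ^ 2) :
    frobNorm (signal X B + E - R.fit X (k + 1)) ^ 2 ≤ frobNorm (signal X B + E - R.fit X k) ^ 2 -
      (frobNorm (signal X B - R.fit X k) ^ 2 / 2) ^ 2 / (4 * (n * μ * Ln ^ 2)) := by
  obtain ⟨h1, -, h3, h4⟩ := hR (k + 1) (by omega) hk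
  simp only [Nat.add_sub_cancel] at h3
  have hn' : (0 : ℝ) < n := by positivity
  have hsq : (√(n * μ) * Ln) ^ 2 = n * μ * Ln ^ 2 := by
    rw [mul_pow, Real.sq_sqrt (by positivity)]
  have hfit : frobNorm (R.fit X k) ≤ √(n * μ) * Ln := by
    rw [R.fit_eq_signal]
    refine (hX.frobNorm_signal_le hμ hn _).trans (mul_le_mul_of_nonneg_left ?_ (Real.sqrt_nonneg _))
    exact R.sum_nuclearNorm_coef_le (K := K) hLn.le (fun k hk hkK => (hR k hk hkK).2.2.2.1)
      (fun k hk hkK => (hR k hk hkK).1) (by omega)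
  have hH : frobNorm (X (R.jhat (k + 1)) * R.atom (k + 1)) ≤ √(n * μ) * Ln :=
    (hX.frobNorm_mul_le hμ hn _ _).trans (mul_le_mul_of_nonneg_left
      ((frobNorm_le_nuclearNorm _).trans h1) (Real.sqrt_nonneg _))
  have hS : frobNorm (signal X B) ≤ √(n * μ) * Ln :=
    (hX.frobNorm_signal_le hμ hn _).trans (mul_le_mul_of_nonneg_left hB (Real.sqrt_nonneg _))
  set Rs := signal X B + E - R.fit X k with hRs
  have hT0 : 0 ≤ trInner Rs (X (R.jhat (k + 1)) * R.atom (k + 1)) := by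
    have := h3 (R.jhat (k + 1)) 0 (by rw [nuclearNorm_zero]; exact hLn.le)
    rwa [Matrix.mul_zero, trInner_zero_right] at this
  -- With total nuclear norm at most `Ln`, the signal is in the convex hull of the admissible atoms,
  -- so a linear functional at it is at most the maximum over atoms.
  have hST : trInner Rs (signal X B) ≤ trInner Rs (X (R.jhat (k + 1)) * R.atom (k + 1)) := by
    rw [signal, trInner_sum_right]
    calc ∑ j, trInner Rs (X j * B j)
        ≤ ∑ j, nuclearNorm (B j) / Ln * trInner Rs (X (R.jhat (k + 1)) * R.atom (k + 1)) := by
          refine Finset.sum_le_sum fun j _ => ?_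
          refine le_nuclearNorm_div_mul (f := fun S => trInner Rs (X j * S)) ?_ hLn
            (fun S hS => h3 j S hS) (B j)
          intro c S
          rw [Matrix.mul_smul, trInner_smul_right]
      _ = (∑ j, nuclearNorm (B j)) / Ln * trInner Rs (X (R.jhat (k + 1)) * R.atom (k + 1)) := by
          rw [← Finset.sum_mul, ← Finset.sum_div]
      _ ≤ 1 * trInner Rs (X (R.jhat (k + 1)) * R.atom (k + 1)) :=
          mul_le_mul_of_nonneg_right ((div_le_one hLn).2 hB) hT0
      _ = _ := one_mul _
  have hdec : trInner Rs (signal X B - R.fit X k) =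
      frobNorm (signal X B - R.fit X k) ^ 2 + trInner E (signal X B - R.fit X k) := by
    rw [frobNorm_sq, ← trInner_add_left]
    congr 1
    rw [hRs]; abel
  -- Signal and fit lie in the same ball; this keeps the trial step at most one.
  have he4 : frobNorm (signal X B - R.fit X k) ^ 2 ≤ 4 * (n * μ * Ln ^ 2) := by
    rw [← hsq]
    exact sq_le_four_mul (frobNorm_nonneg _) hS hfit (frobNorm_sub_le _ _)
  have hD : frobNorm (X (R.jhat (k + 1)) * R.atom (k + 1) - R.fit X k) ^ 2 ≤
      4 * (n * μ * Ln ^ 2) := by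
    rw [← hsq]
    exact sq_le_four_mul (frobNorm_nonneg _) hH hfit (frobNorm_sub_le _ _)
  have he0 := sq_nonneg (frobNorm (signal X B - R.fit X k))
  refine h4.decrease (by positivity) (by linarith) (by positivity) ?_ hD
  rw [trInner_sub_right]
  rw [trInner_sub_right] at hdec
  have := neg_abs_le (trInner E (signal X B - R.fit X k))
  linarith

theorem rank_smul_le {m l : ℕ} (c : ℝ) (A : Matrix (Fin m) (Fin l) ℝ) :
    (c • A).rank ≤ A.rank := by
  have : c • A = (c • (1 : Matrix (Fin m) (Fin m) ℝ)) * A := by rw [Matrix.smul_mul, Matrix.one_mul]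
  rw [this]
  exact Matrix.rank_mul_le_right _ _

theorem rank_pos_of_ne_zero {m l : ℕ} {A : Matrix (Fin m) (Fin l) ℝ} (h : A ≠ 0) : 0 < A.rank := by
  refine Nat.pos_of_ne_zero fun h0 => h ?_
  have h1 := nuclearNorm_sq_le A
  rw [h0, Nat.cast_zero, zero_mul] at h1
  have h2 : nuclearNorm A = 0 := pow_eq_zero_iff two_ne_zero |>.1 (le_antisymm h1 (sq_nonneg _))
  exact frobNorm_eq_zero.1
    (le_antisymm ((frobNorm_le_nuclearNorm A).trans h2.le) (frobNorm_nonneg A))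

/-- Each counted block has nuclear norm at least `√(d / s)`, while the total is at most `√d L`. -/
theorem card_relevant_le (hs : 0 < s)
    (hL : ∑ j, nuclearNorm (B j) ≤ √(d : ℝ) * L) (hd : 0 < d) {Jn : Finset (Fin p)}
    (hJn : ∀ j ∈ Jn, s⁻¹ ≤ frobNorm ((√(d : ℝ))⁻¹ • B j) ^ 2) : (Jn.card : ℝ) ≤ L * √s := by
  have hd' : 0 < √(d : ℝ) := Real.sqrt_pos.2 (by positivity)
  have hss : 0 < √s := Real.sqrt_pos.2 hs
  have h1 : ∀ j ∈ Jn, √(d : ℝ) ≤ √s * nuclearNorm (B j) := by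
    intro j hj
    have h := hJn j hj
    rw [frobNorm_smul, mul_pow, sq_abs, inv_pow, Real.sq_sqrt (by positivity)] at h
    have h2 : (d : ℝ) ≤ s * frobNorm (B j) ^ 2 := by
      have hd0 : (0 : ℝ) < d := by positivity
      rw [inv_mul_eq_div, inv_eq_one_div, div_le_div_iff₀ hs hd0] at h
      linarith
    refine (Real.sqrt_le_sqrt h2).trans ?_
    rw [Real.sqrt_mul hs.le, Real.sqrt_sq (frobNorm_nonneg _)]
    exact mul_le_mul_of_nonneg_left (frobNorm_le_nuclearNorm _) hss.le
  have h2 : Jn.card * √(d : ℝ) ≤ √s * (√(d : ℝ) * L) := by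
    calc Jn.card * √(d : ℝ) = ∑ j ∈ Jn, √(d : ℝ) := by simp
      _ ≤ ∑ j ∈ Jn, √s * nuclearNorm (B j) := Finset.sum_le_sum h1
      _ ≤ ∑ j, √s * nuclearNorm (B j) := Finset.sum_le_sum_of_subset_of_nonneg
          (Finset.subset_univ _) fun j _ _ => mul_nonneg hss.le (nuclearNorm_nonneg _)
      _ = √s * ∑ j, nuclearNorm (B j) := by rw [Finset.mul_sum]
      _ ≤ _ := mul_le_mul_of_nonneg_left hL hss.le
  have h3 : Jn.card * √(d : ℝ) ≤ (L * √s) * √(d : ℝ) := by linarith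
  exact (mul_le_mul_iff_left₀ hd').1 h3

/-- The eigenvalues of `n⁻¹ X(J)ᵀ X(J)` exceed `μ⁻¹` for all `J` with at most `m` elements. -/
def RestrictedEigenvalue (X : Predictors n q) (μ : ℝ) (m : ℕ) : Prop :=
  ∀ J : Finset (Fin p), J.card ≤ m →
    ∀ x ∈ spectrum ℝ ((n : ℝ)⁻¹ • ((stacked X J)ᵀ * stacked X J)), μ⁻¹ < x

/-- A first-stage iterate with a coefficient matrix of too small a rank has an estimation error. -/
theorem le_frobNorm_sq_of_rank_lt (hn : 0 < n) (hd : 0 < d) (hμ : 0 < μ)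
    (hX3 : RestrictedEigenvalue X μ (2 * K))
    (hL : ∑ j, nuclearNorm (B j) ≤ √(d : ℝ) * L) (hs : 0 < s)
    (hsB : ∀ j ∈ relevant B, s⁻¹ ≤ singVal ((√(d : ℝ))⁻¹ • B j) ((B j).rank - 1) ^ 2)
    (hLK : L * √s ≤ K) (hk : k ≤ K) {j : Fin p} (hj : (R.coef k j).rank < (B j).rank) :
    n * d / (μ * s) ≤ frobNorm (signal X B - R.fit X k) ^ 2 := by
  classical
  have hn' : (0 : ℝ) < n := by positivity
  have hd' : (0 : ℝ) < d := by positivity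
  have hsd : 0 < √(d : ℝ) := Real.sqrt_pos.2 hd'
  -- A matrix of smaller rank is at distance at least the last nonzero singular value of `B i`. With
  -- `A = 0` this also bounds relevant blocks from below, which limits their number.
  have key : ∀ (i : Fin p) (A : Matrix (Fin (q i)) (Fin d) ℝ), A.rank < (B i).rank →
      s⁻¹ ≤ frobNorm ((√(d : ℝ))⁻¹ • (B i - A)) ^ 2 := by
    intro i A hA
    have hi : i ∈ relevant B := by
      intro h0
      rw [h0, Matrix.rank_zero] at hA
      omega
    refine (hsB i hi).trans (pow_le_pow_left₀ (singVal_nonneg _ _) ?_ 2)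
    refine le_trans ?_ (opNorm_le_frobNorm _)
    rw [smul_sub]
    refine singVal_le_opNorm_sub _ _ ?_
    have := rank_smul_le (√(d : ℝ))⁻¹ A
    omega
  let Jn : Finset (Fin p) := Finset.univ.filter fun i => B i ≠ 0
  have hcard : Jn.card ≤ K := by
    have := card_relevant_le (Jn := Jn) hs hL hd fun i hi => by
      have h0 : B i ≠ 0 := (Finset.mem_filter.1 hi).2
      have := key i 0 (by
        rw [Matrix.rank_zero]
        exact rank_pos_of_ne_zero h0)
      rwa [sub_zero] at this
    exact_mod_cast this.trans hLK
  -- At most `K` relevant and at most `K` selected indices: the estimation error is supported on `2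
  -- * K` blocks, as the restricted eigenvalue condition allows.
  let J := Jn ∪ R.selected k
  have hJ : J.card ≤ 2 * K := by
    have h1 : J.card ≤ _ := Finset.card_union_le Jn (R.selected k)
    have h2 := R.card_selected_le k
    omega
  have hsig : signal X B - R.fit X k = ∑ i ∈ J, X i * (B i - R.coef k i) := by
    rw [R.fit_eq_signal, signal_sub]
    refine signal_eq_sum X fun i hi => ?_
    rw [Finset.mem_union, not_or] at hi
    have h1 : B i = 0 := by simpa [Jn] using hi.1
    rw [h1, R.coef_eq_zero hi.2, sub_zero]
  have hlow := sum_frobNorm_sq_le hn (hX3 J hJ) fun i => B i - R.coef k i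
  rw [← hsig] at hlow
  have hjJ : j ∈ J := by
    refine Finset.mem_union_left _ (Finset.mem_filter.2 ⟨Finset.mem_univ _, fun h0 => ?_⟩)
    rw [h0, Matrix.rank_zero] at hj
    omega
  have hone : frobNorm (B j - R.coef k j) ^ 2 ≤ ∑ i ∈ J, frobNorm (B i - R.coef k i) ^ 2 :=
    Finset.single_le_sum (f := fun i => frobNorm (B i - R.coef k i) ^ 2)
      (fun i _ => sq_nonneg _) hjJ
  have hk := key j _ hj
  rw [frobNorm_smul, mul_pow, sq_abs, inv_pow, Real.sq_sqrt hd'.le, inv_mul_eq_div,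
    inv_eq_one_div, div_le_div_iff₀ hs hd', one_mul] at hk
  refine le_trans ?_ hlow
  rw [div_le_iff₀ (by positivity)]
  have : (d : ℝ) ≤ (∑ i ∈ J, frobNorm (B i - R.coef k i) ^ 2) * s :=
    hk.trans (mul_le_mul_of_nonneg_right hone hs.le)
  calc (n : ℝ) * d ≤ n * ((∑ i ∈ J, frobNorm (B i - R.coef k i) ^ 2) * s) := by gcongr
    _ = _ := by field_simp

/-- With a small enough noise level and threshold, the first stage does not stop before the
coefficient estimates have at least the ranks of the true coefficient matrices. -/
theorem rank_le_rank_coef_stopTime (hn : 0 < n) (hd : 0 < d) (hμ : 0 < μ)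
    (hX : SpectrumBounded X μ) (hX3 : RestrictedEigenvalue X μ (2 * K))
    (hL : ∑ j, nuclearNorm (B j) ≤ √(d : ℝ) * L) (hLL₀ : L ≤ L₀) (hL₀ : 0 < L₀) (hs : 0 < s)
    (hsB : ∀ j ∈ relevant B, s⁻¹ ≤ singVal ((√(d : ℝ))⁻¹ • B j) ((B j).rank - 1) ^ 2)
    (hLK : L * √s ≤ K) (hM₀ : 0 < M₀)
    (hE : M₀⁻¹ ≤ ((n : ℝ) * d)⁻¹ * frobNorm E ^ 2 ∧ ((n : ℝ) * d)⁻¹ * frobNorm E ^ 2 ≤ M₀)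
    (hR : R.IsFirstStage X (signal X B + E) (√(d : ℝ) * L₀) K) {ν : ℝ}
    (hν : (L + L₀) * xiE X E ≤ ν * (n * √(d : ℝ))) (hν1 : 8 * ν * (μ * s) ≤ 1)
    (hν2 : 4 * ν * M₀ ≤ 1)
    (ht1 : t * (2 * μ * L₀ ^ 2 + 2 * M₀) * s ^ 2 < 1 / (64 * μ ^ 3 * L₀ ^ 2))
    (hexp : Real.exp (-(t * K)) * (2 * μ * L₀ ^ 2 + 2 * M₀) < 1 / (2 * M₀)) (j : Fin p) :
    (B j).rank ≤ (R.coef (R.stopTime X (signal X B + E) t K) j).rank := by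
  by_contra! hlt
  set Y := signal X B + E with hY
  set F : ℕ → ℝ := fun k => R.trainErr X Y k with hF
  set e : ℕ → ℝ := fun k => ((n : ℝ) * d)⁻¹ * frobNorm (signal X B - R.fit X k) ^ 2 with he
  set ε := ((n : ℝ) * d)⁻¹ * frobNorm E ^ 2 with hε
  have hn' : (0 : ℝ) < n := by positivity
  have hd' : (0 : ℝ) < d := by positivity
  have hsd : 0 < √(d : ℝ) := Real.sqrt_pos.2 hd'
  have hdd : √(d : ℝ) * √(d : ℝ) = d := Real.mul_self_sqrt hd'.le
  have hLn : 0 < √(d : ℝ) * L₀ := by positivity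
  have hLB : ∑ j, nuclearNorm (B j) ≤ √(d : ℝ) * L₀ :=
    hL.trans (mul_le_mul_of_nonneg_left hLL₀ hsd.le)
  have hN : (0 : ℝ) < n * d := by positivity
  have hcross : ∀ k ≤ K, |trInner E (signal X B - R.fit X k)| ≤ n * d * ν := by
    intro k hk
    have hcoef := R.sum_nuclearNorm_coef_le (K := K) hLn.le
      (fun k hk hkK => (hR k hk hkK).2.2.2.1) (fun k hk hkK => (hR k hk hkK).1) hk
    rw [R.fit_eq_signal, trInner_sub_right]
    have h1 := abs_trInner_signal_le X E B
    have h2 := abs_trInner_signal_le X E (R.coef k)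
    have hx := xiE_nonneg X E
    calc _ ≤ _ := abs_sub _ _
      _ ≤ xiE X E * (√(d : ℝ) * L) + xiE X E * (√(d : ℝ) * L₀) :=
          add_le_add (h1.trans (mul_le_mul_of_nonneg_left hL hx))
            (h2.trans (mul_le_mul_of_nonneg_left hcoef hx))
      _ = √(d : ℝ) * ((L + L₀) * xiE X E) := by ring
      _ ≤ √(d : ℝ) * (ν * (n * √(d : ℝ))) := mul_le_mul_of_nonneg_left hν hsd.le
      _ = n * (√(d : ℝ) * √(d : ℝ)) * ν := by ring
      _ = _ := by rw [hdd]
  -- Up to the cross term, training error is noise level plus estimation error.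
  have hFe : ∀ k ≤ K, |F k - (ε + e k)| ≤ 2 * ν := by
    intro k hk
    have h1 : F k - (ε + e k) = ((n : ℝ) * d)⁻¹ * (2 * trInner E (signal X B - R.fit X k)) := by
      simp only [hF, RGAPath.trainErr, hε, he]
      have : Y - R.fit X k = E + (signal X B - R.fit X k) := by rw [hY]; abel
      rw [this, frobNorm_add_sq]
      ring
    rw [h1, abs_mul, abs_of_pos (inv_pos.2 hN), abs_mul, abs_two, inv_mul_le_iff₀ hN]
    linarith [hcross k hk]
  have hstep : ∀ k, k + 1 ≤ K → 2 * ν ≤ e k →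
      F (k + 1) ≤ F k - e k ^ 2 / (16 * μ * L₀ ^ 2) := by
    intro k hk hek
    have h1 : 2 * (n * d * ν) ≤ frobNorm (signal X B - R.fit X k) ^ 2 := by
      have := mul_le_mul_of_nonneg_left hek hN.le
      rw [he] at this
      simp only at this
      rw [mul_inv_cancel_left₀ hN.ne'] at this
      linarith
    have h2 := hR.decrease hn hμ hX hLn hLB hk (hcross k (by omega)) h1
    simp only [hF, RGAPath.trainErr, he]
    have h3 := mul_le_mul_of_nonneg_left h2 (inv_nonneg.2 hN.le)
    refine h3.trans (le_of_eq ?_)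
    rw [mul_pow (√(d : ℝ)), sq (√(d : ℝ)), hdd]
    field_simp
    ring
  have hmono : ∀ k, k + 1 ≤ K → F (k + 1) ≤ F k := by
    intro k hk
    exact mul_le_mul_of_nonneg_left (hR (k + 1) (by omega) hk).2.2.2.antitone (inv_nonneg.2 hN.le)
  have hF0 : F 0 ≤ 2 * μ * L₀ ^ 2 + 2 * M₀ := by
    have h1 := hX.frobNorm_signal_le hμ hn B
    have h2 : frobNorm (signal X B) ≤ √(n * μ) * (√(d : ℝ) * L₀) :=
      h1.trans (mul_le_mul_of_nonneg_left hLB (Real.sqrt_nonneg _))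
    have h3 : frobNorm (signal X B) ^ 2 ≤ n * d * (μ * L₀ ^ 2) := by
      refine (pow_le_pow_left₀ (frobNorm_nonneg _) h2 2).trans (le_of_eq ?_)
      rw [mul_pow, mul_pow, Real.sq_sqrt (by positivity), Real.sq_sqrt hd'.le]
      ring
    have h4 : frobNorm Y ^ 2 ≤ 2 * frobNorm (signal X B) ^ 2 + 2 * frobNorm E ^ 2 := by
      have := pow_le_pow_left₀ (frobNorm_nonneg _) (frobNorm_add_le (signal X B) E) 2
      nlinarith [sq_nonneg (frobNorm (signal X B) - frobNorm E)]
    have h5 : F 0 = ((n : ℝ) * d)⁻¹ * frobNorm Y ^ 2 := by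
      simp [hF, RGAPath.trainErr, RGAPath.fit]
    have h6 : frobNorm E ^ 2 ≤ n * d * M₀ := by
      have := hE.2
      rw [hε, inv_mul_le_iff₀ hN] at this
      exact this
    rw [h5, inv_mul_le_iff₀ hN]
    -- The summands `2 * μ * L₀ ^ 2` and `2 * M₀` come from `‖a + b‖² ≤ 2‖a‖² + 2‖b‖²` for signal
    -- and noise.
    linarith
  have hFanti : ∀ k ≤ K, F k ≤ F 0 := by
    intro k hk
    induction k with
    | zero => exact le_rfl
    | succ k ih => exact (hmono k hk).trans (ih (by omega))
  have hFnn : ∀ k, 0 ≤ F k := fun k => by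
    simp only [hF, RGAPath.trainErr]
    positivity
  rcases R.stopTime_spec X Y t K with ⟨h1, h2⟩ | h
  · have hkK := R.stopTime_le X Y t K
    set kh := R.stopTime X Y t K with hkh
    obtain ⟨k, hk⟩ : ∃ k, kh = k + 1 := ⟨kh - 1, by omega⟩
    rw [hk] at h2 hlt hkK
    rw [Nat.add_sub_cancel] at h2
    have hlow := le_frobNorm_sq_of_rank_lt hn hd hμ hX3 hL hs hsB hLK hkK hlt
    have hek1 : 1 / (μ * s) ≤ e (k + 1) := by
      simp only [he]
      rw [← div_eq_inv_mul, le_div_iff₀ hN]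
      refine le_trans (le_of_eq ?_) hlow
      ring
    have hμs : 0 < μ * s := by positivity
    have h4ν : 4 * ν ≤ 1 / (2 * (μ * s)) := by
      rw [le_div_iff₀ (by positivity)]
      linarith
    have hhalf : 1 / (μ * s) = 1 / (2 * (μ * s)) + 1 / (2 * (μ * s)) := by field_simp; norm_num
    -- Training errors decrease and track `ε + e` up to `2 * ν`, so a large error at the stopping
    -- step, minus `4 * ν`, was already present one step earlier.
    have hek : 1 / (2 * (μ * s)) ≤ e k := by
      have a1 := abs_le.1 (hFe (k + 1) hkK)
      have a2 := abs_le.1 (hFe k (by omega))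
      have a3 := hmono k hkK
      linarith [a1.1, a2.2]
    have h0 : 0 < 1 / (2 * (μ * s)) := by positivity
    have hdec := hstep k hkK (by linarith)
    have hsq : (1 / (2 * (μ * s))) ^ 2 / (16 * μ * L₀ ^ 2) ≤ e k ^ 2 / (16 * μ * L₀ ^ 2) := by
      gcongr
    have hcrit : (1 - t) * F k ≤ F (k + 1) := h2
    have hFk := hFanti k (by omega)
    have htF : (1 / (2 * (μ * s))) ^ 2 / (16 * μ * L₀ ^ 2) ≤ t * F k := by linarith
    have heq : (1 / (2 * (μ * s))) ^ 2 / (16 * μ * L₀ ^ 2) * s ^ 2 =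
        1 / (64 * μ ^ 3 * L₀ ^ 2) := by
      field_simp; norm_num
    -- The sign of `t` is not assumed: the stopping rule makes `t * F k` at least a strictly
    -- positive decrease.
    have htpos : 0 < t := by
      by_contra! ht
      have := mul_nonpos_of_nonpos_of_nonneg ht (hFnn k)
      have : 0 < (1 / (2 * (μ * s))) ^ 2 / (16 * μ * L₀ ^ 2) := by positivity
      linarith
    have htF2 : t * F k ≤ t * (2 * μ * L₀ ^ 2 + 2 * M₀) := by
      exact mul_le_mul_of_nonneg_left (hFk.trans hF0) htpos.le
    have := mul_le_mul_of_nonneg_right (htF.trans htF2) (sq_nonneg s)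
    linarith
  -- If the rule never fires, the training error decays geometrically and drops below `1 / (2 *
  -- M₀)`, whereas noise keeps it at least `M₀⁻¹ - 2 * ν`. The rank deficiency plays no role in this
  -- case.
  · have hgeo : ∀ k ≤ K, F k ≤ Real.exp (-(t * k)) * F 0 := by
      intro k hk
      induction k with
      | zero => simp
      | succ k ih =>
        have h1 := (h (k + 1) (by omega) hk).le
        rw [Nat.add_sub_cancel] at h1
        have h2 : 1 - t ≤ Real.exp (-t) := Real.one_sub_le_exp_neg t
        calc F (k + 1) ≤ (1 - t) * F k := h1
          _ ≤ Real.exp (-t) * F k := mul_le_mul_of_nonneg_right h2 (hFnn k)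
          _ ≤ Real.exp (-t) * (Real.exp (-(t * k)) * F 0) :=
              mul_le_mul_of_nonneg_left (ih (by omega)) (Real.exp_pos _).le
          _ = _ := by
              rw [← mul_assoc, ← Real.exp_add]
              congr 2
              push_cast
              ring
    have h1 := hgeo K le_rfl
    have h2 := mul_le_mul_of_nonneg_left hF0 (Real.exp_pos (-(t * K))).le
    have h3 := (abs_le.1 (hFe K le_rfl)).1
    have h4 : 0 ≤ e K := by simp only [he]; positivity
    have h5 : 2 * ν ≤ 1 / (2 * M₀) := by
      rw [le_div_iff₀ (by positivity)]
      linarith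
    have h6 : M₀⁻¹ = 1 / (2 * M₀) + 1 / (2 * M₀) := by field_simp; norm_num
    linarith [hE.1]

end FirstStage

end TSRGA

namespace TSRGA

/-! ### The second stage -/

/-- A quantity that contracts as long as the error `e` exceeds the noise level `4 η`. -/
theorem sq_le_of_contraction {e g : ℕ → ℝ} {η ρ : ℝ} {K : ℕ} (hη : 0 ≤ η) (hρ : ρ ≤ 1)
    (he : ∀ k, 0 ≤ e k) (hanti : ∀ k < K, g (k + 1) ≤ g k)
    (hlow : ∀ k ≤ K, e k ^ 2 - 2 * η * e k ≤ g k) (hup : ∀ k ≤ K, g k ≤ e k ^ 2 + 2 * η * e k)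
    (hcon : ∀ k < K, 4 * η < e k → g (k + 1) ≤ (1 - ρ) * g k) {m : ℕ} (hm : m ≤ K) :
    e m ^ 2 ≤ 3 * ((1 - ρ) ^ m * e 0 ^ 2) + 36 * η ^ 2 := by
  have h1ρ : 0 ≤ 1 - ρ := by linarith
  -- `24 = 4² + 2 · 4`. Once `g` is this small it stays so by monotonicity, even if `e` later
  -- exceeds `4 * η`.
  have hsmall : ∀ k ≤ K, e k ≤ 4 * η → g k ≤ 24 * η ^ 2 := fun k hk h => by
    nlinarith [hup k hk, he k]
  have key : ∀ k ≤ K, g k ≤ 24 * η ^ 2 ∨ g k ≤ (1 - ρ) ^ k * g 0 := by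
    intro k hk
    induction k with
    | zero => right; simp
    | succ k ih =>
      by_cases h4 : e k ≤ 4 * η
      · left
        exact (hanti k (by omega)).trans (hsmall k (by omega) h4)
      rcases ih (by omega) with h | h
      · left
        exact (hanti k (by omega)).trans h
      · right
        refine (hcon k (by omega) (not_le.1 h4)).trans ?_
        rw [pow_succ' (1 - ρ) k, mul_assoc]
        exact mul_le_mul_of_nonneg_left h h1ρ
  -- `e² - 2 η e ≤ 24 η²` factors as `(e - 6 η)(e + 4 η) ≤ 0`.
  have hfin : ∀ k ≤ K, g k ≤ 24 * η ^ 2 → e k ^ 2 ≤ 36 * η ^ 2 := by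
    intro k hk h
    have : e k ≤ 6 * η := by nlinarith [hlow k hk, he k]
    nlinarith [he k]
  have hpow : 0 ≤ (1 - ρ) ^ m * e 0 ^ 2 := by positivity
  rcases key m hm with h | h
  · linarith [hfin m hm h]
  · by_cases h4 : e m ≤ 4 * η
    · linarith [hfin m hm (hsmall m hm h4)]
    have h0 : g m ≤ g 0 := by
      clear h h4 hpow
      induction m with
      | zero => exact le_rfl
      | succ m ih => exact (hanti m (by omega)).trans (ih (by omega))
    by_cases h40 : e 0 ≤ 4 * η
    · linarith [hfin m hm (h0.trans (hsmall 0 (by omega) h40))]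
    -- Above `4 * η` the cross term is at most half of `e²`, so `g` lies between `e² / 2` and `3 e²
    -- / 2`; the ratio of these gives the factor `3`.
    have h5 : g 0 ≤ 3 / 2 * e 0 ^ 2 := by nlinarith [hup 0 (by omega), he 0]
    have h6 : e m ^ 2 ≤ 2 * g m := by nlinarith [hlow m hm, he m]
    have h7 := mul_le_mul_of_nonneg_left h5 (pow_nonneg h1ρ m)
    nlinarith [sq_nonneg η]

section SecondStage

variable {n p d : ℕ} {q : Fin p → ℕ} {X : Predictors n q} {E : Matrix (Fin n) (Fin d) ℝ}
  {B : Coefs q d} {R : RGAPath q d} {K k r : ℕ} {μ : ℝ} {U : ∀ j, Matrix (Fin (q j)) (Fin (q j)) ℝ}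
  {V : Fin p → Matrix (Fin d) (Fin d) ℝ} {j : Fin p} {J : Finset (Fin p)}

theorem candidate_add (S S' : Matrix (Fin (rowDim r (q j) d)) (Fin (colDim r (q j) d)) ℝ) :
    candidate X r U V j (S + S') = candidate X r U V j S + candidate X r U V j S' := by
  simp [candidate, Matrix.mul_add, Matrix.add_mul]

theorem candidate_sub (S S' : Matrix (Fin (rowDim r (q j) d)) (Fin (colDim r (q j) d)) ℝ) :
    candidate X r U V j (S - S') = candidate X r U V j S - candidate X r U V j S' := by
  simp [candidate, Matrix.mul_sub, Matrix.sub_mul]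

theorem candidate_smul (c : ℝ)
    (S : Matrix (Fin (rowDim r (q j) d)) (Fin (colDim r (q j) d)) ℝ) :
    candidate X r U V j (c • S) = c • candidate X r U V j S := by
  simp [candidate]

theorem candidate_zero : candidate X r U V j 0 = 0 := by simp [candidate]

theorem candidate_eq (S : Matrix (Fin (rowDim r (q j) d)) (Fin (colDim r (q j) d)) ℝ) :
    candidate X r U V j S = (sigmaHat X j)⁻¹ * (leadingCols (rowDim_le r (q j) d) (U j) *
      (S * (leadingCols (colDim_le r (q j) d) (V j))ᵀ)) := by
  simp only [candidate, Matrix.mul_assoc]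

theorem frobNorm_mul_candidate_le (hX : SpectrumBounded X μ) (hμ : 0 < μ) (hn : 0 < n)
    (hU : U j ∈ Matrix.orthogonalGroup (Fin (q j)) ℝ) (hV : V j ∈ Matrix.orthogonalGroup (Fin d) ℝ)
    (S : Matrix (Fin (rowDim r (q j) d)) (Fin (colDim r (q j) d)) ℝ) :
    frobNorm (X j * candidate X r U V j S) ≤ √(n * μ) * frobNorm S := by
  rw [candidate_eq]
  refine (hX.frobNorm_mul_inv_le hμ hn j _).trans (le_of_eq ?_)
  rw [frobNorm_orthonormal_mul (leadingCols_orthonormal _ hU),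
    frobNorm_mul_orthonormal (leadingCols_orthonormal _ hV)]

theorem frobNorm_le_candidate (hX : SpectrumBounded X μ) (hμ : 0 < μ)
    (hU : U j ∈ Matrix.orthogonalGroup (Fin (q j)) ℝ) (hV : V j ∈ Matrix.orthogonalGroup (Fin d) ℝ)
    (S : Matrix (Fin (rowDim r (q j) d)) (Fin (colDim r (q j) d)) ℝ) :
    frobNorm S ≤ μ * frobNorm (candidate X r U V j S) := by
  rw [candidate_eq]
  refine le_trans (le_of_eq ?_) (hX.frobNorm_le_mul_inv hμ j _)
  rw [frobNorm_orthonormal_mul (leadingCols_orthonormal _ hU),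
    frobNorm_mul_orthonormal (leadingCols_orthonormal _ hV)]

theorem abs_trInner_candidate_le (hX : SpectrumBounded X μ) (hμ : 0 < μ)
    (hU : U j ∈ Matrix.orthogonalGroup (Fin (q j)) ℝ) (hV : V j ∈ Matrix.orthogonalGroup (Fin d) ℝ)
    (S : Matrix (Fin (rowDim r (q j) d)) (Fin (colDim r (q j) d)) ℝ) :
    |trInner E (X j * candidate X r U V j S)| ≤ μ * xiE X E * nuclearNorm S := by
  rw [trInner_mul_right]
  refine (abs_trInner_le_opNorm_mul_nuclearNorm _ _).trans ?_
  have h1 : nuclearNorm (candidate X r U V j S) ≤ μ * nuclearNorm S := by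
    have h2 := nuclearNorm_mul_mul_le ((sigmaHat X j)⁻¹ * leadingCols (rowDim_le r (q j) d) (U j)) S
      (leadingCols (colDim_le r (q j) d) (V j))ᵀ
    have hu := opNorm_le_one_of_orthonormal (leadingCols_orthonormal (rowDim_le r (q j) d) hU)
    have hv := opNorm_le_one_of_orthonormal (leadingCols_orthonormal (colDim_le r (q j) d) hV)
    have h3 := opNorm_mul_le (sigmaHat X j)⁻¹ (leadingCols (rowDim_le r (q j) d) (U j))
    have h4 : opNorm ((sigmaHat X j)⁻¹ * leadingCols (rowDim_le r (q j) d) (U j)) ≤ μ * 1 :=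
      h3.trans (mul_le_mul (hX.opNorm_inv_le hμ j) hu (opNorm_nonneg _) hμ.le)
    rw [opNorm_transpose] at h2
    have hS := nuclearNorm_nonneg S
    calc _ ≤ _ := h2
      _ ≤ (μ * 1) * nuclearNorm S * 1 := by
          gcongr
          exact opNorm_nonneg _
      _ = _ := by ring
  calc _ ≤ xiE X E * (μ * nuclearNorm S) :=
        mul_le_mul (opNorm_le_xiE X E j) h1 (nuclearNorm_nonneg _) (xiE_nonneg X E)
    _ = _ := by ring

/-- The smaller coordinate dimension is `r` for truncated blocks and `min (q j) d` for full ones,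
exactly the quantities maximized in `kappa`. -/
theorem sum_min_dim_le_kappa (q : Fin p → ℕ) (d : ℕ) (J : Finset (Fin p)) (r : ℕ) :
    ∑ j ∈ J, min (rowDim r (q j) d) (colDim r (q j) d) ≤ kappa q d J r := by
  rw [kappa, ← smul_eq_mul]
  refine Finset.sum_le_card_nsmul _ _ _ fun j hj => ?_
  by_cases h : r < min (q j) d
  · have hne : (J.filter fun j => r < min (q j) d).Nonempty := ⟨j, Finset.mem_filter.2 ⟨hj, h⟩⟩
    rw [if_pos hne]
    simp [rowDim, colDim, h]
  · refine le_max_of_le_left ?_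
    have := Finset.le_sup (f := fun j => min (q j) d)
      (Finset.mem_filter.2 ⟨hj, h⟩ : j ∈ J.filter fun j => ¬ r < min (q j) d)
    rw [rowDim, colDim, if_neg h, if_neg h]
    exact this

/-- The nuclear norms of the second-stage coordinates of a fitted value are controlled by its
Frobenius norm and `κ`. -/
theorem sum_nuclearNorm_le (hX : SpectrumBounded X μ) (hμ : 0 < μ) (hn : 0 < n)
    (hX3 : RestrictedEigenvalue X μ (2 * K)) (hJ : J.card ≤ 2 * K)
    (hU : ∀ j ∈ J, U j ∈ Matrix.orthogonalGroup (Fin (q j)) ℝ)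
    (hV : ∀ j ∈ J, V j ∈ Matrix.orthogonalGroup (Fin d) ℝ)
    (D : ∀ j, Matrix (Fin (rowDim r (q j) d)) (Fin (colDim r (q j) d)) ℝ) :
    ∑ j ∈ J, nuclearNorm (D j) ≤
      √(kappa q d J r * μ ^ 3 / n) * frobNorm (∑ j ∈ J, X j * candidate X r U V j (D j)) := by
  have hn' : (0 : ℝ) < n := by positivity
  refine le_of_sq_le_sq ?_ (mul_nonneg (Real.sqrt_nonneg _) (frobNorm_nonneg _))
  rw [mul_pow, Real.sq_sqrt (by positivity)]
  have h1 : ∀ j, nuclearNorm (D j) ≤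
      √(min (rowDim r (q j) d) (colDim r (q j) d) : ℕ) * frobNorm (D j) := by
    intro j
    refine le_of_sq_le_sq ?_ (mul_nonneg (Real.sqrt_nonneg _) (frobNorm_nonneg _))
    rw [mul_pow, Real.sq_sqrt (by positivity)]
    refine (nuclearNorm_sq_le _).trans (mul_le_mul_of_nonneg_right ?_ (sq_nonneg _))
    exact_mod_cast le_min (Matrix.rank_le_height _) (Matrix.rank_le_width _)
  -- Cauchy–Schwarz across blocks yields `κ`. Passing from coordinates to coefficients costs `μ²`,
  -- and from coefficients to fitted values `μ / n`.
  have h2 : (∑ j ∈ J, nuclearNorm (D j)) ^ 2 ≤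
      (∑ j ∈ J, (√(min (rowDim r (q j) d) (colDim r (q j) d) : ℕ)) ^ 2) *
        ∑ j ∈ J, frobNorm (D j) ^ 2 :=
    (pow_le_pow_left₀ (Finset.sum_nonneg fun j _ => nuclearNorm_nonneg _)
      (Finset.sum_le_sum fun j _ => h1 j) 2).trans (Finset.sum_mul_sq_le_sq_mul_sq _ _ _)
  have h3 : ∑ j ∈ J, (√(min (rowDim r (q j) d) (colDim r (q j) d) : ℕ)) ^ 2 ≤
      (kappa q d J r : ℝ) := by
    calc _ = ((∑ j ∈ J, min (rowDim r (q j) d) (colDim r (q j) d) : ℕ) : ℝ) := by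
          rw [Nat.cast_sum]
          exact Finset.sum_congr rfl fun j _ => Real.sq_sqrt (by positivity)
      _ ≤ _ := by exact_mod_cast sum_min_dim_le_kappa q d J r
  have h4 : ∑ j ∈ J, frobNorm (D j) ^ 2 ≤
      μ ^ 2 * ∑ j ∈ J, frobNorm (candidate X r U V j (D j)) ^ 2 := by
    rw [Finset.mul_sum]
    refine Finset.sum_le_sum fun j hj => ?_
    rw [← mul_pow]
    exact pow_le_pow_left₀ (frobNorm_nonneg _)
      (frobNorm_le_candidate hX hμ (hU j hj) (hV j hj) _) 2
  have h5 := sum_frobNorm_sq_le hn (hX3 J hJ) fun j => candidate X r U V j (D j)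
  have h6 : ∑ j ∈ J, frobNorm (candidate X r U V j (D j)) ^ 2 ≤
      μ / n * frobNorm (∑ j ∈ J, X j * candidate X r U V j (D j)) ^ 2 := by
    rw [div_mul_eq_mul_div, le_div_iff₀ hn']
    have := mul_le_mul_of_nonneg_left h5 hμ.le
    refine le_trans (le_of_eq ?_) this
    field_simp
  have h7 : (0 : ℝ) ≤ ∑ j ∈ J, frobNorm (D j) ^ 2 := Finset.sum_nonneg fun j _ => sq_nonneg _
  calc _ ≤ _ := h2
    _ ≤ (kappa q d J r : ℝ) * ∑ j ∈ J, frobNorm (D j) ^ 2 := mul_le_mul_of_nonneg_right h3 h7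
    _ ≤ (kappa q d J r : ℝ) * (μ ^ 2 *
          (μ / n * frobNorm (∑ j ∈ J, X j * candidate X r U V j (D j)) ^ 2)) := by
        refine mul_le_mul_of_nonneg_left (h4.trans ?_) (by positivity)
        exact mul_le_mul_of_nonneg_left h6 (by positivity)
    _ = _ := by ring

/-- Second-stage iterates are in the span of the candidates, and bounded. -/
theorem exists_fit_eq (hX : SpectrumBounded X μ) (hμ : 0 < μ) (hn : 0 < n) {Ln : ℝ} (hLn : 0 ≤ Ln)
    (hU : ∀ j ∈ J, U j ∈ Matrix.orthogonalGroup (Fin (q j)) ℝ)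
    (hV : ∀ j ∈ J, V j ∈ Matrix.orthogonalGroup (Fin d) ℝ)
    (hR : ∀ k, 1 ≤ k → k ≤ K → R.jhat k ∈ J ∧ R.lam k ∈ Set.Icc (0 : ℝ) 1 ∧
      ∃ S, R.atom k = candidate X r U V (R.jhat k) S ∧ nuclearNorm S ≤ Ln) (hk : k ≤ K) :
    frobNorm (R.fit X k) ≤ √(n * μ) * Ln ∧
    ∃ D : ∀ j, Matrix (Fin (rowDim r (q j) d)) (Fin (colDim r (q j) d)) ℝ,
      R.fit X k = ∑ j ∈ J, X j * candidate X r U V j (D j) := by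
  induction k with
  | zero =>
    refine ⟨?_, fun _ => 0, ?_⟩
    · rw [RGAPath.fit, frobNorm_zero]
      positivity
    · simp [RGAPath.fit, candidate_zero]
  | succ k ih =>
    obtain ⟨hb, D, hD⟩ := ih (by omega)
    obtain ⟨hj, hlam, S, hS, hSn⟩ := hR (k + 1) (by omega) hk
    refine ⟨?_, fun j => (1 - R.lam (k + 1)) • D j + R.lam (k + 1) •
      (Pi.single (R.jhat (k + 1)) S : ∀ j,
        Matrix (Fin (rowDim r (q j) d)) (Fin (colDim r (q j) d)) ℝ) j, ?_⟩
    · rw [RGAPath.fit]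
      refine frobNorm_convex_le hlam hb ?_
      rw [hS]
      exact (frobNorm_mul_candidate_le hX hμ hn (hU _ hj) (hV _ hj) S).trans
        (mul_le_mul_of_nonneg_left ((frobNorm_le_nuclearNorm S).trans hSn) (Real.sqrt_nonneg _))
    · have h : ∑ j ∈ J, X j * candidate X r U V j ((Pi.single (R.jhat (k + 1)) S : ∀ j,
          Matrix (Fin (rowDim r (q j) d)) (Fin (colDim r (q j) d)) ℝ) j) =
          X (R.jhat (k + 1)) * candidate X r U V (R.jhat (k + 1)) S := by
        rw [Finset.sum_eq_single_of_mem _ hj]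
        · simp
        · intro j _ hne
          rw [Pi.single_eq_of_ne hne, candidate_zero, Matrix.mul_zero]
      simp only [RGAPath.fit, hS, candidate_add, candidate_smul, Matrix.mul_add, Matrix.mul_smul,
        Finset.sum_add_distrib, ← Finset.smul_sum, h, ← hD]

end SecondStage

end TSRGA

namespace TSRGA

/-! ### Contraction of the second stage and approximation of the signal by its candidates -/

section SecondStageConvergence

variable {n p d : ℕ} {q : Fin p → ℕ} {X : Predictors n q} {E : Matrix (Fin n) (Fin d) ℝ}
  {B : Coefs q d} {R : RGAPath q d} {K k r : ℕ} {μ : ℝ} {U : ∀ j, Matrix (Fin (q j)) (Fin (q j)) ℝ}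
  {V : Fin p → Matrix (Fin d) (Fin d) ℝ} {j : Fin p} {J : Finset (Fin p)}

/-- The coordinates of `B_j` in the second-stage candidate space of the predictor `j`. -/
noncomputable def projCoord (X : Predictors n q) (B : Coefs q d) (r : ℕ)
    (U : ∀ j, Matrix (Fin (q j)) (Fin (q j)) ℝ) (V : Fin p → Matrix (Fin d) (Fin d) ℝ) (j : Fin p) :
    Matrix (Fin (rowDim r (q j) d)) (Fin (colDim r (q j) d)) ℝ :=
  (leadingCols (rowDim_le r (q j) d) (U j))ᵀ * (sigmaHat X j * B j) *
    leadingCols (colDim_le r (q j) d) (V j)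

/-- Orthonormal columns contract, so only `Σ̂_j` costs a factor. With `μ L ≤ L₀ / 4` the coordinates
then fit into a quarter of the second-stage ball. -/
theorem nuclearNorm_projCoord_le (hX : SpectrumBounded X μ) (hμ : 0 < μ)
    (hU : U j ∈ Matrix.orthogonalGroup (Fin (q j)) ℝ)
    (hV : V j ∈ Matrix.orthogonalGroup (Fin d) ℝ) :
    nuclearNorm (projCoord X B r U V j) ≤ μ * nuclearNorm (B j) := by
  have hu := opNorm_le_one_of_orthonormal (leadingCols_orthonormal (rowDim_le r (q j) d) hU)
  have hv := opNorm_le_one_of_orthonormal (leadingCols_orthonormal (colDim_le r (q j) d) hV)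
  have h1 := nuclearNorm_mul_mul_le
    ((leadingCols (rowDim_le r (q j) d) (U j))ᵀ * sigmaHat X j) (B j)
    (leadingCols (colDim_le r (q j) d) (V j))
  have h2 := opNorm_mul_le (leadingCols (rowDim_le r (q j) d) (U j))ᵀ (sigmaHat X j)
  rw [opNorm_transpose] at h2
  have h3 : opNorm ((leadingCols (rowDim_le r (q j) d) (U j))ᵀ * sigmaHat X j) ≤ 1 * μ :=
    h2.trans (mul_le_mul hu (hX.opNorm_le hμ j) (opNorm_nonneg _) zero_le_one)
  have hB := nuclearNorm_nonneg (B j)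
  rw [projCoord, ← Matrix.mul_assoc]
  calc _ ≤ _ := h1
    _ ≤ (1 * μ) * nuclearNorm (B j) * 1 := by
        gcongr
        exact opNorm_nonneg _
    _ = _ := by ring

/-- The decrease of the residual sum of squares in one step of the second stage. -/
theorem second_stage_decrease (hX : SpectrumBounded X μ) (hμ : 1 ≤ μ) (hn : 0 < n)
    (hX3 : RestrictedEigenvalue X μ (2 * K)) (hJ : J.card ≤ 2 * K) {Ln : ℝ} (hLn : 0 < Ln)
    (hU : ∀ j ∈ J, U j ∈ Matrix.orthogonalGroup (Fin (q j)) ℝ)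
    (hV : ∀ j ∈ J, V j ∈ Matrix.orthogonalGroup (Fin d) ℝ) {Y : Matrix (Fin n) (Fin d) ℝ}
    (hline : R.LineSearch X Y (k + 1))
    (hmax : ∀ j ∈ J, ∀ S : Matrix (Fin (rowDim r (q j) d)) (Fin (colDim r (q j) d)) ℝ,
      nuclearNorm S ≤ Ln → trInner (Y - R.fit X k) (X j * candidate X r U V j S) ≤
        trInner (Y - R.fit X k) (X (R.jhat (k + 1)) * R.atom (k + 1)))
    (hH : frobNorm (X (R.jhat (k + 1)) * R.atom (k + 1)) ≤ √(n * μ) * Ln)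
    (hG : frobNorm (R.fit X k) ≤ √(n * μ) * Ln)
    {S D : ∀ j, Matrix (Fin (rowDim r (q j) d)) (Fin (colDim r (q j) d)) ℝ}
    (hS : ∑ j ∈ J, nuclearNorm (S j) ≤ Ln / 4) {Ys : Matrix (Fin n) (Fin d) ℝ}
    (hYs : Ys = ∑ j ∈ J, X j * candidate X r U V j (S j)) (hJne : J.Nonempty)
    (hYsb : frobNorm Ys ≤ √(n * μ) * Ln)
    (hD : Ys - R.fit X k = ∑ j ∈ J, X j * candidate X r U V j (D j)) {η : ℝ}
    (hη : |trInner (Y - Ys) (Ys - R.fit X k)| ≤ η * frobNorm (Ys - R.fit X k))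
    (he : 4 * η < frobNorm (Ys - R.fit X k)) (hη0 : 0 ≤ η) :
    0 < kappa q d J r ∧ frobNorm (Y - R.fit X (k + 1)) ^ 2 ≤ frobNorm (Y - R.fit X k) ^ 2 -
      81 / 1024 * frobNorm (Ys - R.fit X k) ^ 2 / (kappa q d J r * μ ^ 4) := by
  have hμ0 : 0 < μ := by linarith
  have hn' : (0 : ℝ) < n := by positivity
  set Rs := Y - R.fit X k with hRs
  set T := trInner Rs (X (R.jhat (k + 1)) * R.atom (k + 1)) with hT
  set e := frobNorm (Ys - R.fit X k) with hedef
  have he0 : 0 < e := by linarith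
  have hT0 : 0 ≤ T := by
    obtain ⟨j, hj⟩ := hJne
    have := hmax j hj 0 (by rw [nuclearNorm_zero]; exact hLn.le)
    rwa [candidate_zero, Matrix.mul_zero, trInner_zero_right] at this
  have hscale : ∀ W : ∀ j, Matrix (Fin (rowDim r (q j) d)) (Fin (colDim r (q j) d)) ℝ,
      trInner Rs (∑ j ∈ J, X j * candidate X r U V j (W j)) ≤
        (∑ j ∈ J, nuclearNorm (W j)) / Ln * T := by
    intro W
    rw [trInner_sum_right, Finset.sum_div, Finset.sum_mul]
    refine Finset.sum_le_sum fun j hj => ?_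
    refine le_nuclearNorm_div_mul (f := fun S => trInner Rs (X j * candidate X r U V j S)) ?_ hLn
      (fun S hS => hmax j hj S hS) (W j)
    intro c S
    rw [candidate_smul, Matrix.mul_smul, trInner_smul_right]
  -- The quarter radius pays off here: the target reaches at most a quarter of the best atom's
  -- correlation, which leaves `3 / 4 * T` for the descent direction.
  have h1 : trInner Rs Ys ≤ 1 / 4 * T := by
    rw [hYs]
    refine (hscale S).trans (mul_le_mul_of_nonneg_right ?_ hT0)
    rw [div_le_iff₀ hLn]
    linarith
  -- The cross term is at most `η * e`, and `4 * η < e` makes it less than a quarter of `e ^ 2`.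
  have h2 : 3 / 4 * e ^ 2 ≤ trInner Rs (Ys - R.fit X k) := by
    have : Rs = (Ys - R.fit X k) + (Y - Ys) := by rw [hRs]; abel
    rw [this, trInner_add_left, ← frobNorm_sq]
    have := neg_abs_le (trInner (Y - Ys) (Ys - R.fit X k))
    nlinarith
  set A := √(kappa q d J r * μ ^ 3 / n) with hA
  have hA0 : 0 ≤ A := Real.sqrt_nonneg _
  have hsumD : ∑ j ∈ J, nuclearNorm (D j) ≤ A * e := by
    have := sum_nuclearNorm_le hX hμ0 hn hX3 hJ hU hV D
    rwa [← hD] at this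
  have h3 : 3 / 4 * e ^ 2 ≤ A * e / Ln * T := by
    refine h2.trans ?_
    rw [hD]
    refine (hscale D).trans (mul_le_mul_of_nonneg_right ?_ hT0)
    gcongr
  have h4 : 3 / 4 * e * Ln ≤ A * T := by
    have : A * e / Ln * T * Ln = A * T * e := by field_simp
    have h5 := mul_le_mul_of_nonneg_right h3 hLn.le
    rw [this] at h5
    refine le_of_mul_le_mul_right ?_ he0
    calc _ = 3 / 4 * e ^ 2 * Ln := by ring
      _ ≤ _ := h5
  have hApos : 0 < A := by
    refine lt_of_le_of_ne hA0 fun h => ?_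
    rw [← h, zero_mul] at h4
    have : 0 < 3 / 4 * e * Ln := by positivity
    linarith
  -- If `κ` were zero, all differences would have zero coordinates, contradicting `e > 0`.
  have hκ : 0 < kappa q d J r := by
    by_contra! h
    have h0 : kappa q d J r = 0 := by omega
    rw [hA, h0] at hApos
    simp at hApos
  have hκ1 : (1 : ℝ) ≤ kappa q d J r := by exact_mod_cast hκ
  refine ⟨hκ, ?_⟩
  have hAsq : A ^ 2 * n = kappa q d J r * μ ^ 3 := by
    rw [hA, Real.sq_sqrt (by positivity)]
    field_simp
  have hsq : (√(n * μ) * Ln) ^ 2 = n * μ * Ln ^ 2 := by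
    rw [mul_pow, Real.sq_sqrt (by positivity)]
  have he4 : e ^ 2 ≤ 4 * (n * μ * Ln ^ 2) := by
    rw [← hsq]
    exact sq_le_four_mul he0.le hYsb hG (frobNorm_sub_le _ _)
  have hb : frobNorm (X (R.jhat (k + 1)) * R.atom (k + 1) - R.fit X k) ^ 2 ≤
      4 * (n * μ * Ln ^ 2) := by
    rw [← hsq]
    exact sq_le_four_mul (frobNorm_nonneg _) hH hG (frobNorm_sub_le _ _)
  -- One factor `3 / 4` from `h4`, another from the quarter-radius slack. Squaring and dividing by
  -- four gives the final `81 / 1024`.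
  have ha : 9 / 16 * e * Ln / A ≤
      trInner Rs (X (R.jhat (k + 1)) * R.atom (k + 1) - R.fit X k) := by
    rw [trInner_sub_right, div_le_iff₀ hApos]
    have h6 : 0 ≤ trInner Rs Ys - trInner Rs (R.fit X k) := by
      rw [← trInner_sub_right]
      exact le_trans (by positivity) h2
    have h7 : 3 / 4 * T ≤ T - trInner Rs (R.fit X k) := by linarith
    have h8 := mul_le_mul_of_nonneg_right h7 hApos.le
    linarith
  have hab : 9 / 16 * e * Ln / A ≤ 4 * (n * μ * Ln ^ 2) := by
    rw [div_le_iff₀ hApos]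
    have h9 : e ≤ 4 * (n * μ * Ln) * A := by
      refine le_of_sq_le_sq ?_ (by positivity)
      refine he4.trans ?_
      have h10 : (4 * (n * μ * Ln) * A) ^ 2 = 4 * (n * μ * Ln ^ 2) * (4 * μ * (A ^ 2 * n)) := by
        ring
      rw [h10, hAsq]
      refine le_mul_of_one_le_right (by positivity) ?_
      have h11 : (1 : ℝ) ≤ μ ^ 3 := one_le_pow₀ hμ
      have h12 : (1 : ℝ) ≤ kappa q d J r * μ ^ 3 := one_le_mul_of_one_le_of_one_le hκ1 h11
      nlinarith
    have h13 := mul_le_mul_of_nonneg_right h9 hLn.le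
    have h14 : 0 ≤ e * Ln := by positivity
    nlinarith
  have hdec := hline.decrease (by positivity) hab (by positivity) ha hb
  refine hdec.trans (le_of_eq ?_)
  congr 1
  have hAsq' : A ^ 2 = kappa q d J r * μ ^ 3 / n := by
    rw [← hAsq]; field_simp
  rw [div_pow, hAsq']
  field_simp
  ring

/-- Convergence of the second stage for a given approximation of the signal by candidates. -/
theorem second_stage_bound (hX : SpectrumBounded X μ) (hμ : 1 ≤ μ) (hn : 0 < n)
    (hX3 : RestrictedEigenvalue X μ (2 * K)) (hJ : J.card ≤ 2 * K) {Ln : ℝ} (hLn : 0 < Ln)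
    (hU : ∀ j ∈ J, U j ∈ Matrix.orthogonalGroup (Fin (q j)) ℝ)
    (hV : ∀ j ∈ J, V j ∈ Matrix.orthogonalGroup (Fin d) ℝ)
    (hR : ∀ k, 1 ≤ k → k ≤ K →
      R.jhat k ∈ J ∧
      (∃ S, R.atom k = candidate X r U V (R.jhat k) S ∧ nuclearNorm S ≤ Ln ∧
        IsScaledRankOne Ln S) ∧
      (∀ j ∈ J, ∀ S : Matrix (Fin (rowDim r (q j) d)) (Fin (colDim r (q j) d)) ℝ,
        nuclearNorm S ≤ Ln →
        trInner (signal X B + E - R.fit X (k - 1)) (X j * candidate X r U V j S) ≤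
          trInner (signal X B + E - R.fit X (k - 1)) (X (R.jhat k) * R.atom k)) ∧
      R.LineSearch X (signal X B + E) k)
    {S : ∀ j, Matrix (Fin (rowDim r (q j) d)) (Fin (colDim r (q j) d)) ℝ}
    (hS : ∑ j ∈ J, nuclearNorm (S j) ≤ Ln / 4) {β : ℝ}
    (hβ : frobNorm (signal X B - ∑ j ∈ J, X j * candidate X r U V j (S j)) ≤ β)
    {τ : ℝ} (hτ0 : 0 ≤ τ) (hτ : τ ≤ 1) {m : ℕ} (hm : m ≤ K) :
    frobNorm (signal X B - R.fit X m) ^ 2 ≤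
      6 * ((1 - τ ^ 2 / (64 * μ ^ 5 * kappa q d J r)) ^ m * (n * μ * Ln ^ 2)) +
        144 * (xiE X E ^ 2 * μ ^ 5 * kappa q d J r / n) + 146 * β ^ 2 := by
  have hμ0 : 0 < μ := by linarith
  have hn' : (0 : ℝ) < n := by positivity
  have hβ0 : 0 ≤ β := (frobNorm_nonneg _).trans hβ
  have hξ := xiE_nonneg X E
  set Y := signal X B + E with hY
  obtain ⟨Ys, hYs⟩ : ∃ Ys, Ys = ∑ j ∈ J, X j * candidate X r U V j (S j) := ⟨_, rfl⟩
  rw [← hYs] at hβ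
  have hsq : (√(n * μ) * Ln) ^ 2 = n * μ * Ln ^ 2 := by
    rw [mul_pow, Real.sq_sqrt (by positivity)]
  have hYsb : frobNorm Ys ≤ √(n * μ) * Ln := by
    rw [hYs]
    calc _ ≤ ∑ j ∈ J, frobNorm (X j * candidate X r U V j (S j)) := frobNorm_sum_le _ _
      _ ≤ ∑ j ∈ J, √(n * μ) * nuclearNorm (S j) := Finset.sum_le_sum fun j hj =>
          (frobNorm_mul_candidate_le hX hμ0 hn (hU j hj) (hV j hj) _).trans
            (mul_le_mul_of_nonneg_left (frobNorm_le_nuclearNorm _) (Real.sqrt_nonneg _))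
      _ = √(n * μ) * ∑ j ∈ J, nuclearNorm (S j) := by rw [Finset.mul_sum]
      _ ≤ _ := mul_le_mul_of_nonneg_left (by linarith) (Real.sqrt_nonneg _)
  have hspan : ∀ k ≤ K, frobNorm (R.fit X k) ≤ √(n * μ) * Ln ∧
      ∃ D : ∀ j, Matrix (Fin (rowDim r (q j) d)) (Fin (colDim r (q j) d)) ℝ,
        R.fit X k = ∑ j ∈ J, X j * candidate X r U V j (D j) := fun k hk =>
    exists_fit_eq hX hμ0 hn hLn.le hU hV (fun k h1 hk => by
      obtain ⟨a1, ⟨S', a2, a3, -⟩, -, a4⟩ := hR k h1 hk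
      exact ⟨a1, a4.1, S', a2, a3⟩) hk
  set A := √(kappa q d J r * μ ^ 3 / n) with hA
  have hA0 : 0 ≤ A := Real.sqrt_nonneg _
  -- The noise acts on the candidate span through `μ ξ_E` and the nuclear norm bound `A`; the misfit
  -- of `Ys` acts through its Frobenius norm.
  set η := μ * xiE X E * A + β with hη
  have hη0 : 0 ≤ η := by positivity
  have hdiff : ∀ k ≤ K, ∃ D : ∀ j, Matrix (Fin (rowDim r (q j) d)) (Fin (colDim r (q j) d)) ℝ,
      Ys - R.fit X k = ∑ j ∈ J, X j * candidate X r U V j (D j) := by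
    intro k hk
    obtain ⟨-, D, hD⟩ := hspan k hk
    refine ⟨fun j => S j - D j, ?_⟩
    simp only [candidate_sub, Matrix.mul_sub, Finset.sum_sub_distrib]
    rw [hYs, hD]
  have hcross : ∀ k ≤ K, |trInner (Y - Ys) (Ys - R.fit X k)| ≤
      η * frobNorm (Ys - R.fit X k) := by
    intro k hk
    obtain ⟨D, hD⟩ := hdiff k hk
    have h1 : Y - Ys = E + (signal X B - Ys) := by rw [hY]; abel
    have h2 : |trInner E (Ys - R.fit X k)| ≤ μ * xiE X E * (A * frobNorm (Ys - R.fit X k)) := by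
      have h3 := sum_nuclearNorm_le hX hμ0 hn hX3 hJ hU hV D
      rw [← hD] at h3
      calc |trInner E (Ys - R.fit X k)|
          ≤ ∑ j ∈ J, μ * xiE X E * nuclearNorm (D j) := by
            rw [hD, trInner_sum_right]
            exact (Finset.abs_sum_le_sum_abs _ _).trans (Finset.sum_le_sum fun j hj =>
              abs_trInner_candidate_le hX hμ0 (hU j hj) (hV j hj) _)
        _ = μ * xiE X E * ∑ j ∈ J, nuclearNorm (D j) := by rw [Finset.mul_sum]
        _ ≤ _ := mul_le_mul_of_nonneg_left h3 (by positivity)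
    have h4 : |trInner (signal X B - Ys) (Ys - R.fit X k)| ≤ β * frobNorm (Ys - R.fit X k) :=
      (abs_trInner_le _ _).trans (mul_le_mul_of_nonneg_right hβ (frobNorm_nonneg _))
    rw [h1, trInner_add_left]
    refine (abs_add_le _ _).trans ?_
    rw [hη]
    linarith
  set ρ := τ ^ 2 / (64 * μ ^ 5 * kappa q d J r) with hρ
  have hτ2 : τ ^ 2 ≤ 1 := pow_le_one₀ hτ0 hτ
  have hρ1 : ρ ≤ 1 := by
    -- For `κ = 0` division by zero makes `ρ` zero.
    rcases Nat.eq_zero_or_pos (kappa q d J r) with h0 | h0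
    · rw [hρ, h0]; simp
    · have h1 : (1 : ℝ) ≤ kappa q d J r := by exact_mod_cast h0
      have h2 : (1 : ℝ) ≤ μ ^ 5 := one_le_pow₀ hμ
      have h3 := one_le_mul_of_one_le_of_one_le h2 h1
      rw [hρ, div_le_one (by positivity)]
      nlinarith
  have hexpand : ∀ k, frobNorm (Y - R.fit X k) ^ 2 - frobNorm (Y - Ys) ^ 2 =
      frobNorm (Ys - R.fit X k) ^ 2 + 2 * trInner (Y - Ys) (Ys - R.fit X k) := by
    intro k
    have : Y - R.fit X k = (Y - Ys) + (Ys - R.fit X k) := by abel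
    rw [this, frobNorm_add_sq]
    ring
  have hmain := sq_le_of_contraction (e := fun k => frobNorm (Ys - R.fit X k))
    (g := fun k => frobNorm (Y - R.fit X k) ^ 2 - frobNorm (Y - Ys) ^ 2) (K := K) hη0 hρ1
    (fun k => frobNorm_nonneg _)
    (fun k hk => sub_le_sub_right (hR (k + 1) (by omega) hk).2.2.2.antitone _)
    (fun k hk => by
      rw [hexpand]
      have := (abs_le.1 (hcross k hk)).1
      linarith)
    (fun k hk => by
      rw [hexpand]
      have := (abs_le.1 (hcross k hk)).2
      linarith)
    (fun k hk he => by
      obtain ⟨hj, ⟨S', hS', hSn, -⟩, hmax, hline⟩ := hR (k + 1) (by omega) hk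
      obtain ⟨D, hD⟩ := hdiff k hk.le
      have hH : frobNorm (X (R.jhat (k + 1)) * R.atom (k + 1)) ≤ √(n * μ) * Ln := by
        rw [hS']
        exact (frobNorm_mul_candidate_le hX hμ0 hn (hU _ hj) (hV _ hj) S').trans
          (mul_le_mul_of_nonneg_left ((frobNorm_le_nuclearNorm S').trans hSn) (Real.sqrt_nonneg _))
      obtain ⟨hκ, hdec⟩ := second_stage_decrease hX hμ hn hX3 hJ hLn hU hV hline hmax hH
        (hspan k hk.le).1 hS hYs ⟨_, hj⟩ hYsb hD (hcross k hk.le) he hη0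
      have hκ' : (0 : ℝ) < kappa q d J r := by exact_mod_cast hκ
      have hc := (abs_le.1 (hcross k hk.le)).2
      have he0 := frobNorm_nonneg (Ys - R.fit X k)
      have hgk := hexpand k
      have hup : frobNorm (Y - R.fit X k) ^ 2 - frobNorm (Y - Ys) ^ 2 ≤
          3 / 2 * frobNorm (Ys - R.fit X k) ^ 2 := by nlinarith
      have hρ0 : 0 ≤ ρ := by positivity
      -- The excess is at most `3 / 2 * e²`, and `3 / 128 ≤ 81 / 1024`, so the guaranteed decrease
      -- covers `ρ` times the excess.
      have hρle : ρ * (3 / 2) ≤ 81 / 1024 / (kappa q d J r * μ ^ 4) := by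
        rw [hρ, div_mul_eq_mul_div, div_le_div_iff₀ (by positivity) (by positivity)]
        have h1 : μ ^ 4 ≤ μ ^ 5 := pow_le_pow_right₀ hμ (by norm_num)
        have h2 : τ ^ 2 * (kappa q d J r * μ ^ 4) ≤ 1 * (kappa q d J r * μ ^ 5) := by gcongr
        have h3 : 0 < kappa q d J r * μ ^ 5 := by positivity
        linarith
      have h5 : ρ * (frobNorm (Y - R.fit X k) ^ 2 - frobNorm (Y - Ys) ^ 2) ≤
          81 / 1024 * frobNorm (Ys - R.fit X k) ^ 2 / (kappa q d J r * μ ^ 4) := by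
        calc _ ≤ ρ * (3 / 2 * frobNorm (Ys - R.fit X k) ^ 2) :=
              mul_le_mul_of_nonneg_left hup hρ0
          _ = ρ * (3 / 2) * frobNorm (Ys - R.fit X k) ^ 2 := by ring
          _ ≤ 81 / 1024 / (kappa q d J r * μ ^ 4) * frobNorm (Ys - R.fit X k) ^ 2 :=
              mul_le_mul_of_nonneg_right hρle (sq_nonneg _)
          _ = _ := by ring
      linarith) hm
  simp only [RGAPath.fit, sub_zero] at hmain
  have h0 : frobNorm Ys ^ 2 ≤ n * μ * Ln ^ 2 := by
    rw [← hsq]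
    exact pow_le_pow_left₀ (frobNorm_nonneg _) hYsb 2
  have h1ρ : 0 ≤ (1 - ρ) ^ m := pow_nonneg (by linarith) m
  have h00 := mul_le_mul_of_nonneg_left h0 h1ρ
  have hη2 : η ^ 2 ≤ 2 * (xiE X E ^ 2 * μ ^ 5 * kappa q d J r / n) + 2 * β ^ 2 := by
    have h1 : (μ * xiE X E * A) ^ 2 = xiE X E ^ 2 * μ ^ 5 * kappa q d J r / n := by
      rw [mul_pow, hA, Real.sq_sqrt (by positivity)]
      ring
    rw [← h1, hη]
    nlinarith [sq_nonneg (μ * xiE X E * A - β)]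
  have hsplit : frobNorm (signal X B - R.fit X m) ^ 2 ≤
      2 * frobNorm (Ys - R.fit X m) ^ 2 + 2 * β ^ 2 := by
    have h1 : signal X B - R.fit X m = (Ys - R.fit X m) + (signal X B - Ys) := by abel
    have h2 := frobNorm_add_le (Ys - R.fit X m) (signal X B - Ys)
    rw [← h1] at h2
    have h3 := pow_le_pow_left₀ (frobNorm_nonneg _) (h2.trans (add_le_add_right hβ _)) 2
    nlinarith [sq_nonneg (frobNorm (Ys - R.fit X m) - β)]
  linarith

theorem leadingCols_mul_transpose_of_eq {m r : ℕ} (h : r ≤ m) (hr : r = m)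
    {U : Matrix (Fin m) (Fin m) ℝ} (hU : U ∈ Matrix.orthogonalGroup (Fin m) ℝ) :
    leadingCols h U * (leadingCols h U)ᵀ = 1 := by
  subst hr
  rw [leadingCols_mul_transpose]
  simp only [Fin.is_lt, if_true, Matrix.diagonal_one, Matrix.mul_one]
  exact (Matrix.mem_orthogonalGroup_iff (Fin r) ℝ).1 hU

open Classical in
/-- The signal is approximated by the candidates with its projected coefficient matrices. -/
theorem frobNorm_signal_sub_candidate_le (hX : SpectrumBounded X μ) (hμ : 0 < μ) (hn : 0 < n)
    (hsvd : ∀ j ∈ J, IsSVD ((X j)ᵀ * (signal X B + E)) (U j) (V j))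
    (hJB : ∀ j, j ∉ J → B j = 0) (hr : ∀ j, rbar X B j ≤ r) {η : ℝ} (hη : 0 < η)
    (hση : ∀ j ∈ largeRelevant X B, η ≤ singVal ((X j)ᵀ * signal X B) (rbar X B j - 1))
    (hrev : ∀ j ∈ largeRelevant X B, LocalRevelation X B j) :
    frobNorm (signal X B - ∑ j ∈ J, X j * candidate X r U V j (projCoord X B r U V j)) ≤
      √(n * μ) * (6 * (xiE X E / η) * (μ * ∑ j, nuclearNorm (B j))) *
        (if (largeRelevant X B).Nonempty then 1 else 0) := by
  have hξ := xiE_nonneg X E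
  have hind : (0 : ℝ) ≤ if (largeRelevant X B).Nonempty then 1 else 0 := by
    split_ifs <;> norm_num
  have hterm : ∀ j ∈ J, frobNorm (X j * B j - X j * candidate X r U V j (projCoord X B r U V j)) ≤
      √(n * μ) * (6 * (xiE X E / η) * (μ * nuclearNorm (B j))) *
        (if (largeRelevant X B).Nonempty then 1 else 0) := by
    intro j hj
    have hrhs : 0 ≤ √(n * μ) * (6 * (xiE X E / η) * (μ * nuclearNorm (B j))) *
        (if (largeRelevant X B).Nonempty then 1 else 0) := by
      have := nuclearNorm_nonneg (B j)
      positivity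
    obtain ⟨hU, hV, -⟩ := hsvd j hj
    have hdet := (Matrix.isUnit_iff_isUnit_det _).1 (hX.isUnit hμ j)
    obtain ⟨Z, hZ⟩ : ∃ Z, Z = sigmaHat X j * B j := ⟨_, rfl⟩
    have hBZ : B j = (sigmaHat X j)⁻¹ * Z := by
      rw [hZ, Matrix.nonsing_inv_mul_cancel_left _ _ hdet]
    -- The candidate at the projected coordinates is `Σ̂_j⁻¹ P Z Q` with `Z = Σ̂_j B_j` and `P`, `Q`
    -- the projections, so only `Z - P Z Q` matters.
    have heq : X j * B j - X j * candidate X r U V j (projCoord X B r U V j) =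
        X j * ((sigmaHat X j)⁻¹ * (Z - leadingCols (rowDim_le r (q j) d) (U j) *
          (leadingCols (rowDim_le r (q j) d) (U j))ᵀ * Z *
          (leadingCols (colDim_le r (q j) d) (V j) *
            (leadingCols (colDim_le r (q j) d) (V j))ᵀ))) := by
      rw [Matrix.mul_sub (sigmaHat X j)⁻¹, ← hBZ, Matrix.mul_sub, candidate, projCoord, ← hZ]
      simp only [Matrix.mul_assoc]
    rw [heq]
    refine (hX.frobNorm_mul_inv_le hμ hn j _).trans ?_
    by_cases hlt : r < min (q j) d
    · by_cases hB : B j = 0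
      · have : Z = 0 := by rw [hZ, hB, Matrix.mul_zero]
        rw [this, Matrix.mul_zero, Matrix.zero_mul, sub_zero, frobNorm_zero, mul_zero]
        exact hrhs
      -- A relevant block truncated at `r` belongs to `J_o`, because `r` dominates its rank `r̄_j`;
      -- local revelation is therefore available where it is needed.
      have hjl : j ∈ largeRelevant X B := ⟨hB, (hr j).trans_lt hlt⟩
      obtain ⟨U₀, V₀, h₀, Lam, hLam⟩ := hrev j hjl
      have hsvd' := hsvd j hj
      rw [Matrix.mul_add] at hsvd'
      have hb := frobNorm_sub_projection_le h₀ hsvd' (rbar_le_left X B j) (rbar_le_right X B j)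
        (rowDim_le r (q j) d) (colDim_le r (q j) d)
        (by rw [rowDim, if_pos hlt]; exact hr j) (by rw [colDim, if_pos hlt]; exact hr j)
        hη (hση j hjl) Lam (hZ.trans hLam)
      rw [if_pos ⟨j, hjl⟩, mul_one]
      refine mul_le_mul_of_nonneg_left (hb.trans ?_) (Real.sqrt_nonneg _)
      have h1 := opNorm_le_xiE X E j
      have h2 : frobNorm Z ≤ μ * nuclearNorm (B j) := by
        rw [hZ]
        exact (TSRGA.frobNorm_mul_le _ _).trans
          (mul_le_mul (hX.opNorm_le hμ j) (frobNorm_le_nuclearNorm _) (frobNorm_nonneg _) hμ.le)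
      have := frobNorm_nonneg Z
      gcongr
    · have hP := leadingCols_mul_transpose_of_eq (rowDim_le r (q j) d)
        (by rw [rowDim, if_neg hlt]) hU
      have hQ := leadingCols_mul_transpose_of_eq (colDim_le r (q j) d)
        (by rw [colDim, if_neg hlt]) hV
      rw [hP, hQ, Matrix.one_mul, Matrix.mul_one, sub_self, frobNorm_zero, mul_zero]
      exact hrhs
  rw [signal_eq_sum X hJB, ← Finset.sum_sub_distrib]
  calc _ ≤ _ := frobNorm_sum_le _ _
    _ ≤ ∑ j ∈ J, √(n * μ) * (6 * (xiE X E / η) * (μ * nuclearNorm (B j))) *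
        (if (largeRelevant X B).Nonempty then 1 else 0) := Finset.sum_le_sum hterm
    _ = √(n * μ) * (6 * (xiE X E / η) * (μ * ∑ j ∈ J, nuclearNorm (B j))) *
        (if (largeRelevant X B).Nonempty then 1 else 0) := by
        simp only [Finset.mul_sum, Finset.sum_mul]
    _ ≤ _ := by
        have : ∑ j ∈ J, nuclearNorm (B j) ≤ ∑ j, nuclearNorm (B j) :=
          Finset.sum_le_sum_of_subset_of_nonneg (Finset.subset_univ _)
            fun j _ _ => nuclearNorm_nonneg _
        gcongr

end SecondStageConvergence

end TSRGA

namespace TSRGA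

/-! ### The two-stage algorithm -/

section TwoStage

variable {n p d : ℕ} {q : Fin p → ℕ} {X : Predictors n q} {E : Matrix (Fin n) (Fin d) ℝ}
  {B : Coefs q d}

theorem rank_add_le {m l : ℕ} (A A' : Matrix (Fin m) (Fin l) ℝ) :
    (A + A').rank ≤ A.rank + A'.rank := by
  rw [Matrix.rank, Matrix.mulVecLin_add]
  exact (Submodule.finrank_mono (LinearMap.range_add_le _ _)).trans
    (Submodule.finrank_add_le_finrank_add_finrank _ _)

theorem rank_sum_le {ι : Type*} {m l : ℕ} (J : Finset ι) (A : ι → Matrix (Fin m) (Fin l) ℝ) :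
    (∑ j ∈ J, A j).rank ≤ ∑ j ∈ J, (A j).rank := by
  classical
  induction J using Finset.induction_on with
  | empty => simp
  | insert a J ha ih =>
    rw [Finset.sum_insert ha, Finset.sum_insert ha]
    exact (rank_add_le _ _).trans (Nat.add_le_add_left ih _)

/-- The rank of `X_jᵀ Ỹ` is at most that of `Ỹ`, hence at most the sum of the block ranks; this is
why the rank sum of the first stage is a safe truncation level. -/
theorem rbar_le_sum {J : Finset (Fin p)} (hJB : ∀ j, j ∉ J → B j = 0) (j : Fin p) :
    rbar X B j ≤ ∑ i ∈ J, (B i).rank := by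
  refine (Matrix.rank_mul_le_right _ _).trans ?_
  rw [signal_eq_sum X hJB]
  exact (rank_sum_le _ _).trans (Finset.sum_le_sum fun i _ => Matrix.rank_mul_le_right _ _)

open Classical in
/-- The error bound for the second stage at a sample, when the first stage has found all relevant
predictors and at least their ranks. -/
theorem normalized_error_le {R₁ R₂ : RGAPath q d} {kh K : ℕ} {μ L L₀ δ τ : ℝ} (hn : 0 < n)
    (hd : 0 < d) (hX : SpectrumBounded X μ) (hμ : 1 ≤ μ)
    (hX3 : RestrictedEigenvalue X μ (2 * K)) (hL₀ : 0 < L₀) (hLL₀ : μ * L ≤ L₀ / 4)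
    (hL : ∑ j, nuclearNorm (B j) ≤ √(d : ℝ) * L) (hδ : 0 < δ)
    (hσ : ∀ j ∈ largeRelevant X B,
      n * δ ≤ singVal ((X j)ᵀ * signal X B) (rbar X B j - 1))
    (hrev : ∀ j ∈ largeRelevant X B, LocalRevelation X B j) (hkh : kh ≤ K)
    (hrank : ∀ j, (B j).rank ≤ (R₁.coef kh j).rank)
    (hR : R₂.IsSecondStage X (signal X B + E) (√(d : ℝ) * L₀) (R₁.selected kh) (R₁.rankSum kh) K)
    (hτ0 : 0 ≤ τ) (hτ : τ ≤ 1) {m : ℕ} (hm : m ≤ K) :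
    ((n : ℝ) * d)⁻¹ * frobNorm (signal X B - R₂.fit X m) ^ 2 ≤
      (6 * μ * L₀ ^ 2 + 144 * μ ^ 5 + 5256 * μ ^ 3 * L ^ 2) *
      ((1 - τ ^ 2 / (64 * μ ^ 5 * kappa q d (R₁.selected kh) (R₁.rankSum kh))) ^ m +
        (m + kappa q d (R₁.selected kh) (R₁.rankSum kh)) * xiE X E ^ 2 / ((n : ℝ) ^ 2 * d) +
        xiE X E ^ 2 / (δ ^ 2 * (n : ℝ) ^ 2) *
          (if (largeRelevant X B).Nonempty then 1 else 0)) := by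
  have hμ0 : 0 < μ := by linarith
  have hn' : (0 : ℝ) < n := by positivity
  have hd' : (0 : ℝ) < d := by positivity
  have hsd : 0 < √(d : ℝ) := Real.sqrt_pos.2 hd'
  obtain ⟨U, V, hsvd, hsteps⟩ := hR
  set J := R₁.selected kh with hJdef
  set r := R₁.rankSum kh with hr
  -- An unselected predictor has a zero estimate, so matching ranks implies that nothing relevant
  -- was missed.
  have hJB : ∀ j, j ∉ J → B j = 0 := by
    intro j hj
    by_contra h
    have h1 := rank_pos_of_ne_zero h
    have h2 := hrank j
    rw [R₁.coef_eq_zero hj, Matrix.rank_zero] at h2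
    omega
  have hJcard : J.card ≤ 2 * K := by
    have : J.card ≤ kh := R₁.card_selected_le kh
    omega
  have hrb : ∀ j, rbar X B j ≤ r := fun j =>
    (rbar_le_sum hJB j).trans (Finset.sum_le_sum fun i _ => hrank i)
  have happrox := frobNorm_signal_sub_candidate_le hX hμ0 hn hsvd hJB hrb
    (by positivity : 0 < n * δ) hσ hrev
  have hS : ∑ j ∈ J, nuclearNorm (projCoord X B r U V j) ≤ √(d : ℝ) * L₀ / 4 := by
    calc _ ≤ ∑ j ∈ J, μ * nuclearNorm (B j) := Finset.sum_le_sum fun j hj =>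
          nuclearNorm_projCoord_le hX hμ0 (hsvd j hj).1 (hsvd j hj).2.1
      _ ≤ ∑ j, μ * nuclearNorm (B j) := Finset.sum_le_sum_of_subset_of_nonneg
          (Finset.subset_univ _) fun j _ _ => mul_nonneg hμ0.le (nuclearNorm_nonneg _)
      _ = μ * ∑ j, nuclearNorm (B j) := by rw [Finset.mul_sum]
      _ ≤ μ * (√(d : ℝ) * L) := mul_le_mul_of_nonneg_left hL hμ0.le
      _ = √(d : ℝ) * (μ * L) := by ring
      _ ≤ √(d : ℝ) * (L₀ / 4) := mul_le_mul_of_nonneg_left hLL₀ hsd.le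
      _ = _ := by ring
  have hξ := xiE_nonneg X E
  set ind : ℝ := if (largeRelevant X B).Nonempty then 1 else 0 with hind
  have hind0 : 0 ≤ ind := by rw [hind]; split_ifs <;> norm_num
  have hind2 : ind ^ 2 = ind := by rw [hind]; split_ifs <;> norm_num
  have hβ : frobNorm (signal X B - ∑ j ∈ J, X j * candidate X r U V j (projCoord X B r U V j)) ≤
      √(n * μ) * (6 * (xiE X E / (n * δ)) * (μ * (√(d : ℝ) * L))) * ind := by
    refine happrox.trans ?_
    gcongr
  have hbound := second_stage_bound hX hμ hn hX3 hJcard (by positivity : 0 < √(d : ℝ) * L₀)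
    (fun j hj => (hsvd j hj).1) (fun j hj => (hsvd j hj).2.1) hsteps hS hβ hτ0 hτ hm
  set κ := kappa q d J r with hκ
  set ρ := τ ^ 2 / (64 * μ ^ 5 * (κ : ℝ)) with hρ
  have hρ1 : ρ ≤ 1 := by
    rcases Nat.eq_zero_or_pos κ with h0 | h0
    · rw [hρ, h0]; simp
    · have h1 : (1 : ℝ) ≤ κ := by exact_mod_cast h0
      have h2 : (1 : ℝ) ≤ μ ^ 5 := one_le_pow₀ hμ
      have h3 := one_le_mul_of_one_le_of_one_le h2 h1
      have h4 : τ ^ 2 ≤ 1 := pow_le_one₀ hτ0 hτ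
      rw [hρ, div_le_one (by positivity)]
      linarith
  have ha0 : 0 ≤ (1 - ρ) ^ m := pow_nonneg (by linarith) m
  have hb0 : 0 ≤ κ * xiE X E ^ 2 / ((n : ℝ) ^ 2 * d) := by positivity
  have hb1 : κ * xiE X E ^ 2 / ((n : ℝ) ^ 2 * d) ≤
      (m + κ) * xiE X E ^ 2 / ((n : ℝ) ^ 2 * d) := by
    gcongr
    exact le_add_of_nonneg_left (Nat.cast_nonneg m)
  have hc0 : 0 ≤ xiE X E ^ 2 / (δ ^ 2 * (n : ℝ) ^ 2) * ind := by positivity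
  -- `5256 = 146 · 6²`, from squaring the approximation error; the indicator equals its own square.
  have hnum : ((n : ℝ) * d)⁻¹ * frobNorm (signal X B - R₂.fit X m) ^ 2 ≤
      6 * μ * L₀ ^ 2 * (1 - ρ) ^ m + 144 * μ ^ 5 * (κ * xiE X E ^ 2 / ((n : ℝ) ^ 2 * d)) +
        5256 * μ ^ 3 * L ^ 2 * (xiE X E ^ 2 / (δ ^ 2 * (n : ℝ) ^ 2) * ind) := by
    refine (mul_le_mul_of_nonneg_left hbound (by positivity)).trans (le_of_eq ?_)
    rw [mul_pow _ ind, hind2, mul_pow √(n * μ), Real.sq_sqrt (by positivity), mul_pow √(d : ℝ),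
      Real.sq_sqrt hd'.le, mul_pow (6 * _), mul_pow μ, mul_pow √(d : ℝ), Real.sq_sqrt hd'.le]
    field_simp
    ring
  have hx : 0 ≤ 6 * μ * L₀ ^ 2 := by positivity
  have hy : 0 ≤ 144 * μ ^ 5 := by positivity
  have hz : 0 ≤ 5256 * μ ^ 3 * L ^ 2 := by positivity
  refine hnum.trans ?_
  generalize (1 - ρ) ^ m = a at *
  generalize κ * xiE X E ^ 2 / ((n : ℝ) ^ 2 * d) = b at *
  generalize (m + κ) * xiE X E ^ 2 / ((n : ℝ) ^ 2 * d) = b' at *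
  generalize xiE X E ^ 2 / (δ ^ 2 * (n : ℝ) ^ 2) * ind = c at *
  have hb' : 0 ≤ b' := hb0.trans hb1
  calc _ ≤ (6 * μ * L₀ ^ 2 + 144 * μ ^ 5 + 5256 * μ ^ 3 * L ^ 2) * a +
        (6 * μ * L₀ ^ 2 + 144 * μ ^ 5 + 5256 * μ ^ 3 * L ^ 2) * b' +
        (6 * μ * L₀ ^ 2 + 144 * μ ^ 5 + 5256 * μ ^ 3 * L ^ 2) * c := by
        refine add_le_add (add_le_add ?_ ?_) ?_
        · exact mul_le_mul_of_nonneg_right (by linarith) ha0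
        · exact mul_le_mul (by linarith) hb1 hb0 (by linarith)
        · exact mul_le_mul_of_nonneg_right (by linarith) hc0
    _ = _ := by ring

end TwoStage

/-! ### Asymptotics -/

/-- A sequence with a deterministic bound on events of probability tending to one, and a further
event of limiting probability at least `1 - ε` for every `ε`, is stochastically bounded. -/
theorem isBigOp_one_of_good_events {Ω : ℕ → Type*} [∀ n, MeasurableSpace (Ω n)]
    {P : ∀ n, Measure (Ω n)} {x u v : ∀ n, Ω n → ℝ} {G : ∀ n, Set (Ω n)} (hG : WPA1 P G)
    (huv : IsBigOp P u v) {M : ℝ}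
    (h : ∀ M' : ℝ, ∀ᶠ n in atTop, ∀ ω ∈ G n, u n ω / v n ω ≤ M' → x n ω ≤ M) :
    IsBigOp P x fun _ _ => 1 := by
  intro ε hε
  obtain ⟨M', hM'⟩ := huv (ε / 2) (by positivity)
  -- The bound `M` does not depend on `ε`; only the sample size from which it holds does, through
  -- `M'`. The probabilities sum to `3 ε / 4`, which leaves room for the strict inequality of the
  -- limsup.
  refine ⟨M, ?_⟩
  have h1 := eventually_lt_of_limsup_lt hM'
  have h2 : ∀ᶠ n in atTop, P n (G n)ᶜ < ENNReal.ofReal (ε / 4) :=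
    hG.eventually_lt_const (by rw [ENNReal.ofReal_pos]; positivity)
  have h3 : ∀ᶠ n in atTop, P n {ω | M < x n ω / 1} ≤ ENNReal.ofReal (3 * ε / 4) := by
    filter_upwards [h1, h2, h M'] with n h1 h2 h3
    have hsub : {ω | M < x n ω / 1} ⊆ (G n)ᶜ ∪ {ω | M' < u n ω / v n ω} := by
      intro ω hω
      by_contra hc
      rw [Set.mem_union, not_or, Set.mem_compl_iff, not_not] at hc
      have := h3 ω hc.1 (not_lt.1 hc.2)
      rw [Set.mem_ofPred_eq, div_one] at hω
      linarith
    calc _ ≤ _ := measure_mono hsub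
      _ ≤ _ := measure_union_le _ _
      _ ≤ ENNReal.ofReal (ε / 4) + ENNReal.ofReal (ε / 2) := add_le_add h2.le h1.le
      _ = ENNReal.ofReal (3 * ε / 4) := by
        rw [← ENNReal.ofReal_add (by positivity) (by positivity)]
        congr 1
        ring
  refine (limsup_le_of_le (by isBoundedDefault) h3).trans_lt ?_
  rw [ENNReal.ofReal_lt_ofReal_iff hε]
  linarith

theorem WPA1.inter {Ω : ℕ → Type*} [∀ n, MeasurableSpace (Ω n)] {P : ∀ n, Measure (Ω n)}
    {A A' : ∀ n, Set (Ω n)} (h : WPA1 P A) (h' : WPA1 P A') : WPA1 P fun n => A n ∩ A' n := by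
  have h0 := Tendsto.add h h'
  rw [add_zero] at h0
  refine tendsto_of_tendsto_of_tendsto_of_le_of_le tendsto_const_nhds h0 (fun _ => zero_le)
    fun n => ?_
  simp only [Set.compl_inter]
  exact measure_union_le _ _

end TSRGA

/-! ### The theorem: choice of the threshold constant, rates and good events -/

theorem theorem3 (μ L εL L₀ M₀ : ℝ) (hμ : 0 < μ) (hεL : εL < 1) (hεμ : 1 - εL ≤ μ⁻¹ ^ 2 / 4)
    (hL₀ : 0 < L₀) (hLL₀ : L / (1 - εL) ≤ L₀) (hM₀ : 0 < M₀) :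
    ∃ C₀ : ℝ, 0 < C₀ ∧ ∀ C : ℝ, 0 < C → C ≤ C₀ → ∀ τ : ℝ, 0 < τ → τ < 1 →
      ∀ (Ω : ℕ → Type*) [∀ n, MeasurableSpace (Ω n)] (P : ∀ n, MeasureTheory.Measure (Ω n))
        [∀ n, MeasureTheory.IsProbabilityMeasure (P n)]
        (D : TSRGA.RegressionModel Ω) (K : ℕ → ℕ) (s δ : ℕ → ℝ) (T : TSRGA.TwoStageRun D),
        D.C1 P μ → D.C2 P K → D.C3 P μ K → D.C4 L K s → D.C5 P δ → D.C6 P →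
        D.NoiseLevel P M₀ →
        T.IsTSRGA L₀ (fun n => C * (s n ^ 2)⁻¹) K →
        TSRGA.IsBigOp P
          (fun n ω => ⨆ m : Set.Icc 1 (K n),
            (((n : ℝ) * D.d n)⁻¹ * TSRGA.frobNorm (D.Ytilde n ω - T.Ghat n ω m) ^ 2) /
              ((1 - τ ^ 2 / (64 * μ ^ 5 * T.kappa (fun n => C * (s n ^ 2)⁻¹) K n ω)) ^ (m : ℕ) +
                ((m : ℕ) + T.kappa (fun n => C * (s n ^ 2)⁻¹) K n ω) * D.xi n ω ^ 2 /
                  ((n : ℝ) ^ 2 * D.d n) +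
                D.xi n ω ^ 2 / (δ n ^ 2 * (n : ℝ) ^ 2) * D.indJo n ω))
          (fun _ _ => 1) := by

  have hM : 0 < 2 * μ * L₀ ^ 2 + 2 * M₀ := by positivity
  have hc : 0 < 1 / (64 * μ ^ 3 * L₀ ^ 2) := by positivity
  -- Guaranteed decrease divided by twice the bound on the initial training error; the factor two
  -- makes the comparison with the stopping rule strict.
  refine ⟨1 / (64 * μ ^ 3 * L₀ ^ 2) / (2 * (2 * μ * L₀ ^ 2 + 2 * M₀)), by positivity, ?_⟩
  intro C hC hC₀ τ hτ0 hτ1 Ω _ P _ D K s δ T h1 h2 h3 h4 h5 h6 hNL hT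
  obtain ⟨hL, hs, -, hsK, hsB⟩ := h4
  obtain ⟨hK, hξ⟩ := h2
  obtain ⟨hδ, -, hσ⟩ := h5
  have hLsum : ∀ n, ∑ j, TSRGA.nuclearNorm (D.Bstar n j) ≤ √(D.d n : ℝ) * L := by
    intro n
    have hd : 0 < √(D.d n : ℝ) := Real.sqrt_pos.2 (by exact_mod_cast D.d_pos n)
    have := hL n
    rwa [inv_mul_le_iff₀ hd] at this
  have hL0 : 0 ≤ L := le_trans (mul_nonneg (by positivity)
    (Finset.sum_nonneg fun j _ => TSRGA.nuclearNorm_nonneg _)) (hL 0)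
  have hKr : Filter.Tendsto (fun n => (K n : ℝ)) Filter.atTop Filter.atTop :=
    tendsto_natCast_atTop_atTop.comp hK
  have hKinv : Filter.Tendsto (fun n => (K n : ℝ)⁻¹) Filter.atTop (nhds 0) :=
    tendsto_inv_atTop_zero.comp hKr
  have hs2 : Filter.Tendsto (fun n => s n ^ 2 / (K n : ℝ)) Filter.atTop (nhds 0) :=
    hsK.tendsto_div_nhds_zero
  have hs1 : Filter.Tendsto (fun n => s n / (K n : ℝ)) Filter.atTop (nhds 0) := by
    refine squeeze_zero (fun n => div_nonneg (hs n).le (Nat.cast_nonneg _)) (fun n => ?_)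
      (by simpa using hs2.add hKinv)
    rw [← one_div, ← add_div]
    refine div_le_div_of_nonneg_right ?_ (Nat.cast_nonneg _)
    nlinarith [sq_nonneg (s n - 1)]
  have hsroot : Filter.Tendsto (fun n => L * √(s n) / (K n : ℝ)) Filter.atTop (nhds 0) := by
    have h0 : Filter.Tendsto (fun n => L * (s n / (K n : ℝ) + (K n : ℝ)⁻¹))
        Filter.atTop (nhds 0) := by
      simpa using (hs1.add hKinv).const_mul L
    refine squeeze_zero (fun n => by positivity) (fun n => ?_) h0
    rw [← one_div, ← add_div, mul_div_assoc]
    refine mul_le_mul_of_nonneg_left (div_le_div_of_nonneg_right ?_ (Nat.cast_nonneg _)) hL0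
    nlinarith [Real.sq_sqrt (hs n).le, sq_nonneg (√(s n) - 1)]
  have hexp : Filter.Tendsto (fun n => Real.exp (-(C * (s n ^ 2)⁻¹ * K n)) *
      (2 * μ * L₀ ^ 2 + 2 * M₀)) Filter.atTop (nhds 0) := by
    have h0 : Filter.Tendsto (fun n => C * (s n ^ 2)⁻¹ * (K n : ℝ)) Filter.atTop
        Filter.atTop := by
      have hpos : ∀ᶠ n in Filter.atTop, 0 < s n ^ 2 / (K n : ℝ) := by
        filter_upwards [hK.eventually_ge_atTop 1] with n hn
        have : (0 : ℝ) < K n := by exact_mod_cast hn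
        have := hs n
        positivity
      have := (tendsto_nhdsWithin_iff.2 ⟨hs2, hpos⟩).inv_tendsto_nhdsGT_zero.const_mul_atTop hC
      refine this.congr fun n => ?_
      simp only [Pi.inv_apply, inv_div]
      ring
    simpa using (Real.tendsto_exp_neg_atTop_nhds_zero.comp h0).mul_const _
  refine TSRGA.isBigOp_one_of_good_events
    (M := 6 * μ * L₀ ^ 2 + 144 * μ ^ 5 + 5256 * μ ^ 3 * L ^ 2)
    (((((TSRGA.WPA1.inter h1 h3).inter hσ).inter h6).inter hNL)) hξ ?_
  intro M'
  -- The normalized cross-term bound is `ν = (L + L₀) |M'| / K`, from `K ξ_E ≤ M' n √d`; it vanishes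
  -- even after multiplication by `s`, since `s ≤ s² + 1` is negligible against `K`.
  have hν1 : Filter.Tendsto (fun n => 8 * ((L + L₀) * |M'| / K n) * (μ * s n))
      Filter.atTop (nhds 0) := by
    have := hs1.const_mul (8 * ((L + L₀) * |M'|) * μ)
    rw [mul_zero] at this
    exact this.congr fun n => by ring
  have hν2 : Filter.Tendsto (fun n => 4 * ((L + L₀) * |M'| / K n) * M₀)
      Filter.atTop (nhds 0) := by
    have := hKinv.const_mul (4 * ((L + L₀) * |M'|) * M₀)
    rw [mul_zero] at this
    exact this.congr fun n => by ring
  filter_upwards [Filter.eventually_gt_atTop 0, hK.eventually_ge_atTop 1,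
    hν1.eventually_le_const one_pos, hν2.eventually_le_const one_pos,
    hsroot.eventually_le_const one_pos,
    hexp.eventually_lt_const (by positivity : 0 < 1 / (2 * M₀))]
    with n hn hKn hν1 hν2 hsroot hexp
  rintro ω ⟨⟨⟨⟨hX, hX3⟩, hσ⟩, hrev⟩, hE⟩ hM'
  have hX' : TSRGA.SpectrumBounded (D.X n ω) μ := hX
  have hX3' : TSRGA.RestrictedEigenvalue (D.X n ω) μ (2 * K n) := hX3
  have hμ1 : 1 ≤ μ := hX'.one_le hμ (D.q_pos n ⟨0, D.p_pos n⟩)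
  have hd := D.d_pos n
  have hn' : (0 : ℝ) < n := by exact_mod_cast hn
  have hd' : (0 : ℝ) < D.d n := by exact_mod_cast hd
  have hsd : 0 < √(D.d n : ℝ) := Real.sqrt_pos.2 hd'
  have hKn' : (0 : ℝ) < K n := by exact_mod_cast hKn
  -- The condition on `εL` gives `L ≤ L₀ μ⁻² / 4`, with a factor `μ` to spare.
  have hμL : μ * L ≤ L₀ / 4 := by
    have a1 : L ≤ L₀ * (1 - εL) := (div_le_iff₀ (by linarith)).1 hLL₀
    have a2 : L ≤ L₀ * (μ⁻¹ ^ 2 / 4) := a1.trans (mul_le_mul_of_nonneg_left hεμ hL₀.le)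
    have a3 : μ⁻¹ ≤ 1 := inv_le_one_of_one_le₀ hμ1
    calc μ * L ≤ μ * (L₀ * (μ⁻¹ ^ 2 / 4)) := mul_le_mul_of_nonneg_left a2 hμ.le
      _ = L₀ / 4 * μ⁻¹ := by field_simp
      _ ≤ L₀ / 4 := mul_le_of_le_one_right (by positivity) a3
  have hLL : L ≤ L₀ := by nlinarith
  obtain ⟨hfirst, hsecond⟩ := hT n ω
  have hνE : (L + L₀) * TSRGA.xiE (D.X n ω) (D.E n ω) ≤
      (L + L₀) * |M'| / K n * (n * √(D.d n : ℝ)) := by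
    have b1 : K n * D.xi n ω ≤ |M'| * (n * √(D.d n : ℝ)) :=
      (div_le_iff₀ (by positivity)).1 (hM'.trans (le_abs_self M'))
    have b2 : D.xi n ω ≤ |M'| / K n * (n * √(D.d n : ℝ)) := by
      rw [div_mul_eq_mul_div, le_div_iff₀ hKn']
      linarith
    calc _ ≤ (L + L₀) * (|M'| / K n * (n * √(D.d n : ℝ))) :=
          mul_le_mul_of_nonneg_left b2 (by linarith)
      _ = _ := by ring
  have ht1 : C * (s n ^ 2)⁻¹ * (2 * μ * L₀ ^ 2 + 2 * M₀) * s n ^ 2 <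
      1 / (64 * μ ^ 3 * L₀ ^ 2) := by
    have c1 := (le_div_iff₀ (by positivity)).1 hC₀
    have c2 : C * (s n ^ 2)⁻¹ * (2 * μ * L₀ ^ 2 + 2 * M₀) * s n ^ 2 =
        C * (2 * μ * L₀ ^ 2 + 2 * M₀) := by
      have := (hs n).ne'
      field_simp
    have c3 : 0 < C * (2 * μ * L₀ ^ 2 + 2 * M₀) := by positivity
    linarith
  have hrank := TSRGA.rank_le_rank_coef_stopTime hn hd hμ hX' hX3' (hLsum n) hLL hL₀ (hs n)
    (hsB n) ((div_le_one hKn').1 hsroot) hM₀ hE hfirst hνE hν1 hν2 ht1 hexp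
  have hfac : 0 ≤ 6 * μ * L₀ ^ 2 + 144 * μ ^ 5 + 5256 * μ ^ 3 * L ^ 2 := by positivity
  refine Real.iSup_le (fun m => ?_) hfac
  have hbound := TSRGA.normalized_error_le hn hd hX' hμ1 hX3' hL₀ hμL (hLsum n) (hδ n) hσ hrev
    (TSRGA.RGAPath.stopTime_le _ _ _ _ _) hrank hsecond hτ0.le hτ1.le m.2.2
  refine div_le_of_le_mul₀ ?_ hfac hbound
  -- The denominator is nonnegative because a positive multiple of it dominates the nonnegative
  -- error.
  by_contra! hneg
  have hnn : 0 ≤ ((n : ℝ) * D.d n)⁻¹ *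
      TSRGA.frobNorm (D.Ytilde n ω - T.Ghat n ω m) ^ 2 := by positivity
  have := hnn.trans hbound
  have hfac' : 0 < 6 * μ * L₀ ^ 2 + 144 * μ ^ 5 + 5256 * μ ^ 3 * L ^ 2 := by positivity
  exact absurd (nonneg_of_mul_nonneg_right this hfac') (not_le.2 hneg)
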